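/- **Setting.** Let $N,n,m\ge1$ and consider $N$ agents $x_i(t+1)=A_ix_i(t)+B_iu_i(t)$, $x_i\in\mathbb R^n$, $u_i\in\mathbb R^m$, with $\mathcal A=\mathrm{diag}(A_i)$, $\mathcal B=\mathrm{diag}(B_i)$. Let $\varrho\in(0,1]$ be a discount factor, $Q=G\odot\tilde Q$ (Khatri–Rao product of $G\in\mathbb R^{N\times N}$, $G\succeq0$, and $\tilde Q\in\mathbb R^{nN\times nN}$, $\tilde Q\succeq 0$), $R=\mathrm{diag}(R_i)\succ0$, and $x(0)\sim\mathcal D$ bounded with $\Sigma_x=\mathbb E[x(0)x(0)^\top]\succ0$. The cost graph has the edges $(i,j)$ with $G_{ij}\ne0$, and all self-loops ($G_{ii}\neq0$); $\mathcal N_C^j$ is the set of neighbours of $j$ in it. The sensing graph is a directed graph with self-loops; agent $i$ senses the agents in $\mathcal N_S^i$. The structured gains form $\mathbb K_d=\{K: K(i,j)=0\text{ if }j\notin\mathcal N_S^i\}$, where $K(i,j)$ is the $m\times n$ block; they are identified isometrically with $\mathbf K=(\mathbf K_1,\dots,\mathbf K_N)$, $\mathbf K_i\in\mathbb R^{q_i}$,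 $q_i=mn|\mathcal N_S^i|$. Let $\mathbb K_s=\{K:\sqrt\varrho(\mathcal A-\mathcal BK)\text{ is Schur stable}\}$ and $J(K)=\mathbb E\sum_{t\ge0}\varrho^tx(t)^\top(Q+K^\top RK)x(t)$ along $x(t+1)=(\mathcal A-\mathcal BK)x(t)$. Let $\mathcal V_S^i$ be the set of agents reachable from $i$ in the sensing graph, $\mathcal N_L^i=\bigcup_{j\in\mathcal V_S^i}\mathcal N_C^j$ the neighbours of $i$ in the learning graph, $M_i$ the matrix that agrees with $G$ on $\mathcal N_L^i\times\mathcal N_L^i$ and is zero elsewhere, $\hat Q_i=M_i\odot\tilde Q$, $\hat R_i$ the matrix $R$ with the blocks $R_j$, $j\notin\mathcal N_L^i$, replaced by $0$. Put $H_{i,T}(K,x(0))=\sum_{t<T}\varrho^tx(t)^\top(\hat Q_i+K^\top\hat R_iK)x(t)$, $H_i=H_{i,\infty}$ and $J_i(K)=\mathbb E[H_i(K,x(0))]$. **Algorithm.** Inputs: $\eta>0$, $r_i>0$, an assignment of the agents to clusters $\mathcal V_1,\dots,\mathcal V_s$ such that distinct agents of a cluster are not adjacent in the learning graph, an update order $z_k$,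 weights $w_i^k\ge0$ determined by the past, horizons $T_J(k)$ (which may depend on the past and on the samples of step $k$), and $K^0\in\mathbb K_d\cap\mathbb K_s$. At step $k=0,\dots,T_K-1$ draw $x(0)\sim\mathcal D$ and, for $i\in\mathcal V_{z_k}$, $\mathbf D_i(k)$ uniform on the unit sphere of $\mathbb R^{q_i}$, independently of each other and of the past; put $\hat{\mathbf K}_i^k=\mathbf K_i^k+w_i^k(\mathbf K_i^k-\mathbf K_i^{k_{prev}})$, where $\mathbf K_i^{k_{prev}}$ is the value of block $i$ before its last update ($\mathbf K_i^0$ if there was none), and $\mathbf K_i^{k+1}=\hat{\mathbf K}_i^k-\eta\frac{q_i}{r_i}H_{i,T_J(k)}(K^{i,k},x(0))\mathbf D_i(k)$, where $K^{i,k}$ is $\mathbf K^k$ with block $i$ replaced by $\hat{\mathbf K}_i^k+r_i\mathbf D_i(k)$. For $i\notin\mathcal V_{z_k}$, $\mathbf K_i^{k+1}=\mathbf K_i^k$. **Constants.** On $\mathbb K_d\cap\mathbb K_s$ the series and expectations above converge, $J$ is differentiable, and there exist positive continuous functions $\lambda,\zeta,\phi,\beta$ on it such that for each $K\in\mathbb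 K_d\cap\mathbb K_s$: every structured $K'$ with $\|K'-K\|_F\le\zeta_K$ lies in $\mathbb K_s$ and $|J(K')-J(K)|\le\lambda_K\|K'-K\|_F$, and every structured $K'$ with $\|K'-K\|_F\le\beta_K$ lies in $\mathbb K_s$ and $\|\nabla_{\mathbf K}J(K')-\nabla_{\mathbf K}J(K)\|\le\phi_K\|K'-K\|_F$. There is also $c_{lqr}>0$ such that almost surely $H_i(K,x(0))\le c_{lqr}J_i(K)$ for all $i$ and all $K\in\mathbb K_d\cap\mathbb K_s$. Fix any such functions and constant. Let $\epsilon,\nu,\gamma>0$, $\alpha\ge2+\gamma+\frac1\nu+\nu\gamma$, and let $\alpha_i>1$ be so large that $J(K)\le\alpha J(K^0)$ implies $J_i(K)\le\alpha_iJ_i(K^0)$ for all $i$ and all $K\in\mathbb K_d\cap\mathbb K_s$. Let $\mathbb K_\alpha=\{K\in\mathbb K_d\cap\mathbb K_s:J(K)\le\alpha J(K^0),\ J_i(K)\le\alpha_iJ_i(K^0)\ \forall i\}$, $\phi_0=\sup_{\mathbb K_\alpha}\phi_K$, $\lambda_0=\sup_{\mathbb K_\alpha}\lambda_K$, $\rho_0=\inf_{\mathbb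 K_\alpha}\min\{\beta_K,\zeta_K\}$ (the suprema being finite), and let $\kappa_0$ be the (finite) supremum of the spectral norm $\|\sqrt\varrho(\mathcal A-\mathcal BK')\|$ over all $K'$ obtained from some $K\in\mathbb K_\alpha$ by moving one block $\mathbf K_i$ by at most $\rho_0$. Let $N_i$ be the size of the cluster of agent $i$, $N_0=\max_iN_i$, $q_+=\max_iq_i$, $r_-=\min_ir_i$, $J_0(K^0)=\max_i\alpha_iJ_i(K^0)$, $\epsilon'>0$ and $\delta=\frac{q_+}{r_-}[c_{lqr}(J_0(K^0)+\lambda_0\rho_0)+\epsilon']$. **Theorem.** There is a threshold $\bar T$, which depends only on the problem, $K^0$ and the constants above except for $r_i$, $\eta$, the clusters and $\delta$, such that the following holds. Suppose that almost surely, for each $k<T_K$, the horizon is long enough: $T_J(k)\ge\bar T$, or $\kappa_0<1$ and $$T_J(k)\ge\max_i\frac1{2(1-\kappa_0)}\log\frac{(\alpha_iJ_i(K^0)+\lambda_0\rho_0)\,\lambda_{\max}(x(0)x(0)^\top)}{\lambda_{\min}(\Sigma_x)\,\epsilon'}$$ for the sample $x(0)$ of step $k$ (with no condition if the argument of the logarithm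 is $0$). Suppose also that $T_K=\lceil\frac{2\alpha\nu J(K^0)}{\eta\epsilon}\rceil$, $\epsilon'\le\frac{r_-}{4q_+}\sqrt{\frac{\gamma\epsilon}{\alpha N_0}}$, $$\eta\le\min\Big\{1,\ \frac{\rho_0}{2\delta\sqrt{N_0}},\ \frac{2\alpha J(K^0)}{\gamma\epsilon},\ \frac{\gamma\epsilon}{2\alpha N_0(\phi_0\delta^2+4\phi_0^2+\phi_0+4)}\Big\},\qquad r_i\le\min\Big\{\frac{\rho_0}2,\frac1{4\phi_0}\sqrt{\frac{\gamma\epsilon}{\alpha N_0}}\Big\},$$ and almost surely $w_i^k\|\mathbf K_i^k-\mathbf K_i^{k_{prev}}\|\le\min\{\eta^{3/2},\frac{\rho_0}{2\sqrt{N_i}}\}$ for all $i$ and $k<T_K$. (i) With probability at least $1-\frac1\alpha(2+\gamma+\frac1\nu+\nu\gamma)$, all $\mathbf K^k$, $k<T_K$, are stabilizing and $$\frac1{T_K}\sum_{k=0}^{T_K-1}\sum_{i\in\mathcal V_{z_k}}\|\nabla_{\mathbf K_i}J(\mathbf K^k)\|^2<\epsilon.$$ (ii) Let $T_0\ge s$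 be an integer such that each cluster is updated at least once in any $T_0$ consecutive steps among $0,\dots,T_K-1$, and let $\bar\epsilon\in(0,\rho_0]$ be such that $2(T_0-1)N_iw_i^k\|\mathbf K_i^k-\mathbf K_i^{k_{prev}}\|\le\bar\epsilon$ almost surely for all $i$ and $k<T_K$, and $2\delta(T_0-1)N_0\eta\le\bar\epsilon$. Then, with probability at least $1-\frac1\alpha(2+\gamma+\frac1\nu+\nu\gamma)$, all $\mathbf K^k$, $k<T_K$, are stabilizing and $$\frac1{T_K}\sum_{k=0}^{T_K-1}\|\nabla_{\mathbf K}J(\mathbf K^k)\|^2<2T_0(\epsilon+\phi_0^2\bar\epsilon^2).$$ -/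

import Mathlib

open MeasureTheory ProbabilityTheory Matrix Finset

universe u

noncomputable section

/-- The smallest eigenvalue of a real symmetric matrix. -/
def lambdaMin {ι : Type*} [Fintype ι] [DecidableEq ι] (M : Matrix ι ι ℝ) : ℝ :=
  sInf (spectrum ℝ M)

/-- The largest eigenvalue of a real symmetric matrix. -/
def lambdaMax {ι : Type*} [Fintype ι] [DecidableEq ι] (M : Matrix ι ι ℝ) : ℝ :=
  sSup (spectrum ℝ M)

/-- The spectral norm of a square matrix. -/
def matSpectralNorm {ι : Type*} [Fintype ι] [DecidableEq ι] (M : Matrix ι ι ℝ) : ℝ :=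
  ‖Matrix.toEuclideanCLM (n := ι) (𝕜 := ℝ) M‖

/-- A real square matrix is Schur stable if all its complex eigenvalues lie in the open
unit disc. -/
def IsSchur {ι : Type*} [Fintype ι] [DecidableEq ι] (M : Matrix ι ι ℝ) : Prop :=
  ∀ z ∈ spectrum ℂ (M.map (fun a : ℝ => (a : ℂ))), ‖z‖ < 1

/-- The uniform distribution on the unit sphere of a Euclidean space, as a measure on the
space: the normalized surface measure. -/
def uniformSphere (E : Type*) [NormedAddCommGroup E] [InnerProductSpace ℝ E]
    [FiniteDimensional ℝ E] [MeasurableSpace E] [BorelSpace E] : Measure E :=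
  (((volume : Measure E).toSphere Set.univ)⁻¹ • (volume : Measure E).toSphere).map
    Subtype.val

/-- The second moment matrix `E[x xᵀ]` of a distribution. -/
def secondMoment {ι : Type*} [Fintype ι] (D : Measure (ι → ℝ)) : Matrix ι ι ℝ :=
  Matrix.of fun a b => ∫ x, x a * x b ∂D

/-- A distributed linear-quadratic problem for `N` agents with decoupled dynamics
`x_i(t+1) = A_i x_i(t) + B_i u_i(t)`, states in `ℝⁿ` and inputs in `ℝᵐ`.
Coordinates of the whole state are pairs (coordinate, agent). -/
structure MultiAgentLQR (N n m : ℕ) where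
  /-- the agents' state matrices -/
  A : Fin N → Matrix (Fin n) (Fin n) ℝ
  /-- the agents' input matrices -/
  B : Fin N → Matrix (Fin n) (Fin m) ℝ
  /-- the matrix whose nonzero entries are the edges of the cost graph -/
  G : Matrix (Fin N) (Fin N) ℝ
  G_psd : G.PosSemidef
  /-- every agent has a self-loop in the cost graph -/
  G_self : ∀ i, G i i ≠ 0
  /-- the second factor of the Khatri-Rao product that gives the state weight -/
  Qt : Matrix (Fin n × Fin N) (Fin n × Fin N) ℝ
  Qt_psd : Qt.PosSemidef
  /-- the agents' input weights -/
  R : Fin N → Matrix (Fin m) (Fin m) ℝ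
  R_pos : ∀ i, (R i).PosDef
  /-- the discount factor -/
  disc : ℝ
  disc_pos : 0 < disc
  disc_le : disc ≤ 1
  /-- the distribution of the initial state -/
  D : Measure (Fin n × Fin N → ℝ)
  D_prob : IsProbabilityMeasure D
  D_bdd : ∃ M : ℝ, ∀ᵐ x ∂D, ‖x‖ ≤ M
  D_pos : (secondMoment D).PosDef
  /-- `nbrS i` is the set of the agents that agent `i` senses -/
  nbrS : Fin N → Finset (Fin N)
  nbrS_self : ∀ i, i ∈ nbrS i

namespace MultiAgentLQR

variable {N n m : ℕ} (P : MultiAgentLQR N n m)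

/-- States of the whole system. -/
abbrev State (_P : MultiAgentLQR N n m) : Type := Fin n × Fin N → ℝ

/-- Gains of the whole system. -/
abbrev Gain (_P : MultiAgentLQR N n m) : Type := Matrix (Fin m × Fin N) (Fin n × Fin N) ℝ

/-- The policy variable of agent `i`: the entries of its gain `K̃_i`, as a vector. -/
abbrev Blk (i : Fin N) : Type := EuclideanSpace ℝ (Fin m × {j // j ∈ P.nbrS i} × Fin n)

/-- The policy variable of all agents, with the Euclidean norm. -/
abbrev Pol : Type := PiLp 2 P.Blk

/-- The dimension of the variable of agent `i`. -/
def dim (i : Fin N) : ℕ := m * (P.nbrS i).card * n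

/-- The structured gain matrix that corresponds to a policy variable. -/
def gain (K : P.Pol) : P.Gain := Matrix.of fun a b =>
  if h : b.2 ∈ P.nbrS a.2 then K a.2 (a.1, ⟨b.2, h⟩, b.1) else 0

/-- The policy variable with the block of agent `i` replaced by `y`. -/
def replace (K : P.Pol) (i : Fin N) (y : P.Blk i) : P.Pol :=
  WithLp.toLp 2 (Function.update (fun j => K j) i y)

/-- The closed-loop matrix `𝒜 - ℬ K`. -/
def closedLoop (K : P.Gain) : Matrix (Fin n × Fin N) (Fin n × Fin N) ℝ :=
  Matrix.blockDiagonal P.A - Matrix.blockDiagonal P.B * K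

/-- The closed-loop matrix `√γ (𝒜 - ℬ K)` of the discounted system. -/
def discLoop (K : P.Gain) : Matrix (Fin n × Fin N) (Fin n × Fin N) ℝ :=
  Real.sqrt P.disc • P.closedLoop K

/-- The policy variables whose structured gain is stabilizing. -/
def stab : Set P.Pol := {K | IsSchur (P.discLoop (P.gain K))}

/-- The state at time `t` under `u = - K x`, started at `x`. -/
def traj (K : P.Gain) (x : P.State) (t : ℕ) : P.State := (P.closedLoop K ^ t) *ᵥ x

/-- The discounted cost at time `t` under `u = - K x`, for the weights `W` and `V`. -/
def stageCost (W : Matrix (Fin n × Fin N) (Fin n × Fin N) ℝ)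
    (V : Matrix (Fin m × Fin N) (Fin m × Fin N) ℝ) (K : P.Gain) (x : P.State) (t : ℕ) : ℝ :=
  P.disc ^ t * (P.traj K x t ⬝ᵥ ((W + Kᵀ * V * K) *ᵥ P.traj K x t))

/-- The state weight `Q = G ⊙ Q̃` (Khatri-Rao product). -/
def Q : Matrix (Fin n × Fin N) (Fin n × Fin N) ℝ :=
  Matrix.of fun a b => P.G a.2 b.2 * P.Qt a b

/-- The input weight. -/
def Rfull : Matrix (Fin m × Fin N) (Fin m × Fin N) ℝ := Matrix.blockDiagonal P.R

/-- The global cost `J`. -/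
def J (K : P.Pol) : ℝ := ∫ x, ∑' t, P.stageCost P.Q P.Rfull (P.gain K) x t ∂P.D

/-- `j` can be reached from `i` by a path in the sensing graph (the empty path included:
every agent has a self-loop). -/
def Reach (i j : Fin N) : Prop := Relation.ReflTransGen (fun a b => a ∈ P.nbrS b) i j

/-- `k` is a neighbour of `i` in the learning graph: it is a neighbour in the cost graph of
an agent that is reachable from `i` in the sensing graph. -/
def Learn (i k : Fin N) : Prop := ∃ j, P.Reach i j ∧ P.G j k ≠ 0

open Classical in
/-- The matrix `M_i`: the principal submatrix of `G` on the learning neighbours of `i`, and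
zero elsewhere. -/
def localG (i : Fin N) : Matrix (Fin N) (Fin N) ℝ := Matrix.of fun j k =>
  if P.Learn i j ∧ P.Learn i k then P.G j k else 0

/-- The local state weight `M_i ⊙ Q̃`. -/
def localQ (i : Fin N) : Matrix (Fin n × Fin N) (Fin n × Fin N) ℝ :=
  Matrix.of fun a b => P.localG i a.2 b.2 * P.Qt a b

open Classical in
/-- The local input weight: the blocks `R_j` of the learning neighbours `j` of `i`. -/
def localR (i : Fin N) : Matrix (Fin m × Fin N) (Fin m × Fin N) ℝ :=
  Matrix.blockDiagonal fun j => if P.Learn i j then P.R j else 0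

/-- The local cost of agent `i` over an infinite horizon, from the initial state `x`. -/
def localH (i : Fin N) (K : P.Pol) (x : P.State) : ℝ :=
  ∑' t, P.stageCost (P.localQ i) (P.localR i) (P.gain K) x t

/-- The local cost of agent `i` over the horizon `T`, from the initial state `x`. -/
def localHT (i : Fin N) (T : ℕ) (K : P.Pol) (x : P.State) : ℝ :=
  ∑ t ∈ Finset.range T, P.stageCost (P.localQ i) (P.localR i) (P.gain K) x t

/-- The expected local cost of agent `i`. -/
def localJ (i : Fin N) (K : P.Pol) : ℝ := ∫ x, P.localH i K x ∂P.D

/-- The costs are what they are meant to be at `K`: the series converge, the expectations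
exist, and `J` is differentiable. -/
def Regular (K : P.Pol) : Prop :=
  (∀ x, Summable (P.stageCost P.Q P.Rfull (P.gain K) x)) ∧
  Integrable (fun x => ∑' t, P.stageCost P.Q P.Rfull (P.gain K) x t) P.D ∧
  (∀ i x, Summable (P.stageCost (P.localQ i) (P.localR i) (P.gain K) x)) ∧
  (∀ i, Integrable (P.localH i K) P.D) ∧
  DifferentiableAt ℝ P.J K

/-- `J` is `(lam, zet)` locally Lipschitz and has a `(phi, bet)` locally Lipschitz gradient
on the stabilizing policies, where the four parameters are positive and continuous. -/
structure LocalParams (lam zet phi bet : P.Pol → ℝ) : Prop where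
  cont : ContinuousOn lam P.stab ∧ ContinuousOn zet P.stab ∧ ContinuousOn phi P.stab ∧
    ContinuousOn bet P.stab
  pos : ∀ K ∈ P.stab, 0 < lam K ∧ 0 < zet K ∧ 0 < phi K ∧ 0 < bet K
  lip : ∀ K ∈ P.stab, ∀ K', ‖K' - K‖ ≤ zet K →
    K' ∈ P.stab ∧ |P.J K' - P.J K| ≤ lam K * ‖K' - K‖
  grad : ∀ K ∈ P.stab, ∀ K', ‖K' - K‖ ≤ bet K →
    K' ∈ P.stab ∧ ‖gradient P.J K' - gradient P.J K‖ ≤ phi K * ‖K' - K‖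

/-- `c` bounds the ratio of the sampled local costs to the expected local costs. -/
def CostRatio (c : ℝ) : Prop :=
  0 < c ∧ ∀ᵐ x ∂P.D, ∀ i, ∀ K ∈ P.stab, P.localH i K x ≤ c * P.localJ i K

/-- The set `𝕂_α`. -/
def levelSet (K0 : P.Pol) (α : ℝ) (αi : Fin N → ℝ) : Set P.Pol :=
  {K | K ∈ P.stab ∧ P.J K ≤ α * P.J K0 ∧ ∀ i, P.localJ i K ≤ αi i * P.localJ i K0}

/-- The policies obtained from those of a set by moving one block by at most `ρ`. -/
def blockNhd (S : Set P.Pol) (ρ : ℝ) : Set P.Pol :=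
  {K' | ∃ K ∈ S, ∃ i, ∃ y : P.Blk i, ‖y - K i‖ ≤ ρ ∧ K' = P.replace K i y}

/-- The explicit lower bound on the horizon for agent `i` and the initial state `x`. -/
def horizonBound (K0 : P.Pol) (αi : Fin N → ℝ) (lam0 rho0 κ0 ε' : ℝ) (x : P.State)
    (i : Fin N) : ℝ :=
  1 / (2 * (1 - κ0)) *
    Real.log ((αi i * P.localJ i K0 + lam0 * rho0) * lambdaMax (Matrix.vecMulVec x x) /
      (lambdaMin (secondMoment P.D) * ε'))

/-- The largest dimension of the variable of an agent. -/
def dimMax : ℕ := Finset.univ.sup P.dim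

/-- The uniform bound on the estimated gradients. -/
def gradBound (K0 : P.Pol) (αi : Fin N → ℝ) (r : Fin N → ℝ) (c lam0 rho0 ε' : ℝ) : ℝ :=
  P.dimMax / (⨅ i, r i) * (c * ((⨆ i, αi i * P.localJ i K0) + lam0 * rho0) + ε')

/-- An assignment of the agents to `s` clusters such that distinct agents of the same cluster
are not adjacent in the learning graph. -/
def IsClustering {s : ℕ} (cl : Fin N → Fin s) : Prop :=
  ∀ i j, i ≠ j → cl i = cl j → ¬ P.Learn i j

/-- One iteration of the algorithm. The two components of `p` are the current policy and,
blockwise, the value that each block had before its last update. The arguments are the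
smoothing radii, the step-size, the clusters, the cluster that is updated, the extrapolation
weights, the horizon, the sampled initial state and the sampled directions. -/
def step (r : Fin N → ℝ) (η : ℝ) {s : ℕ} (cl : Fin N → Fin s) (z : Fin s) (w : Fin N → ℝ)
    (T : ℕ) (x : P.State) (d : ∀ i, P.Blk i) (p : P.Pol × P.Pol) : P.Pol × P.Pol :=
  let hat : ∀ i, P.Blk i := fun i => p.1 i + w i • (p.1 i - p.2 i)
  let est : ∀ i, P.Blk i := fun i =>
    ((P.dim i : ℝ) / r i * P.localHT i T (P.replace p.1 i (hat i + r i • d i)) x) • d i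
  (WithLp.toLp 2 fun i => if cl i = z then hat i - η • est i else p.1 i,
   WithLp.toLp 2 fun i => if cl i = z then p.1 i else p.2 i)

/-- The algorithm, started at `K0`, for a given realization of its inputs. -/
def run (K0 : P.Pol) (r : Fin N → ℝ) (η : ℝ) {s : ℕ} (cl : Fin N → Fin s) (z : ℕ → Fin s)
    (w : ℕ → Fin N → ℝ) (T : ℕ → ℕ) (x : ℕ → P.State) (d : ℕ → ∀ i, P.Blk i) :
    ℕ → P.Pol × P.Pol
  | 0 => (K0, K0)
  | k + 1 => P.step r η cl (z k) (w k) (T k) (x k) (d k) (run K0 r η cl z w T x d k)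

/-- The random inputs of the algorithm on a probability space: in step `k` the initial state
is drawn from the given distribution and the directions are drawn uniformly from the unit
spheres, independently of each other and of the past `ℱ k`; the extrapolation weights are
determined by the past; the horizon may depend on the past and on the samples of the step. -/
structure Sampling {Ω : Type u} [MeasurableSpace Ω] (μ : Measure Ω)
    (ℱ : Filtration ℕ (inferInstance : MeasurableSpace Ω))
    (w : ℕ → Fin N → Ω → ℝ) (T : ℕ → Ω → ℕ) (x : ℕ → Ω → P.State)
    (d : ℕ → Ω → ∀ i, P.Blk i) : Prop where
  meas : ∀ k, Measurable[ℱ (k + 1)] (fun ω => (x k ω, d k ω))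
  law : ∀ k, μ.map (fun ω => (x k ω, d k ω)) =
    P.D.prod (Measure.pi fun i => uniformSphere (P.Blk i))
  indep : ∀ k, Indep (MeasurableSpace.comap (fun ω => (x k ω, d k ω)) inferInstance)
    (ℱ k) μ
  weight : ∀ k i, Measurable[ℱ k] (w k i)
  horizon : ∀ k, Measurable[ℱ (k + 1)] (T k)

end MultiAgentLQR

end

/-!
The theorem holds because the algorithm is a stochastic gradient descent on `J` whose cost is a
supermartingale, up to a small drift, until it leaves a sublevel set.

*The costs are quadratic forms.* For a stabilizing policy the matrix `L` of the discounted closed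
loop satisfies `‖L ^ t‖ < 1` for some `t`, so the value matrix `∑ (Lᵀ) ^ t * W * L ^ t` solves a
linear equation `X - Lᵀ * X * L = W` with an invertible left side and is a smooth function of the
policy (`contDiffOn_lyapunov`). Hence `J` and the local costs are smooth on the open set of
stabilizing policies, which gives the functions `lam`, `zet`, `phi`, `bet`; and a positive
semidefinite form at a bounded point is at most a multiple of its mean under a law with positive
definite second moment, which gives `CostRatio`. A sublevel set is bounded, since the local cost
of an agent dominates the square of its gain (`exists_mul_norm_sq_le_localJ`), and then compact,
which makes the tails of the costs uniformly small (`exists_horizon_blockNhd`); if `κ0 < 1` the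
tails decay explicitly (`tail_le_of_log_le`).

*Local costs have the right gradients.* Changing the policy of agent `i` alone changes `J` and
`localJ i` by the same amount (`J_sub_localJ_eq`), because the agents whose trajectories change
lie in the learning neighbourhood of `i` together with all the agents they share costs with.

*One-point estimates.* The mean of `q / r * f (y + r • D) * ⟪g, D⟫` over the unit sphere is
compared with `‖g‖ ^ 2` by means of the reflection in the hyperplane orthogonal to `g`: it turns
the value `f (y + r • D)` into a difference along `g`, and only the Lipschitz constant of the
linearization error enters (`abs_integral_sphere_estimate_sub_le`). No divergence theorem is
needed.

*Descent.* As long as the iterates stay in the sublevel set of `M = min α (2 * α * ν) * J K0`, a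
step decreases `J` in the mean by `η / 2` times the squared norm of the updated gradient blocks,
up to `η * γ * ε / (2 * α)` (`agent_balance`, `Sampling.setIntegral_J_step_le`). The truncation of
the horizon costs only half of its range, because a constant may be subtracted from the
observations without changing their mean. Stopping at the exit from the sublevel set and applying
Markov's inequality bounds the probability that the iterates leave it or that the sum of the
squared gradient blocks is large (`min_mul_measureReal_bad_le`); the resulting event carries both
claims.

*Cyclic updates.* In a cycle of `T0` steps every cluster is updated at some step, and the gradients
of the cycle differ by at most `phi0 * εbar`, so the full gradients are controlled by the updated
blocks (`sum_norm_sq_block_le`). The fewer than `T0` steps after the last complete cycle are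
controlled one by one: a nonnegative function with a Lipschitz gradient has a small gradient where
it is small (`mul_norm_gradient_sq_le`).
-/

/-! ### The uniform distribution on the unit sphere -/

section Sphere

open Metric
open scoped RealInnerProductSpace Pointwise

variable {E : Type*} [NormedAddCommGroup E] [InnerProductSpace ℝ E] [FiniteDimensional ℝ E]
  [MeasurableSpace E] [BorelSpace E]

instance isProbabilityMeasure_uniformSphere [Nontrivial E] :
    IsProbabilityMeasure (uniformSphere E) := by
  constructor
  rw [uniformSphere, Measure.map_apply measurable_subtype_coe MeasurableSet.univ]
  simp only [Set.preimage_univ, Measure.smul_apply, smul_eq_mul]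
  exact ENNReal.inv_mul_cancel (by rw [Ne, Measure.measure_univ_eq_zero]; simp)
    (measure_ne_top _ _)

theorem ae_norm_eq_one_uniformSphere : ∀ᵐ D ∂(uniformSphere E), ‖D‖ = 1 := by
  rw [uniformSphere, ae_map_iff measurable_subtype_coe.aemeasurable
    (measurableSet_eq_fun measurable_norm measurable_const)]
  exact Filter.Eventually.of_forall fun D => by simp

/-- The uniform distribution on the sphere is invariant under linear isometries, because the
Lebesgue measure of the cone over a set is. -/
theorem map_uniformSphere (A : E ≃ₗᵢ[ℝ] E) :
    (uniformSphere E).map A = uniformSphere E := by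
  have hA : Measurable A := A.continuous.measurable
  ext s hs
  rw [Measure.map_apply hA hs]
  simp only [uniformSphere]
  rw [Measure.map_apply measurable_subtype_coe (hA hs),
    Measure.map_apply measurable_subtype_coe hs]
  simp only [Measure.smul_apply]
  congr 1
  rw [Measure.toSphere_apply' _ (measurable_subtype_coe (hA hs)),
    Measure.toSphere_apply' _ (measurable_subtype_coe hs)]
  congr 1
  have h : (Set.Ioo (0 : ℝ) 1 • ((↑) '' ((↑) ⁻¹' (A ⁻¹' s) : Set (sphere (0 : E) 1)) : Set E)) =
      A ⁻¹' (Set.Ioo (0 : ℝ) 1 • ((↑) '' ((↑) ⁻¹' s : Set (sphere (0 : E) 1)) : Set E)) := by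
    ext v
    simp only [Set.mem_smul, Set.mem_image, Set.mem_preimage, Subtype.exists, mem_sphere_iff_norm,
      sub_zero, exists_and_left, exists_prop, exists_eq_right_right]
    constructor
    · rintro ⟨t, ht, y, ⟨hy, hy1⟩, rfl⟩
      exact ⟨t, ht, A y, ⟨hy, by simpa using hy1⟩, by simp⟩
    · rintro ⟨t, ht, y, ⟨hy, hy1⟩, hv⟩
      refine ⟨t, ht, A.symm y, ⟨by simpa using hy, by simpa using hy1⟩, ?_⟩
      apply A.injective
      simpa using hv
  rw [h]
  exact A.measurePreserving.measure_preimage_emb A.toHomeomorph.measurableEmbedding _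

theorem integral_uniformSphere_comp (A : E ≃ₗᵢ[ℝ] E) (f : E → ℝ) :
    ∫ D, f (A D) ∂(uniformSphere E) = ∫ D, f D ∂(uniformSphere E) := by
  conv_rhs => rw [← map_uniformSphere A]
  exact (A.toHomeomorph.measurableEmbedding.integral_map (μ := uniformSphere E) f).symm

theorem integrable_uniformSphere_of_bound [Nontrivial E] {f : E → ℝ} {C : ℝ}
    (hf : AEStronglyMeasurable f (uniformSphere E))
    (hC : ∀ D, ‖D‖ = 1 → |f D| ≤ C) : Integrable f (uniformSphere E) :=
  Integrable.of_bound hf C (by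
    filter_upwards [ae_norm_eq_one_uniformSphere (E := E)] with D hD using hC D hD)

theorem integrable_inner_sq_uniformSphere [Nontrivial E] (v : E) :
    Integrable (fun D => ⟪D, v⟫ ^ 2) (uniformSphere E) := by
  refine integrable_uniformSphere_of_bound (C := ‖v‖ ^ 2) ?_ ?_
  · exact (by fun_prop : Continuous fun D : E => ⟪D, v⟫ ^ 2).aestronglyMeasurable
  · intro D hD
    rw [abs_of_nonneg (sq_nonneg _), ← sq_abs]
    gcongr
    simpa [hD] using abs_real_inner_le_norm D v

/-- The second moments of the uniform distribution on the sphere. -/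
theorem integral_inner_sq_uniformSphere [Nontrivial E] (v : E) :
    ∫ D, ⟪D, v⟫ ^ 2 ∂(uniformSphere E) = ‖v‖ ^ 2 / Module.finrank ℝ E := by
  -- a reflection exchanges any two vectors of the same length
  have hsame : ∀ v w : E, ‖v‖ = ‖w‖ →
      ∫ D, ⟪D, v⟫ ^ 2 ∂(uniformSphere E) = ∫ D, ⟪D, w⟫ ^ 2 ∂(uniformSphere E) := by
    intro v w h
    rw [← integral_uniformSphere_comp (Submodule.reflection (ℝ ∙ (v - w))ᗮ)]
    congr 1 with D
    have h1 := LinearIsometryEquiv.inner_map_map (Submodule.reflection (ℝ ∙ (v - w))ᗮ) D w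
    have h2 : Submodule.reflection (ℝ ∙ (v - w))ᗮ w = v := by
      have := congrArg (Submodule.reflection (ℝ ∙ (v - w))ᗮ) (Submodule.reflection_sub h)
      rwa [Submodule.reflection_reflection, eq_comm] at this
    rw [← h1, h2]
  set b := stdOrthonormalBasis ℝ E
  have hb : ∀ i, ∫ D, ⟪D, v⟫ ^ 2 ∂(uniformSphere E) =
      ‖v‖ ^ 2 * ∫ D, ⟪D, b i⟫ ^ 2 ∂(uniformSphere E) := by
    intro i
    rw [hsame v (‖v‖ • b i) (by simp [norm_smul]), ← integral_const_mul]
    congr 1 with D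
    rw [inner_smul_right]; ring
  have hsum : ∑ i, ∫ D, ⟪D, b i⟫ ^ 2 ∂(uniformSphere E) = 1 := by
    rw [← integral_finsetSum _ fun i _ => integrable_inner_sq_uniformSphere (b i)]
    have : ∀ᵐ D ∂(uniformSphere E), ∑ i, ⟪D, b i⟫ ^ 2 = (1 : ℝ) := by
      filter_upwards [ae_norm_eq_one_uniformSphere (E := E)] with D hD
      have := b.sum_sq_norm_inner_left D
      simpa [hD, real_inner_comm] using this
    rw [integral_congr_ae this]; simp
  have hq : (0 : ℝ) < Module.finrank ℝ E := by exact_mod_cast Module.finrank_pos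
  have h2 : (Module.finrank ℝ E : ℝ) * ∫ D, ⟪D, v⟫ ^ 2 ∂(uniformSphere E) = ‖v‖ ^ 2 := by
    have := Finset.sum_congr (rfl : (univ : Finset (Fin (Module.finrank ℝ E))) = univ)
      fun i _ => hb i
    rw [← Finset.mul_sum, hsum] at this
    simpa using this
  field_simp
  linarith

/-- The one-point estimate of a gradient from a value on a sphere is accurate up to the
Lipschitz constant of the linearization error. The reflection in the hyperplane orthogonal to
`g` turns the value into a difference along `g`, which keeps the error free of the dimension. -/
theorem abs_integral_sphere_estimate_sub_le [Nontrivial E] {f : E → ℝ} {y g : E} {r C : ℝ}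
    (hr : 0 < r)
    (hf : ∀ p ∈ closedBall y r, ∀ p' ∈ closedBall y r, |f p - f p' - ⟪g, p - p'⟫| ≤ C * ‖p - p'‖)
    (hint : Integrable (fun D => f (y + r • D) * ⟪g, D⟫) (uniformSphere E)) :
    |Module.finrank ℝ E / r * ∫ D, f (y + r • D) * ⟪g, D⟫ ∂(uniformSphere E) - ‖g‖ ^ 2| ≤
      C * ‖g‖ := by
  by_cases hg : g = 0
  · simp [hg]
  have hg0 : 0 < ‖g‖ := norm_pos_iff.2 hg
  set σ := Submodule.reflection (ℝ ∙ g)ᗮ with hσ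
  have hσg : σ g = -g := by
    rw [hσ]; exact Submodule.reflection_orthogonalComplement_singleton_eq_neg g
  have hσD : ∀ D, ⟪g, σ D⟫ = -⟪g, D⟫ := by
    intro D
    have h1 : ⟪σ g, σ D⟫ = ⟪g, D⟫ := LinearIsometryEquiv.inner_map_map _ _ _
    rw [hσg, inner_neg_left] at h1
    linarith
  have hdiff : ∀ D, D - σ D = (2 * ⟪g, D⟫ / ‖g‖ ^ 2) • g := by
    intro D
    have h0 : ⟪g, D - (⟪g, D⟫ / ‖g‖ ^ 2) • g⟫ = 0 := by
      rw [inner_sub_right, inner_smul_right, real_inner_self_eq_norm_sq]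
      field_simp
      ring
    have h1 : σ (D - (⟪g, D⟫ / ‖g‖ ^ 2) • g) = D - (⟪g, D⟫ / ‖g‖ ^ 2) • g := by
      rw [hσ, Submodule.reflection_eq_self_iff, Submodule.mem_orthogonal_singleton_iff_inner_right]
      exact h0
    rw [map_sub, map_smul, hσg] at h1
    have h2 : σ D = D - (2 * (⟪g, D⟫ / ‖g‖ ^ 2)) • g := by
      rw [sub_eq_iff_eq_add] at h1
      rw [h1]; module
    rw [h2, mul_div_assoc]
    abel
  have hq : (0 : ℝ) < Module.finrank ℝ E := by exact_mod_cast Module.finrank_pos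
  have hint2 : Integrable (fun D => f (y + r • σ D) * ⟪g, D⟫) (uniformSphere E) := by
    have h1 : Integrable (fun D => f (y + r • σ D) * ⟪g, σ D⟫) (uniformSphere E) := by
      have h2 : MeasurePreserving σ (uniformSphere E) (uniformSphere E) :=
        ⟨σ.continuous.measurable, map_uniformSphere σ⟩
      exact (h2.integrable_comp_emb σ.toHomeomorph.measurableEmbedding).2 hint
    refine h1.neg.congr (Filter.Eventually.of_forall fun D => ?_)
    simp only [Pi.neg_apply, hσD]; ring
  have heq : ∫ D, f (y + r • D) * ⟪g, D⟫ ∂(uniformSphere E) =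
      -∫ D, f (y + r • σ D) * ⟪g, D⟫ ∂(uniformSphere E) := by
    rw [← integral_uniformSphere_comp σ, ← integral_neg]
    congr 1 with D
    rw [hσD]; ring
  set I := ∫ D, f (y + r • D) * ⟪g, D⟫ ∂(uniformSphere E) with hI
  have h2I : 2 * I = ∫ D, (f (y + r • D) - f (y + r • σ D)) * ⟪g, D⟫ ∂(uniformSphere E) := by
    have : ∀ D, (f (y + r • D) - f (y + r • σ D)) * ⟪g, D⟫ =
      f (y + r • D) * ⟪g, D⟫ - f (y + r • σ D) * ⟪g, D⟫ := fun D => by ring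
    simp_rw [this]
    rw [integral_sub hint hint2, ← hI]
    linarith
  have hmain : |2 * I - ∫ D, 2 * r * ⟪D, g⟫ ^ 2 ∂(uniformSphere E)| ≤
      ∫ D, C * (2 * r / ‖g‖) * ⟪D, g⟫ ^ 2 ∂(uniformSphere E) := by
    have hi3 := (integrable_inner_sq_uniformSphere g).const_mul (2 * r)
    have hi4 : Integrable (fun D => (f (y + r • D) - f (y + r • σ D)) * ⟪g, D⟫)
        (uniformSphere E) := (hint.sub hint2).congr
          (Filter.Eventually.of_forall fun D => by simp only [Pi.sub_apply]; ring)
    rw [h2I, ← integral_sub hi4 hi3]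
    refine abs_integral_le_integral_abs.trans ?_
    refine integral_mono_ae (hi4.sub hi3).abs
      ((integrable_inner_sq_uniformSphere g).const_mul _) ?_
    filter_upwards [ae_norm_eq_one_uniformSphere (E := E)] with D hD
    have hp : ∀ D : E, ‖D‖ = 1 → y + r • D ∈ closedBall y r := fun D hD => by
      simp [norm_smul, hD, abs_of_pos hr]
    have h1 := hf _ (hp D hD) _ (hp (σ D) (by simpa using hD))
    have h3 : (y + r • D) - (y + r • σ D) = (r * (2 * ⟪g, D⟫ / ‖g‖ ^ 2)) • g := by
      rw [mul_smul, ← hdiff]; module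
    rw [h3, inner_smul_right, real_inner_self_eq_norm_sq, norm_smul, Real.norm_eq_abs] at h1
    have h4 : r * (2 * ⟪g, D⟫ / ‖g‖ ^ 2) * ‖g‖ ^ 2 = 2 * r * ⟪g, D⟫ := by
      field_simp
    rw [h4] at h1
    have h5 : |(f (y + r • D) - f (y + r • σ D)) * ⟪g, D⟫ - 2 * r * ⟪D, g⟫ ^ 2| =
        |f (y + r • D) - f (y + r • σ D) - 2 * r * ⟪g, D⟫| * |⟪g, D⟫| := by
      rw [← abs_mul, real_inner_comm g D]; ring_nf
    simp only [h5]
    refine (mul_le_mul_of_nonneg_right h1 (abs_nonneg _)).trans (le_of_eq ?_)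
    rw [abs_mul, abs_div, abs_mul, abs_of_pos hr, abs_of_pos (by norm_num : (0 : ℝ) < 2),
      abs_of_pos (by positivity : 0 < ‖g‖ ^ 2), real_inner_comm g D, ← sq_abs ⟪g, D⟫]
    field_simp
  rw [integral_const_mul, integral_const_mul, integral_inner_sq_uniformSphere] at hmain
  set q : ℝ := (Module.finrank ℝ E : ℝ)
  have h6 : q / r * I - ‖g‖ ^ 2 = q / (2 * r) * (2 * I - 2 * r * (‖g‖ ^ 2 / q)) := by
    field_simp
  rw [h6, abs_mul, abs_of_pos (by positivity : 0 < q / (2 * r))]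
  refine (mul_le_mul_of_nonneg_left hmain (by positivity)).trans (le_of_eq ?_)
  field_simp

end Sphere

/-! ### Functions with a locally Lipschitz gradient -/

section Smooth

open Metric Topology
open scoped RealInnerProductSpace

/-- A continuously differentiable function on an open set has, at each point, a Lipschitz constant
on a ball about the point; both can be chosen continuously. The radius is half the distance to
the complement (capped), and the constants are glued by a partition of unity. -/
theorem exists_continuousOn_lipschitz {E F : Type*} [NormedAddCommGroup E] [NormedSpace ℝ E]
    [FiniteDimensional ℝ E] [NormedAddCommGroup F] [NormedSpace ℝ F] {U : Set E} (hU : IsOpen U)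
    {f : E → F} (hf : ContDiffOn ℝ 1 f U) :
    ∃ lam zet : E → ℝ, ContinuousOn lam U ∧ ContinuousOn zet U ∧
      (∀ x ∈ U, 0 < lam x ∧ 0 < zet x) ∧
      ∀ x ∈ U, ∀ y, ‖y - x‖ ≤ zet x → y ∈ U ∧ ‖f y - f x‖ ≤ lam x * ‖y - x‖ := by
  classical
  have hzet : ∃ zet : E → ℝ, Continuous zet ∧ ∀ x ∈ U, 0 < zet x ∧ closedBall x (zet x) ⊆ U := by
    by_cases hne : (Uᶜ).Nonempty
    · refine ⟨fun x => infDist x Uᶜ / 2, by fun_prop, fun x hx => ?_⟩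
      have hpos : 0 < infDist x Uᶜ :=
        (hU.isClosed_compl.notMem_iff_infDist_pos hne).1 (by simpa using hx)
      refine ⟨by positivity, fun y hy => ?_⟩
      by_contra hyU
      have h1 := infDist_le_dist_of_mem (x := x) (show y ∈ Uᶜ from hyU)
      rw [mem_closedBall, dist_comm] at hy
      linarith
    · have hUu : U = Set.univ := by simpa [Set.not_nonempty_iff_eq_empty] using hne
      exact ⟨fun _ => 1, continuous_const, fun x _ => ⟨one_pos, by simp [hUu]⟩⟩
  obtain ⟨zet, hzc, hz⟩ := hzet
  let t : U → Set ℝ := fun x => {c | 0 < c ∧ ∀ y ∈ closedBall (x : E) (zet x),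
    ‖f y - f x‖ ≤ c * ‖y - x‖}
  have hconv : ∀ x, Convex ℝ (t x) := by
    intro x
    have : (t x).OrdConnected := by
      refine ⟨fun a ha b hb c hc => ⟨ha.1.trans_le hc.1, fun y hy => (ha.2 y hy).trans ?_⟩⟩
      gcongr
      exact hc.1
    exact this.convex
  have hloc : ∀ x : U, ∃ c : ℝ, ∀ᶠ y in 𝓝 x, c ∈ t y := by
    intro x
    -- a closed ball slightly larger than the one at `x` still lies in `U`
    obtain ⟨R, hR, hRU⟩ : ∃ R > zet x, closedBall (x : E) R ⊆ U := by
      obtain ⟨δ, hδ, hsub⟩ := (isCompact_closedBall (x : E) (zet x)).exists_cthickening_subset_open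
        hU (hz x x.2).2
      refine ⟨zet x + δ, by linarith, ?_⟩
      rwa [cthickening_closedBall hδ.le (hz x x.2).1.le, add_comm] at hsub
    have hR0 : 0 < R := (hz x x.2).1.trans hR
    obtain ⟨C, hC⟩ : ∃ C, ∀ y ∈ closedBall (x : E) R, ‖fderiv ℝ f y‖ ≤ C :=
      (isCompact_closedBall (x : E) R).exists_bound_of_continuousOn
        ((hf.continuousOn_fderiv_of_isOpen hU le_rfl).mono hRU)
    refine ⟨max C 1, ?_⟩
    have hev : ∀ᶠ y in 𝓝 (x : E), zet y + dist y x < R := by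
      have hc : ContinuousAt (fun y : E => zet y + dist y (x : E)) x := by fun_prop
      have := hc.eventually_lt (continuousAt_const (y := R)) (by simpa using hR)
      exact this
    have hev' := (continuous_subtype_val.tendsto x).eventually hev
    filter_upwards [hev'] with y hy
    refine ⟨by positivity, fun w hw => ?_⟩
    have hsub : closedBall (y : E) (zet y) ⊆ closedBall (x : E) R :=
      closedBall_subset_closedBall' hy.le
    refine (Convex.norm_image_sub_le_of_norm_fderiv_le (𝕜 := ℝ) (s := closedBall (x : E) R)
      (C := max C 1) (fun v hv => ?_) (fun v hv => (hC v hv).trans (le_max_left _ _))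
      (convex_closedBall _ _) (hsub (mem_closedBall_self (hz y y.2).1.le)) (hsub hw))
    exact (hf.differentiableOn one_ne_zero).differentiableAt (hU.mem_nhds (hRU hv))
  obtain ⟨g, hg⟩ := exists_continuous_forall_mem_convex_of_local_const hconv hloc
  refine ⟨fun x => if h : x ∈ U then g ⟨x, h⟩ else 0, zet, ?_, hzc.continuousOn, ?_, ?_⟩
  · rw [continuousOn_iff_continuous_domRestrict]
    convert g.continuous using 1
    ext x
    simp
  · intro x hx
    simp only [hx, dif_pos]
    exact ⟨(hg ⟨x, hx⟩).1, (hz x hx).1⟩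
  · intro x hx y hy
    simp only [hx, dif_pos]
    exact ⟨(hz x hx).2 (by simpa [dist_eq_norm] using hy),
      (hg ⟨x, hx⟩).2 y (by simpa [dist_eq_norm] using hy)⟩

variable {E : Type*} [NormedAddCommGroup E] [InnerProductSpace ℝ E] [CompleteSpace E]

/-- The linearization error on a ball on which the gradient varies by at most `C`. -/
theorem abs_sub_sub_inner_le {f : E → ℝ} {x₀ : E} {R C : ℝ}
    (hd : ∀ y, ‖y - x₀‖ ≤ R → DifferentiableAt ℝ f y)
    (hg : ∀ y, ‖y - x₀‖ ≤ R → ‖gradient f y - gradient f x₀‖ ≤ C) {a b : E}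
    (ha : ‖a - x₀‖ ≤ R) (hb : ‖b - x₀‖ ≤ R) :
    |f a - f b - ⟪gradient f x₀, a - b⟫| ≤ C * ‖a - b‖ := by
  have hder : ∀ y, ‖y - x₀‖ ≤ R → HasFDerivAt (fun y => f y - ⟪gradient f x₀, y⟫)
      (InnerProductSpace.toDual ℝ E (gradient f y - gradient f x₀)) y := by
    intro y hy
    have h1 := (hd y hy).hasGradientAt.hasFDerivAt
    have h2 : HasFDerivAt (fun y => ⟪gradient f x₀, y⟫)
        (InnerProductSpace.toDual ℝ E (gradient f x₀)) y :=
      (InnerProductSpace.toDual ℝ E (gradient f x₀)).hasFDerivAt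
    rw [map_sub]
    exact h1.sub h2
  have := Convex.norm_image_sub_le_of_norm_hasFDerivWithin_le (𝕜 := ℝ) (s := closedBall x₀ R)
    (C := C) (f := fun y => f y - ⟪gradient f x₀, y⟫)
    (fun y hy => (hder y (by simpa [dist_eq_norm] using hy)).hasFDerivWithinAt)
    (fun y hy => by
      rw [LinearIsometryEquiv.norm_map]; exact hg y (by simpa [dist_eq_norm] using hy))
    (convex_closedBall _ _) (by simpa [dist_eq_norm] using hb) (by simpa [dist_eq_norm] using ha)
  rw [Real.norm_eq_abs] at this
  rw [inner_sub_right]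
  convert this using 2
  ring

/-- The descent lemma, for a gradient that is Lipschitz relative to the base point. -/
theorem le_add_inner_add_of_gradient {f : E → ℝ} {x₀ : E} {R φ : ℝ}
    (hd : ∀ y, ‖y - x₀‖ ≤ R → DifferentiableAt ℝ f y)
    (hg : ∀ y, ‖y - x₀‖ ≤ R → ‖gradient f y - gradient f x₀‖ ≤ φ * ‖y - x₀‖) {x : E}
    (hx : ‖x - x₀‖ ≤ R) :
    f x ≤ f x₀ + ⟪gradient f x₀, x - x₀⟫ + φ / 2 * ‖x - x₀‖ ^ 2 := by
  set v := x - x₀ with hv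
  let h : ℝ → ℝ := fun t => f (x₀ + t • v) - t * ⟪gradient f x₀, v⟫ - φ / 2 * t ^ 2 * ‖v‖ ^ 2
  have hmem : ∀ t ∈ Set.Icc (0 : ℝ) 1, ‖x₀ + t • v - x₀‖ ≤ R := by
    intro t ht
    rw [add_sub_cancel_left, norm_smul, Real.norm_eq_abs, abs_of_nonneg ht.1]
    exact (mul_le_of_le_one_left (norm_nonneg _) ht.2).trans hx
  have hder : ∀ t ∈ Set.Icc (0 : ℝ) 1, HasDerivAt h
      (⟪gradient f (x₀ + t • v), v⟫ - ⟪gradient f x₀, v⟫ - φ * t * ‖v‖ ^ 2) t := by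
    intro t ht
    have h1 := (hd _ (hmem t ht)).hasGradientAt.hasFDerivAt
    have h2 : HasDerivAt (fun t : ℝ => x₀ + t • v) v t := by
      simpa using ((hasDerivAt_id t).smul_const v).const_add x₀
    have h3 := h1.comp_hasDerivAt t h2
    rw [InnerProductSpace.toDual_apply_apply] at h3
    have h4 := (h3.sub ((hasDerivAt_id t).mul_const ⟪gradient f x₀, v⟫)).sub
      ((((hasDerivAt_id t).pow 2).const_mul (φ / 2)).mul_const (‖v‖ ^ 2))
    refine h4.congr_deriv ?_
    simp only [id]
    push_cast
    ring
  have hanti : AntitoneOn h (Set.Icc 0 1) := by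
    refine antitoneOn_of_deriv_nonpos (convex_Icc 0 1)
      (fun t ht => (hder t ht).continuousAt.continuousWithinAt)
      (fun t ht => ((hder t (interior_subset ht)).differentiableAt).differentiableWithinAt)
      fun t ht => ?_
    have ht' := interior_subset ht
    rw [(hder t ht').deriv, ← inner_sub_left]
    have h5 := real_inner_le_norm (gradient f (x₀ + t • v) - gradient f x₀) v
    have h6 := hg _ (hmem t ht')
    rw [add_sub_cancel_left, norm_smul, Real.norm_eq_abs, abs_of_nonneg ht'.1] at h6
    nlinarith [mul_le_mul_of_nonneg_right h6 (norm_nonneg v)]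
  have h01 := hanti (Set.left_mem_Icc.2 zero_le_one) (Set.right_mem_Icc.2 zero_le_one) zero_le_one
  simp only [h, one_smul, zero_smul, add_zero, hv, add_sub_cancel] at h01
  linarith

theorem norm_gradient_le_of_lip {f : E → ℝ} {x₀ : E} {R C : ℝ} (hR : 0 < R) (hC : 0 ≤ C)
    (hf : ∀ y, ‖y - x₀‖ ≤ R → |f y - f x₀| ≤ C * ‖y - x₀‖) : ‖gradient f x₀‖ ≤ C := by
  rw [gradient, LinearIsometryEquiv.norm_map]
  refine norm_fderiv_le_of_lip' ℝ hC ?_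
  filter_upwards [closedBall_mem_nhds x₀ hR] with y hy
  exact hf y (by simpa [dist_eq_norm] using hy)

/-- A nonnegative function that is flat compared with a ball has a small gradient. -/
theorem mul_norm_gradient_le {f : E → ℝ} {x₀ : E} {R φ : ℝ} (hR : 0 < R) (hφ : 0 ≤ φ)
    (hd : ∀ y, ‖y - x₀‖ ≤ R → DifferentiableAt ℝ f y)
    (hg : ∀ y, ‖y - x₀‖ ≤ R → ‖gradient f y - gradient f x₀‖ ≤ φ * ‖y - x₀‖)
    (h0 : ∀ y, ‖y - x₀‖ ≤ R → 0 ≤ f y) :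
    R * ‖gradient f x₀‖ ≤ f x₀ + φ / 2 * R ^ 2 := by
  by_cases hz : gradient f x₀ = 0
  · rw [hz, norm_zero, mul_zero]
    have := h0 x₀ (by simpa using hR.le)
    positivity
  · have hv0 : 0 < ‖gradient f x₀‖ := norm_pos_iff.2 hz
    have hx : ‖x₀ + (-(R / ‖gradient f x₀‖)) • gradient f x₀ - x₀‖ = R := by
      rw [add_sub_cancel_left, norm_smul, Real.norm_eq_abs, abs_neg, abs_of_pos (by positivity)]
      field_simp
    have := le_add_inner_add_of_gradient hd hg hx.le
    have h1 := h0 _ hx.le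
    rw [hx, add_sub_cancel_left, inner_smul_right, real_inner_self_eq_norm_sq] at this
    have h2 : -(R / ‖gradient f x₀‖) * ‖gradient f x₀‖ ^ 2 = -(R * ‖gradient f x₀‖) := by
      field_simp
    linarith

end Smooth

/-! ### Schur stable matrices and the discrete Lyapunov equation -/

/-- The value `x ⬝ X x` of a quadratic form, as a continuous linear function of the matrix. -/
noncomputable def quadAt {ι : Type*} [Fintype ι] (x : ι → ℝ) : Matrix ι ι ℝ →L[ℝ] ℝ :=
  LinearMap.toContinuousLinearMap
    { toFun := fun X => x ⬝ᵥ (X *ᵥ x)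
      map_add' := fun X Y => by rw [add_mulVec, dotProduct_add]
      map_smul' := fun c X => by rw [smul_mulVec, dotProduct_smul]; rfl }

theorem quadAt_apply {ι : Type*} [Fintype ι] (x : ι → ℝ) (X : Matrix ι ι ℝ) :
    quadAt x X = x ⬝ᵥ (X *ᵥ x) := rfl

/-- The solution `X` of a linear equation `X - a X b = m` in a finite-dimensional algebra depends
smoothly on `a`, `b` and `m` where the equation is solvable for every right-hand side. -/
theorem contDiffOn_of_sub_mul_mul_eq {A E : Type*} [NormedRing A] [NormedAlgebra ℝ A]
    [FiniteDimensional ℝ A] [NormedAddCommGroup E] [NormedSpace ℝ E] {k : ℕ∞} {a b m v : E → A}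
    {U : Set E} (ha : ContDiff ℝ k a) (hb : ContDiff ℝ k b) (hm : ContDiff ℝ k m)
    (hsolv : ∀ x ∈ U, ∀ c, ∃ X, X - a x * X * b x = c)
    (hv : ∀ x ∈ U, v x - a x * v x * b x = m x) : ContDiffOn ℝ k v U := by
  have hcomplete : CompleteSpace A := FiniteDimensional.complete ℝ A
  obtain ⟨Φ, hΦ', hΦ⟩ : ∃ Φ : E → A →L[ℝ] A, ContDiff ℝ k Φ ∧
      ∀ x X, Φ x X = X - a x * X * b x :=
    ⟨fun x => 1 - ContinuousLinearMap.mulLeftRight ℝ A (a x) (b x), by fun_prop, fun x X => by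
      rw [_root_.sub_apply, one_apply_eq_self, ContinuousLinearMap.mulLeftRight_apply]⟩
  have hu : ∀ x ∈ U, IsUnit (Φ x) := by
    intro x hx
    rw [ContinuousLinearMap.isUnit_iff_bijective]
    have hsurj : Function.Surjective (Φ x) := fun c => by
      simpa only [hΦ] using hsolv x hx c
    exact ⟨LinearMap.injective_iff_surjective.2 hsurj, hsurj⟩
  have heq : ∀ x ∈ U, v x = Ring.inverse (Φ x) (m x) := by
    intro x hx
    rw [← hv x hx, ← hΦ, ← mul_apply_eq_comp, Ring.inverse_mul_cancel _ (hu x hx),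
      one_apply_eq_self]
  refine ContDiffOn.congr (ContDiffOn.clm_apply (fun x hx => ?_) hm.contDiffOn) heq
  obtain ⟨w, hw⟩ := hu x hx
  have h1 := contDiffAt_ringInverse ℝ (n := k) w
  rw [hw] at h1
  exact (h1.comp x hΦ'.contDiffAt).contDiffWithinAt

section Lyapunov

open Filter Topology
open scoped Matrix.Norms.Frobenius

variable {ι : Type*} [Fintype ι] [DecidableEq ι]

/-- A matrix is Schur stable iff some power of it is a contraction (Gelfand's formula for the
complexified matrix). -/
theorem isSchur_iff_exists_norm_pow_lt_one [Nonempty ι] {L : Matrix ι ι ℝ} :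
    IsSchur L ↔ ∃ t, 1 ≤ t ∧ ‖L ^ t‖ < 1 := by
  set c : Matrix ι ι ℂ := L.map (fun a : ℝ => (a : ℂ)) with hc
  have hpow : ∀ t, ‖c ^ t‖ = ‖L ^ t‖ := by
    intro t
    have : c ^ t = (L ^ t).map (fun a : ℝ => (a : ℂ)) :=
      (map_pow (Complex.ofRealHom.mapMatrix (m := ι)) L t).symm
    rw [this]
    exact frobenius_norm_map_eq _ _ fun a => by simp
  constructor
  · intro h
    have hr : spectralRadius ℂ c < (1 : NNReal) :=
      spectrum.spectralRadius_lt_of_forall_lt c fun k hk => h k hk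
    have hev := (spectrum.pow_nnnorm_pow_one_div_tendsto_nhds_spectralRadius c).eventually_lt_const
      hr
    obtain ⟨t, ht, ht1⟩ := (hev.and (eventually_ge_atTop 1)).exists
    refine ⟨t, ht1, ?_⟩
    rw [← hpow]
    by_contra hcon
    push Not at hcon
    have h1 : (1 : ENNReal) ≤ (‖c ^ t‖₊ : ENNReal) := by exact_mod_cast hcon
    have h2 : (1 : ENNReal) ≤ (‖c ^ t‖₊ : ENNReal) ^ (1 / (t : ℝ)) :=
      ENNReal.one_le_rpow h1 (by positivity)
    exact absurd ht (not_lt.2 (by simpa using h2))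
  · rintro ⟨t, ht, hlt⟩ z hz
    by_contra hcon
    push Not at hcon
    have hle : ∀ s : ℕ, 1 ≤ ‖L ^ t‖ ^ (s + 1) * ‖(1 : Matrix ι ι ℂ)‖ := by
      intro s
      have h1 := spectrum.norm_le_norm_mul_of_mem (spectrum.pow_mem_pow c (t * (s + 1)) hz)
      rw [norm_pow] at h1
      refine (one_le_pow₀ hcon).trans (h1.trans ?_)
      gcongr
      rw [pow_mul, ← hpow]
      exact norm_pow_le' _ s.succ_pos
    have hlim := ((tendsto_pow_atTop_nhds_zero_of_lt_one (norm_nonneg _) hlt).comp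
      (tendsto_add_atTop_nat 1)).mul_const
      ‖(1 : Matrix ι ι ℂ)‖
    rw [zero_mul] at hlim
    exact absurd (ge_of_tendsto' hlim hle) (by norm_num)

theorem isOpen_setOf_isSchur [Nonempty ι] : IsOpen {L : Matrix ι ι ℝ | IsSchur L} := by
  have : {L : Matrix ι ι ℝ | IsSchur L} = ⋃ t ∈ {t : ℕ | 1 ≤ t}, {L | ‖L ^ t‖ < 1} := by
    ext L
    simp [isSchur_iff_exists_norm_pow_lt_one]
  rw [this]
  exact isOpen_biUnion fun t _ => isOpen_lt (by fun_prop) continuous_const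

theorem summable_norm_pow_of_isSchur [Nonempty ι] {L : Matrix ι ι ℝ} (h : IsSchur L) :
    Summable fun t => ‖L ^ t‖ := by
  obtain ⟨p, hp, hlt⟩ := isSchur_iff_exists_norm_pow_lt_one.1 h
  have : NeZero p := ⟨by omega⟩
  rw [← (Nat.divModEquiv p).symm.summable_iff]
  have hsum : Summable fun x : ℕ × Fin p => ‖L ^ p‖ ^ x.1 * (1 + ‖(1 : Matrix ι ι ℝ)‖) *
      ‖L ^ (x.2 : ℕ)‖ := by
    refine Summable.mul_of_nonneg (f := fun s : ℕ => ‖L ^ p‖ ^ s * (1 + ‖(1 : Matrix ι ι ℝ)‖))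
      (g := fun r : Fin p => ‖L ^ (r : ℕ)‖) ?_ (Summable.of_finite) ?_ ?_
    · exact (summable_geometric_of_lt_one (norm_nonneg _) hlt).mul_right _
    · intro s; positivity
    · intro r; positivity
  refine hsum.of_nonneg_of_le (fun x => norm_nonneg _) fun x => ?_
  have : (Nat.divModEquiv p).symm x = p * x.1 + x.2 := by
    simp [Nat.divModEquiv, mul_comm]
  simp only [Function.comp_apply, this]
  rw [pow_add, pow_mul]
  refine (norm_mul_le _ _).trans ?_
  gcongr
  rcases Nat.eq_zero_or_pos x.1 with h0 | h0
  · simp [h0]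
  · refine (norm_pow_le' _ h0).trans (le_mul_of_one_le_right (by positivity) ?_)
    linarith [norm_nonneg (1 : Matrix ι ι ℝ)]

theorem tendsto_norm_pow_of_isSchur [Nonempty ι] {L : Matrix ι ι ℝ} (h : IsSchur L) :
    Tendsto (fun t => ‖L ^ t‖) atTop (𝓝 0) :=
  (summable_norm_pow_of_isSchur h).tendsto_atTop_zero

/-- The solution `∑ (Lᵀ)ᵗ M Lᵗ` of the discrete Lyapunov equation `X = M + Lᵀ X L`. -/
noncomputable def lyapunov (L M : Matrix ι ι ℝ) : Matrix ι ι ℝ :=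
  ∑' t : ℕ, Lᵀ ^ t * M * L ^ t

theorem summable_lyapunov [Nonempty ι] {L : Matrix ι ι ℝ} (h : IsSchur L) (M : Matrix ι ι ℝ) :
    Summable fun t : ℕ => Lᵀ ^ t * M * L ^ t := by
  obtain ⟨C, hC⟩ := (tendsto_norm_pow_of_isSchur h).bddAbove_range
  refine Summable.of_norm_bounded (g := fun t => C * ‖M‖ * ‖L ^ t‖)
    ((summable_norm_pow_of_isSchur h).mul_left _) fun t => ?_
  refine (norm_mul_le _ _).trans ?_
  gcongr
  refine (norm_mul_le _ _).trans ?_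
  gcongr
  rw [← transpose_pow, frobenius_norm_transpose]
  exact hC ⟨t, rfl⟩

theorem lyapunov_eq [Nonempty ι] {L : Matrix ι ι ℝ} (h : IsSchur L) (M : Matrix ι ι ℝ) :
    lyapunov L M = M + Lᵀ * lyapunov L M * L := by
  have hs := summable_lyapunov h M
  conv_lhs => rw [lyapunov, hs.tsum_eq_zero_add]
  rw [lyapunov, ← hs.tsum_mul_left, ← (hs.mul_left _).tsum_mul_right]
  simp only [pow_zero, one_mul, mul_one]
  congr 1
  refine tsum_congr fun t => ?_
  rw [pow_succ' Lᵀ, pow_succ L]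
  simp only [Matrix.mul_assoc]

/-- The solution of the Lyapunov equation depends smoothly on its data. -/
theorem contDiffOn_lyapunov [Nonempty ι] {E : Type*} [NormedAddCommGroup E] [NormedSpace ℝ E]
    {k : ℕ∞} {L M : E → Matrix ι ι ℝ} (hL : ContDiff ℝ k L) (hM : ContDiff ℝ k M) :
    ContDiffOn ℝ k (fun x => lyapunov (L x) (M x)) {x | IsSchur (L x)} := by
  have ht : ContDiff ℝ k fun x => (L x)ᵀ :=
    ((transposeLinearEquiv ι ι ℝ ℝ).toLinearMap.toContinuousLinearMap).contDiff.comp hL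
  exact contDiffOn_of_sub_mul_mul_eq ht hL hM
    (fun x hx m => ⟨lyapunov (L x) m, by nth_rewrite 1 [lyapunov_eq hx m]; abel⟩)
    (fun x hx => by nth_rewrite 1 [lyapunov_eq hx (M x)]; abel)

theorem dotProduct_pow_mulVec (L M : Matrix ι ι ℝ) (x : ι → ℝ) (t : ℕ) :
    (L ^ t *ᵥ x) ⬝ᵥ (M *ᵥ (L ^ t *ᵥ x)) = x ⬝ᵥ ((Lᵀ ^ t * M * L ^ t) *ᵥ x) := by
  rw [← transpose_pow, Matrix.mul_assoc, ← mulVec_mulVec, dotProduct_mulVec x, vecMul_transpose,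
    ← mulVec_mulVec]

theorem hasSum_quadratic_lyapunov [Nonempty ι] {L : Matrix ι ι ℝ} (h : IsSchur L)
    (M : Matrix ι ι ℝ) (x : ι → ℝ) :
    HasSum (fun t : ℕ => (L ^ t *ᵥ x) ⬝ᵥ (M *ᵥ (L ^ t *ᵥ x))) (x ⬝ᵥ (lyapunov L M *ᵥ x)) := by
  have := (summable_lyapunov h M).hasSum.mapL (quadAt x)
  simp only [quadAt_apply, ← dotProduct_pow_mulVec] at this
  exact this

theorem posSemidef_lyapunov [Nonempty ι] {L M : Matrix ι ι ℝ} (h : IsSchur L)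
    (hM : M.PosSemidef) : (lyapunov L M).PosSemidef := by
  refine PosSemidef.of_dotProduct_mulVec_nonneg ?_ fun x => ?_
  · rw [IsHermitian, conjTranspose_eq_transpose_of_trivial, lyapunov, Matrix.transpose_tsum]
    refine tsum_congr fun t => ?_
    have hMt : Mᵀ = M := by
      simpa [conjTranspose_eq_transpose_of_trivial] using hM.isHermitian.eq
    rw [transpose_mul, transpose_mul, transpose_pow, transpose_pow, transpose_transpose, hMt,
      Matrix.mul_assoc]
  · rw [star_trivial, ← (hasSum_quadratic_lyapunov h M x).tsum_eq]
    exact tsum_nonneg fun t => by simpa using hM.dotProduct_mulVec_nonneg (L ^ t *ᵥ x)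

/-- The part of the series from time `T` on is the value at the state at time `T`. -/
theorem quadratic_lyapunov_sub_sum [Nonempty ι] {L : Matrix ι ι ℝ} (h : IsSchur L)
    (M : Matrix ι ι ℝ) (x : ι → ℝ) (T : ℕ) :
    x ⬝ᵥ (lyapunov L M *ᵥ x) -
      ∑ t ∈ range T, (L ^ t *ᵥ x) ⬝ᵥ (M *ᵥ (L ^ t *ᵥ x)) =
      (L ^ T *ᵥ x) ⬝ᵥ (lyapunov L M *ᵥ (L ^ T *ᵥ x)) := by
  have h1 := hasSum_quadratic_lyapunov h M x
  have h2 := hasSum_quadratic_lyapunov h M (L ^ T *ᵥ x)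
  rw [← h1.tsum_eq, ← h2.tsum_eq, ← h1.summable.sum_add_tsum_nat_add T, add_sub_cancel_left]
  refine tsum_congr fun t => ?_
  rw [mulVec_mulVec x (L ^ t), ← pow_add]

theorem frobenius_norm_sq (X : Matrix ι ι ℝ) : ‖X‖ ^ 2 = ∑ i, ∑ j, X i j ^ 2 := by
  rw [frobenius_norm_def, ← Real.sqrt_eq_rpow, Real.sq_sqrt (by positivity)]
  simp

theorem dotProduct_mulVec_self_le (X : Matrix ι ι ℝ) (x : ι → ℝ) :
    (X *ᵥ x) ⬝ᵥ (X *ᵥ x) ≤ ‖X‖ ^ 2 * (x ⬝ᵥ x) := by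
  rw [frobenius_norm_sq, Finset.sum_mul]
  simp only [dotProduct, mulVec]
  refine Finset.sum_le_sum fun i _ => ?_
  have := Finset.sum_mul_sq_le_sq_mul_sq univ (fun j => X i j) x
  simpa [sq] using this

/-- The squared norms of the powers sum up to the trace of the solution for the weight `1`. -/
theorem hasSum_norm_pow_sq [Nonempty ι] {L : Matrix ι ι ℝ} (h : IsSchur L) :
    HasSum (fun t : ℕ => ‖L ^ t‖ ^ 2) (lyapunov L 1).trace := by
  have := (summable_lyapunov h 1).hasSum.mapL
    ((traceLinearMap ι ℝ ℝ).toContinuousLinearMap)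
  convert! this using 2 with t
  rw [frobenius_norm_sq]
  simp only [LinearMap.coe_toContinuousLinearMap', traceLinearMap_apply, mul_one]
  rw [← transpose_pow, trace]
  simp only [diag_apply, mul_apply, transpose_apply]
  rw [Finset.sum_comm]
  simp [sq]

/-- The powers decay at a rate that depends only on the trace: every factorization of the power
gives a term of a convolution of two convergent series. -/
theorem mul_norm_pow_sq_le [Nonempty ι] {L : Matrix ι ι ℝ} (h : IsSchur L) (T : ℕ) :
    T * ‖L ^ T‖ ^ 2 ≤ (lyapunov L 1).trace ^ 2 := by
  have hs := hasSum_norm_pow_sq h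
  set V := (lyapunov L 1).trace
  have hV : 0 ≤ V := hs.nonneg fun t => by positivity
  have hle : ∀ t, ‖L ^ t‖ ^ 2 ≤ V := fun t => le_hasSum hs t fun _ _ => by positivity
  calc T * ‖L ^ T‖ ^ 2 = ∑ t ∈ range T, ‖L ^ T‖ ^ 2 := by simp
    _ ≤ ∑ t ∈ range T, ‖L ^ t‖ ^ 2 * V := by
      refine Finset.sum_le_sum fun t ht => ?_
      have h1 : L ^ T = L ^ t * L ^ (T - t) := by
        rw [← pow_add, Nat.add_sub_cancel' (Finset.mem_range.1 ht).le]
      calc ‖L ^ T‖ ^ 2 ≤ (‖L ^ t‖ * ‖L ^ (T - t)‖) ^ 2 := by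
            gcongr
            rw [h1]
            exact norm_mul_le _ _
        _ = ‖L ^ t‖ ^ 2 * ‖L ^ (T - t)‖ ^ 2 := by ring
        _ ≤ _ := by gcongr; exact hle _
    _ = (∑ t ∈ range T, ‖L ^ t‖ ^ 2) * V := by rw [Finset.sum_mul]
    _ ≤ V * V := by
      gcongr
      exact sum_le_hasSum _ (fun _ _ => by positivity) hs
    _ = V ^ 2 := by ring

theorem dotProduct_pow_mulVec_le_spectralNorm (L : Matrix ι ι ℝ) (x : ι → ℝ) (T : ℕ) :
    (L ^ T *ᵥ x) ⬝ᵥ (L ^ T *ᵥ x) ≤ matSpectralNorm L ^ (2 * T) * (x ⬝ᵥ x) := by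
  have hsq : ∀ y : ι → ℝ, y ⬝ᵥ y = ‖WithLp.toLp 2 y‖ ^ 2 := fun y => by
    rw [EuclideanSpace.real_norm_sq_eq]; simp [dotProduct, sq]
  have h1 : WithLp.toLp 2 (L ^ T *ᵥ x) =
      (Matrix.toEuclideanCLM (n := ι) (𝕜 := ℝ) L ^ T) (WithLp.toLp 2 x) := by
    rw [← map_pow]
    rfl
  rw [hsq, hsq, h1, pow_mul', ← mul_pow]
  gcongr
  refine (ContinuousLinearMap.le_opNorm _ _).trans ?_
  gcongr
  rcases Nat.eq_zero_or_pos T with rfl | hT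
  · rw [pow_zero, pow_zero]
    exact ContinuousLinearMap.norm_id_le
  · exact norm_pow_le' _ hT

end Lyapunov

/-! ### Quadratic forms and second moments -/

section Moments

open scoped MatrixOrder Matrix.Norms.Frobenius

variable {ι : Type*} [Fintype ι]

theorem dotProduct_self_nonneg' (x : ι → ℝ) : 0 ≤ x ⬝ᵥ x := by
  simpa using dotProduct_star_self_nonneg x

theorem quadratic_eq_sum (X : Matrix ι ι ℝ) (x : ι → ℝ) :
    x ⬝ᵥ (X *ᵥ x) = ∑ a, ∑ b, X a b * (x a * x b) := by
  simp only [dotProduct, mulVec, Finset.mul_sum]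
  exact Finset.sum_congr rfl fun a _ => Finset.sum_congr rfl fun b _ => by ring

variable {D : Measure (ι → ℝ)} [IsProbabilityMeasure D]

theorem integrable_mul_apply (hD : ∃ M : ℝ, ∀ᵐ x ∂D, ‖x‖ ≤ M) (a b : ι) :
    Integrable (fun x : ι → ℝ => x a * x b) D := by
  obtain ⟨M, hM⟩ := hD
  refine Integrable.of_bound (by fun_prop : Continuous fun x : ι → ℝ =>
    x a * x b).aestronglyMeasurable (M * M) ?_
  filter_upwards [hM] with x hx
  rw [norm_mul]
  exact mul_le_mul ((norm_le_pi_norm x a).trans hx) ((norm_le_pi_norm x b).trans hx)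
    (norm_nonneg _) ((norm_nonneg _).trans hx)

theorem integrable_quadratic (hD : ∃ M : ℝ, ∀ᵐ x ∂D, ‖x‖ ≤ M) (X : Matrix ι ι ℝ) :
    Integrable (fun x : ι → ℝ => x ⬝ᵥ (X *ᵥ x)) D := by
  simp_rw [quadratic_eq_sum]
  exact integrable_finsetSum _ fun a _ => integrable_finsetSum _ fun b _ =>
    (integrable_mul_apply hD a b).const_mul _

theorem integral_quadratic (hD : ∃ M : ℝ, ∀ᵐ x ∂D, ‖x‖ ≤ M) (X : Matrix ι ι ℝ) :
    ∫ x, x ⬝ᵥ (X *ᵥ x) ∂D = ∑ a, ∑ b, X a b * secondMoment D a b := by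
  have hab : ∀ a b, Integrable (fun x : ι → ℝ => X a b * (x a * x b)) D :=
    fun a b => (integrable_mul_apply hD a b).const_mul _
  calc ∫ x, x ⬝ᵥ (X *ᵥ x) ∂D = ∫ x, ∑ a, ∑ b, X a b * (x a * x b) ∂D :=
        integral_congr_ae (Filter.Eventually.of_forall fun x => quadratic_eq_sum X x)
    _ = ∑ a, ∫ x, ∑ b, X a b * (x a * x b) ∂D :=
        integral_finsetSum _ fun a _ => integrable_finsetSum _ fun b _ => hab a b
    _ = ∑ a, ∑ b, ∫ x, X a b * (x a * x b) ∂D :=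
        Finset.sum_congr rfl fun a _ => integral_finsetSum _ fun b _ => hab a b
    _ = _ := Finset.sum_congr rfl fun a _ => Finset.sum_congr rfl fun b _ => by
        rw [integral_const_mul]; rfl

theorem integrable_dotProduct_sq (hD : ∃ M : ℝ, ∀ᵐ x ∂D, ‖x‖ ≤ M) (v : ι → ℝ) :
    Integrable (fun x => (v ⬝ᵥ x) ^ 2) D := by
  simp_rw [sq, dotProduct, Finset.sum_mul, Finset.mul_sum]
  refine integrable_finsetSum _ fun a _ => integrable_finsetSum _ fun b _ => ?_
  refine ((integrable_mul_apply hD a b).const_mul (v a * v b)).congr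
    (Filter.Eventually.of_forall fun x => by simp only; ring)

variable [DecidableEq ι]

theorem lambdaMin_mul_dotProduct_le {A : Matrix ι ι ℝ} (hA : A.IsHermitian) (v : ι → ℝ) :
    lambdaMin A * (v ⬝ᵥ v) ≤ v ⬝ᵥ (A *ᵥ v) := by
  have h1 : algebraMap ℝ (Matrix ι ι ℝ) (lambdaMin A) ≤ A := by
    rw [algebraMap_le_iff_le_spectrum (ha := hA)]
    exact fun x hx => csInf_le A.finite_real_spectrum.bddBelow hx
  have h2 := (Matrix.le_iff.1 h1).dotProduct_mulVec_nonneg v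
  rw [star_trivial, sub_mulVec, dotProduct_sub, Algebra.algebraMap_eq_smul_one] at h2
  simp only [smul_mulVec, one_mulVec, dotProduct_smul, smul_eq_mul] at h2
  linarith

theorem lambdaMin_pos [Nonempty ι] {A : Matrix ι ι ℝ} (hA : A.PosDef) : 0 < lambdaMin A := by
  have hne : (spectrum ℝ A).Nonempty := by
    rw [hA.isHermitian.spectrum_real_eq_range_eigenvalues]
    exact Set.range_nonempty _
  have hmem : lambdaMin A ∈ spectrum ℝ A := hne.csInf_mem A.finite_real_spectrum
  rw [hA.isHermitian.spectrum_real_eq_range_eigenvalues] at hmem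
  obtain ⟨i, hi⟩ := hmem
  rw [← hi]
  exact hA.eigenvalues_pos i

theorem dotProduct_self_le_lambdaMax {x : ι → ℝ} (hx : x ≠ 0) :
    x ⬝ᵥ x ≤ lambdaMax (vecMulVec x x) := by
  refine le_csSup (vecMulVec x x).finite_real_spectrum.bddAbove ?_
  rw [← Matrix.spectrum_toLin']
  refine Module.End.HasEigenvalue.mem_spectrum (Module.End.hasEigenvalue_of_hasEigenvector
    (x := x) ⟨?_, hx⟩)
  rw [Module.End.mem_eigenspace_iff, toLin'_apply, vecMulVec_mulVec]
  ext a
  simp [mul_comm]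

theorem lambdaMin_mul_le_integral_sq (hD : ∃ M : ℝ, ∀ᵐ x ∂D, ‖x‖ ≤ M)
    (hS : (secondMoment D).PosDef) (v : ι → ℝ) :
    lambdaMin (secondMoment D) * (v ⬝ᵥ v) ≤ ∫ x, (v ⬝ᵥ x) ^ 2 ∂D := by
  refine (lambdaMin_mul_dotProduct_le hS.isHermitian v).trans (le_of_eq ?_)
  have h1 : ∀ x : ι → ℝ, (v ⬝ᵥ x) ^ 2 = x ⬝ᵥ (vecMulVec v v *ᵥ x) := by
    intro x
    rw [vecMulVec_mulVec, sq, dotProduct_comm v x]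
    simp [dotProduct, Finset.mul_sum, mul_comm]
    grind
  simp_rw [h1]
  rw [integral_quadratic hD, quadratic_eq_sum]
  exact Finset.sum_congr rfl fun a _ => Finset.sum_congr rfl fun b _ => by
    rw [vecMulVec_apply]; ring

/-- A positive semidefinite form at a point is controlled by its mean, because the distribution
charges every direction. -/
theorem lambdaMin_mul_quadratic_le (hD : ∃ M : ℝ, ∀ᵐ x ∂D, ‖x‖ ≤ M)
    (hS : (secondMoment D).PosDef) {X : Matrix ι ι ℝ} (hX : X.PosSemidef) (x : ι → ℝ) :
    lambdaMin (secondMoment D) * (x ⬝ᵥ (X *ᵥ x)) ≤ (x ⬝ᵥ x) * ∫ y, y ⬝ᵥ (X *ᵥ y) ∂D := by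
  obtain ⟨B, hB⟩ := CStarAlgebra.nonneg_iff_eq_star_mul_self.1 hX.nonneg
  rw [star_eq_conjTranspose] at hB
  subst hB
  obtain ⟨b, hq⟩ : ∃ b : ι → ι → ℝ, ∀ y : ι → ℝ,
      y ⬝ᵥ ((Bᴴ * B) *ᵥ y) = ∑ a, (b a ⬝ᵥ y) ^ 2 := by
    refine ⟨fun a j => B a j, fun y => ?_⟩
    rw [conjTranspose_eq_transpose_of_trivial, ← mulVec_mulVec, dotProduct_mulVec,
      vecMul_transpose]
    simp [dotProduct, mulVec, sq]
  simp_rw [hq]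
  rw [integral_finsetSum _ fun a _ => integrable_dotProduct_sq hD _, Finset.mul_sum,
    Finset.mul_sum]
  refine Finset.sum_le_sum fun a _ => ?_
  have h1 : (b a ⬝ᵥ x) ^ 2 ≤ (b a ⬝ᵥ b a) * (x ⬝ᵥ x) := by
    have := Finset.sum_mul_sq_le_sq_mul_sq univ (b a) x
    simpa [dotProduct, sq] using this
  have h0 : 0 ≤ lambdaMin (secondMoment D) := by
    rcases isEmpty_or_nonempty ι with h | h
    · exact h.elim a
    · exact (lambdaMin_pos hS).le
  calc lambdaMin (secondMoment D) * (b a ⬝ᵥ x) ^ 2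
      ≤ lambdaMin (secondMoment D) * ((b a ⬝ᵥ b a) * (x ⬝ᵥ x)) := by gcongr
    _ = (x ⬝ᵥ x) * (lambdaMin (secondMoment D) * (b a ⬝ᵥ b a)) := by ring
    _ ≤ _ := by
      gcongr
      · exact dotProduct_self_nonneg' x
      · exact lambdaMin_mul_le_integral_sq hD hS (b a)

end Moments

/-! ### Costs as quadratic forms -/

namespace MultiAgentLQR

variable {N n m : ℕ} (P : MultiAgentLQR N n m)

section Weights

/-- The quadratic form of the running cost under `u = - K x`. -/
noncomputable def weight (W : Matrix (Fin n × Fin N) (Fin n × Fin N) ℝ)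
    (V : Matrix (Fin m × Fin N) (Fin m × Fin N) ℝ) (K : P.Pol) :
    Matrix (Fin n × Fin N) (Fin n × Fin N) ℝ :=
  W + (P.gain K)ᵀ * V * P.gain K

/-- The closed-loop matrix of the discounted system, as a function of the policy. -/
noncomputable def loop (K : P.Pol) : Matrix (Fin n × Fin N) (Fin n × Fin N) ℝ :=
  P.discLoop (P.gain K)

/-- The matrix of the quadratic form that gives the cost of the initial state. -/
noncomputable def valMat (W : Matrix (Fin n × Fin N) (Fin n × Fin N) ℝ)
    (V : Matrix (Fin m × Fin N) (Fin m × Fin N) ℝ) (K : P.Pol) :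
    Matrix (Fin n × Fin N) (Fin n × Fin N) ℝ :=
  lyapunov (P.loop K) (P.weight W V K)

theorem mem_stab {K : P.Pol} : K ∈ P.stab ↔ IsSchur (P.loop K) := Iff.rfl

theorem loop_pow_mulVec (K : P.Pol) (x : P.State) (t : ℕ) :
    P.loop K ^ t *ᵥ x = Real.sqrt P.disc ^ t • P.traj (P.gain K) x t := by
  rw [loop, discLoop, smul_pow, smul_mulVec, traj]

/-- Discounting the cost amounts to scaling the closed-loop matrix. -/
theorem stageCost_eq (W : Matrix (Fin n × Fin N) (Fin n × Fin N) ℝ)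
    (V : Matrix (Fin m × Fin N) (Fin m × Fin N) ℝ) (K : P.Pol) (x : P.State) (t : ℕ) :
    P.stageCost W V (P.gain K) x t =
      (P.loop K ^ t *ᵥ x) ⬝ᵥ (P.weight W V K *ᵥ (P.loop K ^ t *ᵥ x)) := by
  have hd : P.disc ^ t = Real.sqrt P.disc ^ t * Real.sqrt P.disc ^ t := by
    rw [← mul_pow, Real.mul_self_sqrt P.disc_pos.le]
  rw [P.loop_pow_mulVec, mulVec_smul, dotProduct_smul, smul_dotProduct, smul_eq_mul, smul_eq_mul,
    stageCost, hd, weight, mul_assoc]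

theorem dotProduct_weight_mulVec (W : Matrix (Fin n × Fin N) (Fin n × Fin N) ℝ)
    (V : Matrix (Fin m × Fin N) (Fin m × Fin N) ℝ) (K : P.Pol) (x : P.State) :
    x ⬝ᵥ (P.weight W V K *ᵥ x) =
      x ⬝ᵥ (W *ᵥ x) + (P.gain K *ᵥ x) ⬝ᵥ (V *ᵥ (P.gain K *ᵥ x)) := by
  rw [weight, add_mulVec, dotProduct_add, Matrix.mul_assoc, ← mulVec_mulVec,
    dotProduct_mulVec x (P.gain K)ᵀ, vecMul_transpose, ← mulVec_mulVec]

open scoped Matrix.Norms.Frobenius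

theorem contDiff_matrix {E : Type*} [NormedAddCommGroup E] [NormedSpace ℝ E] {p q : Type*}
    [Fintype p] [Fintype q] {k : ℕ∞} {f : E → Matrix p q ℝ}
    (h : ∀ i j, ContDiff ℝ k fun x => f x i j) : ContDiff ℝ k f := by
  let e : (p → q → ℝ) →L[ℝ] Matrix p q ℝ := LinearMap.toContinuousLinearMap
    (ofLinearEquiv ℝ : (p → q → ℝ) ≃ₗ[ℝ] Matrix p q ℝ).toLinearMap
  exact e.contDiff.comp (contDiff_pi.2 fun i => contDiff_pi.2 fun j => h i j)

theorem contDiff_gain_apply {k : ℕ∞} (a : Fin m × Fin N) (b : Fin n × Fin N) :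
    ContDiff ℝ k fun K : P.Pol => P.gain K a b := by
  by_cases h : b.2 ∈ P.nbrS a.2
  · simp only [gain, of_apply, h, dif_pos]
    fun_prop
  · simp only [gain, of_apply, h, dif_neg, not_false_eq_true]
    exact contDiff_const

theorem contDiff_loop {k : ℕ∞} : ContDiff ℝ k P.loop := by
  refine contDiff_matrix fun i j => ?_
  have := fun a => P.contDiff_gain_apply (k := k) a j
  simp only [loop, discLoop, closedLoop, Matrix.smul_apply, Matrix.sub_apply, mul_apply,
    smul_eq_mul]
  refine contDiff_const.mul (contDiff_const.sub (ContDiff.sum fun a _ => contDiff_const.mul ?_))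
  exact this a

theorem contDiff_weight {k : ℕ∞} (W : Matrix (Fin n × Fin N) (Fin n × Fin N) ℝ)
    (V : Matrix (Fin m × Fin N) (Fin m × Fin N) ℝ) : ContDiff ℝ k (P.weight W V) := by
  refine contDiff_matrix fun i j => ?_
  have h := fun a b => P.contDiff_gain_apply (k := k) a b
  simp only [weight, Matrix.add_apply, mul_apply, transpose_apply]
  exact contDiff_const.add (ContDiff.sum fun a _ => (ContDiff.sum fun b _ =>
    (h b i).mul contDiff_const).mul (h a j))

variable [Nonempty (Fin n × Fin N)]

theorem isOpen_stab : IsOpen P.stab :=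
  isOpen_setOf_isSchur.preimage (P.contDiff_loop (k := 0)).continuous

theorem contDiffOn_valMat {k : ℕ∞} (W : Matrix (Fin n × Fin N) (Fin n × Fin N) ℝ)
    (V : Matrix (Fin m × Fin N) (Fin m × Fin N) ℝ) :
    ContDiffOn ℝ k (P.valMat W V) P.stab :=
  contDiffOn_lyapunov P.contDiff_loop (P.contDiff_weight W V)

theorem hasSum_stageCost {K : P.Pol} (hK : K ∈ P.stab)
    (W : Matrix (Fin n × Fin N) (Fin n × Fin N) ℝ)
    (V : Matrix (Fin m × Fin N) (Fin m × Fin N) ℝ) (x : P.State) :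
    HasSum (P.stageCost W V (P.gain K) x) (x ⬝ᵥ (P.valMat W V K *ᵥ x)) := by
  have h := hasSum_quadratic_lyapunov (P.mem_stab.1 hK) (P.weight W V K) x
  simp only [← P.stageCost_eq] at h
  exact h

end Weights

section Psd

theorem posSemidef_weight {W : Matrix (Fin n × Fin N) (Fin n × Fin N) ℝ}
    {V : Matrix (Fin m × Fin N) (Fin m × Fin N) ℝ} (hW : W.PosSemidef) (hV : V.PosSemidef)
    (K : P.Pol) : (P.weight W V K).PosSemidef := by
  have := hV.conjTranspose_mul_mul_same (P.gain K)
  rw [conjTranspose_eq_transpose_of_trivial] at this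
  exact hW.add this

theorem dotProduct_blockDiagonal_mulVec {p : ℕ} (R : Fin N → Matrix (Fin p) (Fin p) ℝ)
    (y : Fin p × Fin N → ℝ) :
    y ⬝ᵥ (blockDiagonal R *ᵥ y) =
      ∑ j, (fun a => y (a, j)) ⬝ᵥ (R j *ᵥ fun a => y (a, j)) := by
  simp only [dotProduct, mulVec, Fintype.sum_prod_type, blockDiagonal_apply, ite_mul, zero_mul,
    Finset.sum_ite_eq, Finset.mem_univ, if_true]
  rw [Finset.sum_comm]

theorem posSemidef_blockDiagonal {p : ℕ} {R : Fin N → Matrix (Fin p) (Fin p) ℝ}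
    (hR : ∀ i, (R i).PosSemidef) : (blockDiagonal R).PosSemidef := by
  refine PosSemidef.of_dotProduct_mulVec_nonneg ?_ fun x => ?_
  · rw [IsHermitian, blockDiagonal_conjTranspose]
    congr 1
    ext1 i
    exact (hR i).isHermitian
  · rw [star_trivial, dotProduct_blockDiagonal_mulVec]
    exact Finset.sum_nonneg fun j _ => by
      simpa using (hR j).dotProduct_mulVec_nonneg fun a => x (a, j)

theorem posSemidef_khatriRao {G : Matrix (Fin N) (Fin N) ℝ} (hG : G.PosSemidef) :
    (Matrix.of fun a b : Fin n × Fin N => G a.2 b.2 * P.Qt a b).PosSemidef :=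
  (hG.submatrix Prod.snd).hadamard P.Qt_psd

theorem posSemidef_Q : P.Q.PosSemidef := P.posSemidef_khatriRao P.G_psd

theorem posSemidef_Rfull : P.Rfull.PosSemidef :=
  posSemidef_blockDiagonal fun i => (P.R_pos i).posSemidef

theorem posSemidef_localG (i : Fin N) : (P.localG i).PosSemidef := by
  classical
  have h := P.G_psd.conjTranspose_mul_mul_same
    (diagonal fun j => if P.Learn i j then (1 : ℝ) else 0)
  convert h using 1
  ext j k
  rw [diagonal_conjTranspose, mul_diagonal, diagonal_mul]
  by_cases hj : P.Learn i j <;> by_cases hk : P.Learn i k <;> simp [localG, hj, hk]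

theorem posSemidef_localQ (i : Fin N) : (P.localQ i).PosSemidef :=
  P.posSemidef_khatriRao (P.posSemidef_localG i)

theorem posSemidef_localR (i : Fin N) : (P.localR i).PosSemidef := by
  classical
  refine posSemidef_blockDiagonal fun j => ?_
  split_ifs
  · exact (P.R_pos j).posSemidef
  · exact PosSemidef.zero

theorem learn_self (i : Fin N) : P.Learn i i := ⟨i, Relation.ReflTransGen.refl, P.G_self i⟩

theorem stageCost_nonneg {W : Matrix (Fin n × Fin N) (Fin n × Fin N) ℝ}
    {V : Matrix (Fin m × Fin N) (Fin m × Fin N) ℝ} (hW : W.PosSemidef) (hV : V.PosSemidef)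
    (K : P.Pol) (x : P.State) (t : ℕ) : 0 ≤ P.stageCost W V (P.gain K) x t := by
  rw [P.stageCost_eq]
  simpa using (P.posSemidef_weight hW hV K).dotProduct_mulVec_nonneg (P.loop K ^ t *ᵥ x)

theorem J_nonneg (K : P.Pol) : 0 ≤ P.J K :=
  integral_nonneg fun x => tsum_nonneg fun t =>
    P.stageCost_nonneg P.posSemidef_Q P.posSemidef_Rfull K x t

theorem localH_nonneg (i : Fin N) (K : P.Pol) (x : P.State) : 0 ≤ P.localH i K x :=
  tsum_nonneg fun t => P.stageCost_nonneg (P.posSemidef_localQ i) (P.posSemidef_localR i) K x t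

theorem localJ_nonneg (i : Fin N) (K : P.Pol) : 0 ≤ P.localJ i K :=
  integral_nonneg fun x => P.localH_nonneg i K x

theorem exists_ae_dotProduct_self_le : ∃ M : ℝ, 0 < M ∧ ∀ᵐ x ∂P.D, x ⬝ᵥ x ≤ M := by
  obtain ⟨M, hM⟩ := P.D_bdd
  refine ⟨∑ _a : Fin n × Fin N, M ^ 2 + 1, by positivity, ?_⟩
  filter_upwards [hM] with x hx
  have : x ⬝ᵥ x ≤ ∑ _a : Fin n × Fin N, M ^ 2 := Finset.sum_le_sum fun a _ => by
    rw [← sq]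
    exact sq_le_sq' (by linarith [neg_le_of_abs_le ((norm_le_pi_norm x a).trans hx)])
      (le_of_abs_le ((norm_le_pi_norm x a).trans hx))
  linarith

end Psd

section Values

variable [Nonempty (Fin n × Fin N)]

theorem localH_eq {K : P.Pol} (hK : K ∈ P.stab) (i : Fin N) (x : P.State) :
    P.localH i K x = x ⬝ᵥ (P.valMat (P.localQ i) (P.localR i) K *ᵥ x) :=
  (P.hasSum_stageCost hK _ _ x).tsum_eq

theorem J_eq {K : P.Pol} (hK : K ∈ P.stab) :
    P.J K = ∫ x, x ⬝ᵥ (P.valMat P.Q P.Rfull K *ᵥ x) ∂P.D :=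
  integral_congr_ae (Filter.Eventually.of_forall fun x => (P.hasSum_stageCost hK _ _ x).tsum_eq)

theorem localJ_eq {K : P.Pol} (hK : K ∈ P.stab) (i : Fin N) :
    P.localJ i K = ∫ x, x ⬝ᵥ (P.valMat (P.localQ i) (P.localR i) K *ᵥ x) ∂P.D :=
  integral_congr_ae (Filter.Eventually.of_forall fun x => P.localH_eq hK i x)

theorem posSemidef_local_valMat {K : P.Pol} (hK : K ∈ P.stab) (i : Fin N) :
    (P.valMat (P.localQ i) (P.localR i) K).PosSemidef :=
  posSemidef_lyapunov hK (P.posSemidef_weight (P.posSemidef_localQ i) (P.posSemidef_localR i) K)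

open scoped Matrix.Norms.Frobenius in
theorem contDiffOn_integral_quadratic {k : ℕ∞} (W : Matrix (Fin n × Fin N) (Fin n × Fin N) ℝ)
    (V : Matrix (Fin m × Fin N) (Fin m × Fin N) ℝ) :
    ContDiffOn ℝ k (fun K => ∫ x, x ⬝ᵥ (P.valMat W V K *ᵥ x) ∂P.D) P.stab := by
  have hprob := P.D_prob
  simp_rw [integral_quadratic P.D_bdd]
  refine ContDiffOn.sum fun a _ => ContDiffOn.sum fun b _ => ContDiffOn.mul ?_ contDiffOn_const
  let e : Matrix (Fin n × Fin N) (Fin n × Fin N) ℝ →L[ℝ] ℝ :=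
    LinearMap.toContinuousLinearMap (entryLinearMap ℝ ℝ a b)
  exact e.contDiff.comp_contDiffOn (P.contDiffOn_valMat _ _)

theorem contDiffOn_J {k : ℕ∞} : ContDiffOn ℝ k P.J P.stab :=
  (P.contDiffOn_integral_quadratic P.Q P.Rfull).congr fun _ hK => P.J_eq hK

theorem regular {K : P.Pol} (hK : K ∈ P.stab) : P.Regular K := by
  have hprob := P.D_prob
  refine ⟨fun x => (P.hasSum_stageCost hK _ _ x).summable, ?_,
    fun i x => (P.hasSum_stageCost hK _ _ x).summable, fun i => ?_, ?_⟩
  · exact (integrable_quadratic P.D_bdd (P.valMat P.Q P.Rfull K)).congr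
      (Filter.Eventually.of_forall fun x => ((P.hasSum_stageCost hK _ _ x).tsum_eq).symm)
  · exact (integrable_quadratic P.D_bdd (P.valMat (P.localQ i) (P.localR i) K)).congr
      (Filter.Eventually.of_forall fun x => (P.localH_eq hK i x).symm)
  · exact ((P.contDiffOn_J (k := 1)).differentiableOn (by simp)).differentiableAt
      (P.isOpen_stab.mem_nhds hK)

theorem exists_localParams : ∃ lam zet phi bet : P.Pol → ℝ, P.LocalParams lam zet phi bet := by
  have hJ : ContDiffOn ℝ 1 P.J P.stab := P.contDiffOn_J (k := 1)
  have hgrad : ContDiffOn ℝ 1 (gradient P.J) P.stab := by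
    have h2 : ContDiffOn ℝ 1 (fderiv ℝ P.J) P.stab :=
      (P.contDiffOn_J (k := 2)).fderiv_of_isOpen P.isOpen_stab (by norm_num)
    exact ((InnerProductSpace.toDual ℝ P.Pol).symm.contDiff (n := 1)).comp_contDiffOn h2
  obtain ⟨lam, zet, h1, h2, h3, h4⟩ := exists_continuousOn_lipschitz P.isOpen_stab hJ
  obtain ⟨phi, bet, g1, g2, g3, g4⟩ := exists_continuousOn_lipschitz P.isOpen_stab hgrad
  exact ⟨lam, zet, phi, bet, ⟨h1, h2, g1, g2⟩,
    fun K hK => ⟨(h3 K hK).1, (h3 K hK).2, (g3 K hK).1, (g3 K hK).2⟩, h4, g4⟩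

/-- The local cost of a state is at most its expected value, up to the size of the state. -/
theorem lambdaMin_mul_localH_le {K : P.Pol} (hK : K ∈ P.stab) (i : Fin N) (x : P.State) :
    lambdaMin (secondMoment P.D) * P.localH i K x ≤ (x ⬝ᵥ x) * P.localJ i K := by
  have hprob := P.D_prob
  rw [P.localH_eq hK, P.localJ_eq hK]
  exact lambdaMin_mul_quadratic_le P.D_bdd P.D_pos (P.posSemidef_local_valMat hK i) x

theorem exists_costRatio : ∃ c : ℝ, P.CostRatio c := by
  obtain ⟨M, hM0, hM⟩ := P.exists_ae_dotProduct_self_le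
  have hl := lambdaMin_pos P.D_pos
  refine ⟨M / lambdaMin (secondMoment P.D), by positivity, ?_⟩
  filter_upwards [hM] with x hx i K hK
  have h1 := P.lambdaMin_mul_localH_le hK i x
  have h2 : (x ⬝ᵥ x) * P.localJ i K ≤ M * P.localJ i K :=
    mul_le_mul_of_nonneg_right hx (P.localJ_nonneg i K)
  rw [div_mul_eq_mul_div, le_div_iff₀ hl]
  linarith

end Values

end MultiAgentLQR

namespace MultiAgentLQR

variable {N n m : ℕ} (P : MultiAgentLQR N n m)

/-! ### Perturbations of one block -/

section Blocks

theorem replace_apply_same (K : P.Pol) (i : Fin N) (y : P.Blk i) : P.replace K i y i = y := by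
  simp [replace]

theorem replace_apply_of_ne (K : P.Pol) {i j : Fin N} (h : j ≠ i) (y : P.Blk i) :
    P.replace K i y j = K j := by
  simp [replace, h]

theorem replace_self (K : P.Pol) (i : Fin N) : P.replace K i (K i) = K := by
  ext j : 1
  by_cases h : j = i
  · subst h; rw [replace_apply_same]
  · rw [P.replace_apply_of_ne K h]

theorem norm_sub_eq_of_forall_ne {K K' : P.Pol} {i : Fin N} (h : ∀ j ≠ i, K j = K' j) :
    ‖K - K'‖ = ‖K i - K' i‖ := by
  have h1 : ‖K - K'‖ ^ 2 = ‖K i - K' i‖ ^ 2 := by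
    rw [PiLp.norm_sq_eq_of_L2, Finset.sum_eq_single i]
    · rfl
    · intro j _ hj
      rw [PiLp.sub_apply, h j hj]; simp
    · simp
  exact (sq_eq_sq₀ (norm_nonneg _) (norm_nonneg _)).1 h1

theorem norm_replace_sub_replace (K : P.Pol) (i : Fin N) (y y' : P.Blk i) :
    ‖P.replace K i y - P.replace K i y'‖ = ‖y - y'‖ := by
  rw [P.norm_sub_eq_of_forall_ne (i := i) fun j hj => by
    rw [P.replace_apply_of_ne K hj, P.replace_apply_of_ne K hj], replace_apply_same,
    replace_apply_same]

theorem norm_replace_sub (K : P.Pol) (i : Fin N) (y : P.Blk i) :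
    ‖P.replace K i y - K‖ = ‖y - K i‖ := by
  conv_lhs => rw [← P.replace_self K i, replace_self]
  conv_lhs => enter [1, 2]; rw [← P.replace_self K i]
  exact P.norm_replace_sub_replace K i y (K i)

theorem continuous_replace (K : P.Pol) (i : Fin N) : Continuous (P.replace K i) := by
  have : Isometry (P.replace K i) := Isometry.of_dist_eq fun y y' => by
    rw [dist_eq_norm, dist_eq_norm, P.norm_replace_sub_replace]
  exact this.continuous

theorem inner_replace_sub_replace (g K : P.Pol) (i : Fin N) (y y' : P.Blk i) :
    inner ℝ g (P.replace K i y - P.replace K i y') = inner ℝ (g i) (y - y') := by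
  rw [PiLp.inner_apply, Finset.sum_eq_single i]
  · rw [PiLp.sub_apply, replace_apply_same, replace_apply_same]
  · intro j _ hj
    rw [PiLp.sub_apply, P.replace_apply_of_ne K hj, P.replace_apply_of_ne K hj]; simp
  · simp

theorem finrank_blk (i : Fin N) : Module.finrank ℝ (P.Blk i) = P.dim i := by
  simp [Blk, dim, mul_assoc]

theorem dim_pos (hn : 0 < n) (hm : 0 < m) (i : Fin N) : 0 < P.dim i :=
  Nat.mul_pos (Nat.mul_pos hm (Finset.card_pos.2 ⟨i, P.nbrS_self i⟩)) hn

theorem nontrivial_blk (hn : 0 < n) (hm : 0 < m) (i : Fin N) : Nontrivial (P.Blk i) :=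
  Module.nontrivial_of_finrank_pos (R := ℝ) (by rw [finrank_blk]; exact P.dim_pos hn hm i)

end Blocks

/-! ### The policy of an agent affects the global cost only through its local cost -/

section Locality

theorem blockDiagonal_mulVec_apply {p q : ℕ} (A : Fin N → Matrix (Fin p) (Fin q) ℝ)
    (y : Fin q × Fin N → ℝ) (a : Fin p) (j : Fin N) :
    (blockDiagonal A *ᵥ y) (a, j) = (A j *ᵥ fun b => y (b, j)) a := by
  simp [mulVec, dotProduct, Fintype.sum_prod_type, blockDiagonal_apply]

theorem traj_succ (K : P.Gain) (x : P.State) (t : ℕ) :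
    P.traj K x (t + 1) = P.closedLoop K *ᵥ P.traj K x t := by
  rw [traj, traj, pow_succ', mulVec_mulVec]

variable {P} {K K' : P.Pol} {i : Fin N}

/-- The input of an agent that cannot be reached depends only on agents that cannot be reached. -/
theorem gain_mulVec_eq_of_not_reach (h : ∀ j ≠ i, K j = K' j) {X X' : P.State}
    (hX : ∀ j, ¬ P.Reach i j → ∀ a, X (a, j) = X' (a, j)) {j : Fin N} (hj : ¬ P.Reach i j)
    (b : Fin m) : (P.gain K *ᵥ X) (b, j) = (P.gain K' *ᵥ X') (b, j) := by
  have hji : j ≠ i := fun h => hj (h ▸ Relation.ReflTransGen.refl)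
  simp only [mulVec, dotProduct]
  refine Finset.sum_congr rfl fun c _ => ?_
  by_cases hc : c.2 ∈ P.nbrS j
  · have hcr : ¬ P.Reach i c.2 := fun hr => hj (hr.tail hc)
    have h1 := hX c.2 hcr c.1
    simp only [gain, of_apply, hc, dif_pos, h j hji]
    rw [Prod.mk.eta] at h1
    rw [h1]
  · simp [gain, hc]

theorem traj_eq_of_not_reach (h : ∀ j ≠ i, K j = K' j) (x : P.State) (t : ℕ) :
    ∀ j, ¬ P.Reach i j → ∀ a, P.traj (P.gain K) x t (a, j) = P.traj (P.gain K') x t (a, j) := by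
  induction t with
  | zero => intro j _ a; simp [traj]
  | succ t ih =>
    intro j hj a
    rw [traj_succ, traj_succ, closedLoop, closedLoop, sub_mulVec, sub_mulVec, Pi.sub_apply,
      Pi.sub_apply, ← mulVec_mulVec, ← mulVec_mulVec]
    rw [blockDiagonal_mulVec_apply, blockDiagonal_mulVec_apply, blockDiagonal_mulVec_apply,
      blockDiagonal_mulVec_apply]
    congr 2
    · ext a'
      exact ih j hj a'
    · ext b
      exact gain_mulVec_eq_of_not_reach h ih hj b

theorem learn_of_reach {j k : Fin N} (h : P.Reach i j) (hG : P.G j k ≠ 0) : P.Learn i k :=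
  ⟨j, h, hG⟩

theorem state_cost_sub_eq {X X' : P.State}
    (hX : ∀ j, ¬ P.Reach i j → ∀ a, X (a, j) = X' (a, j)) :
    X ⬝ᵥ (P.Q *ᵥ X) - X ⬝ᵥ (P.localQ i *ᵥ X) = X' ⬝ᵥ (P.Q *ᵥ X') - X' ⬝ᵥ (P.localQ i *ᵥ X') := by
  have hG : ∀ j k, P.G j k = P.G k j := fun j k => by
    simpa using (P.G_psd.isHermitian.apply j k).symm
  rw [quadratic_eq_sum, quadratic_eq_sum, quadratic_eq_sum, quadratic_eq_sum,
    ← Finset.sum_sub_distrib, ← Finset.sum_sub_distrib]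
  refine Finset.sum_congr rfl fun a _ => ?_
  rw [← Finset.sum_sub_distrib, ← Finset.sum_sub_distrib]
  refine Finset.sum_congr rfl fun b _ => ?_
  by_cases h0 : P.G a.2 b.2 = 0
  · simp [Q, localQ, localG, h0]
  -- a pair with a reachable member lies in the learning neighbourhood
  have hin : ∀ {j k}, P.G j k ≠ 0 → P.Reach i j → P.Learn i j ∧ P.Learn i k := fun hjk hr =>
    ⟨learn_of_reach hr (P.G_self _), learn_of_reach hr hjk⟩
  by_cases ha : P.Reach i a.2
  · simp [Q, localQ, localG, hin h0 ha]
  by_cases hb : P.Reach i b.2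
  · have := hin (by rwa [hG]) hb
    simp [Q, localQ, localG, this]
  have h1 := hX a.2 ha a.1
  have h2 := hX b.2 hb b.1
  rw [Prod.mk.eta] at h1 h2
  rw [h1, h2]

theorem input_cost_sub_eq {U U' : Fin m × Fin N → ℝ}
    (hU : ∀ j, ¬ P.Reach i j → ∀ b, U (b, j) = U' (b, j)) :
    U ⬝ᵥ (P.Rfull *ᵥ U) - U ⬝ᵥ (P.localR i *ᵥ U) =
      U' ⬝ᵥ (P.Rfull *ᵥ U') - U' ⬝ᵥ (P.localR i *ᵥ U') := by
  classical
  simp only [Rfull, localR]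
  rw [dotProduct_blockDiagonal_mulVec, dotProduct_blockDiagonal_mulVec,
    dotProduct_blockDiagonal_mulVec, dotProduct_blockDiagonal_mulVec, ← Finset.sum_sub_distrib,
    ← Finset.sum_sub_distrib]
  refine Finset.sum_congr rfl fun j _ => ?_
  by_cases hj : P.Learn i j
  · simp [hj]
  have hr : ¬ P.Reach i j := fun h => hj (learn_of_reach h (P.G_self j))
  have : (fun b => U (b, j)) = fun b => U' (b, j) := funext (hU j hr)
  rw [this]

theorem stageCost_sub_eq (h : ∀ j ≠ i, K j = K' j) (x : P.State) (t : ℕ) :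
    P.stageCost P.Q P.Rfull (P.gain K) x t -
        P.stageCost (P.localQ i) (P.localR i) (P.gain K) x t =
      P.stageCost P.Q P.Rfull (P.gain K') x t -
        P.stageCost (P.localQ i) (P.localR i) (P.gain K') x t := by
  have hX := traj_eq_of_not_reach h x t
  have h1 := state_cost_sub_eq hX
  have h2 := input_cost_sub_eq fun j hj b => gain_mulVec_eq_of_not_reach h hX hj b
  simp only [stageCost]
  rw [← mul_sub, ← mul_sub]
  congr 1
  have e := fun (W) (V) (K : P.Pol) x => P.dotProduct_weight_mulVec W V K x
  simp only [weight] at e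
  rw [e, e, e, e]
  linarith

variable [Nonempty (Fin n × Fin N)]

/-- Changing the policy of agent `i` changes the global cost and the local cost of agent `i` by
the same amount: the agents that notice the change cannot be seen from outside the learning
neighbourhood. -/
theorem J_sub_localJ_eq (hK : K ∈ P.stab) (hK' : K' ∈ P.stab) (h : ∀ j ≠ i, K j = K' j) :
    P.J K - P.localJ i K = P.J K' - P.localJ i K' := by
  obtain ⟨hs, hi, hsl, hil, -⟩ := P.regular hK
  obtain ⟨hs', hi', hsl', hil', -⟩ := P.regular hK'
  simp only [J, localJ]
  rw [← integral_sub hi (hil i), ← integral_sub hi' (hil' i)]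
  congr 1 with x
  simp only [localH]
  rw [← (hs x).tsum_sub (hsl i x), ← (hs' x).tsum_sub (hsl' i x)]
  exact tsum_congr fun t => stageCost_sub_eq h x t

end Locality

/-! ### The cost beyond a finite horizon -/

section Horizon

theorem localHT_nonneg (i : Fin N) (K : P.Pol) (x : P.State) (T : ℕ) : 0 ≤ P.localHT i T K x :=
  Finset.sum_nonneg fun t _ =>
    P.stageCost_nonneg (P.posSemidef_localQ i) (P.posSemidef_localR i) K x t

variable [Nonempty (Fin n × Fin N)]

theorem localH_sub_localHT {K : P.Pol} (hK : K ∈ P.stab) (i : Fin N) (T : ℕ) (x : P.State) :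
    P.localH i K x - P.localHT i T K x = P.localH i K (P.loop K ^ T *ᵥ x) := by
  have := quadratic_lyapunov_sub_sum (P.mem_stab.1 hK) (P.weight (P.localQ i) (P.localR i) K) x T
  rw [P.localH_eq hK, P.localH_eq hK, localHT]
  simp only [P.stageCost_eq]
  exact this

theorem localHT_le_localH {K : P.Pol} (hK : K ∈ P.stab) (i : Fin N) (T : ℕ) (x : P.State) :
    P.localHT i T K x ≤ P.localH i K x := by
  have h1 := P.localH_sub_localHT hK i T x
  have h2 := P.localH_nonneg i K (P.loop K ^ T *ᵥ x)
  linarith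

theorem lambdaMin_mul_tail_le {K : P.Pol} (hK : K ∈ P.stab) (i : Fin N) (T : ℕ) (x : P.State) :
    lambdaMin (secondMoment P.D) * (P.localH i K x - P.localHT i T K x) ≤
      ((P.loop K ^ T *ᵥ x) ⬝ᵥ (P.loop K ^ T *ᵥ x)) * P.localJ i K := by
  rw [P.localH_sub_localHT hK]
  exact P.lambdaMin_mul_localH_le hK i _

/-- The explicit horizon for a closed loop that is a contraction in the spectral norm. It uses
`κ ≤ exp (-(1 - κ))`. -/
theorem tail_le_of_log_le {K : P.Pol} (hK : K ∈ P.stab) {i : Fin N} {T : ℕ} {x : P.State}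
    {κ B ε' : ℝ} (hκ : κ < 1) (hLκ : matSpectralNorm (P.loop K) ≤ κ) (hJ : P.localJ i K ≤ B)
    (hε' : 0 < ε')
    (hT : 1 / (2 * (1 - κ)) * Real.log (B * lambdaMax (vecMulVec x x) /
      (lambdaMin (secondMoment P.D) * ε')) ≤ T) :
    P.localH i K x - P.localHT i T K x ≤ ε' := by
  have hl := lambdaMin_pos P.D_pos
  have htail := P.lambdaMin_mul_tail_le hK i T x
  have hJ0 := P.localJ_nonneg i K
  have hκ0 : 0 ≤ κ := (norm_nonneg _).trans hLκ
  have hpow : (P.loop K ^ T *ᵥ x) ⬝ᵥ (P.loop K ^ T *ᵥ x) ≤ κ ^ (2 * T) * (x ⬝ᵥ x) := by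
    refine (dotProduct_pow_mulVec_le_spectralNorm _ x T).trans ?_
    have := dotProduct_self_nonneg' x
    gcongr
    exact norm_nonneg _
  suffices h : κ ^ (2 * T) * (x ⬝ᵥ x) * B ≤ lambdaMin (secondMoment P.D) * ε' by
    have h1 : ((P.loop K ^ T *ᵥ x) ⬝ᵥ (P.loop K ^ T *ᵥ x)) * P.localJ i K ≤
        κ ^ (2 * T) * (x ⬝ᵥ x) * B := by
      have := dotProduct_self_nonneg' x
      exact mul_le_mul hpow hJ hJ0 (by positivity)
    exact le_of_mul_le_mul_left (htail.trans (h1.trans h)) hl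
  by_cases hx : x = 0
  · simp only [hx, dotProduct_zero, mul_zero, zero_mul]; positivity
  have hΛ := dotProduct_self_le_lambdaMax hx
  have hxx : 0 < x ⬝ᵥ x := by
    simpa using (dotProduct_star_self_pos_iff (v := x)).2 hx
  rcases (hJ0.trans hJ).eq_or_lt with hB | hB
  · rw [← hB, mul_zero]; positivity
  have harg : 0 < B * lambdaMax (vecMulVec x x) / (lambdaMin (secondMoment P.D) * ε') :=
    div_pos (mul_pos hB (hxx.trans_le hΛ)) (mul_pos hl hε')
  have h1 : Real.log (B * lambdaMax (vecMulVec x x) / (lambdaMin (secondMoment P.D) * ε')) ≤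
      (1 - κ) * (2 * T : ℕ) := by
    have h2 : 0 < 2 * (1 - κ) := by linarith
    rw [one_div, inv_mul_le_iff₀ h2] at hT
    push_cast
    linarith
  rw [Real.log_le_iff_le_exp harg, div_le_iff₀ (mul_pos hl hε')] at h1
  have h3 : κ ^ (2 * T) ≤ Real.exp (-((1 - κ) * (2 * T : ℕ))) := by
    have h4 : κ ≤ Real.exp (-(1 - κ)) := by
      have := Real.add_one_le_exp (-(1 - κ))
      linarith
    refine (pow_le_pow_left₀ hκ0 h4 _).trans (le_of_eq ?_)
    rw [← Real.exp_nat_mul]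
    congr 1
    ring
  set e := Real.exp ((1 - κ) * (2 * T : ℕ)) with he
  rw [Real.exp_neg] at h3
  have he0 : 0 < e := Real.exp_pos _
  calc κ ^ (2 * T) * (x ⬝ᵥ x) * B ≤ e⁻¹ * lambdaMax (vecMulVec x x) * B := by gcongr
    _ = e⁻¹ * (B * lambdaMax (vecMulVec x x)) := by ring
    _ ≤ e⁻¹ * (e * (lambdaMin (secondMoment P.D) * ε')) := by gcongr
    _ = _ := by field_simp

theorem contDiffOn_localJ {k : ℕ∞} (i : Fin N) : ContDiffOn ℝ k (P.localJ i) P.stab := by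
  have hprob := P.D_prob
  exact (P.contDiffOn_integral_quadratic (P.localQ i) (P.localR i)).congr fun K hK =>
    P.localJ_eq hK i

open scoped Matrix.Norms.Frobenius in
theorem continuousOn_trace_lyapunov :
    ContinuousOn (fun K => (lyapunov (P.loop K) 1).trace) P.stab := by
  have h1 : ContinuousOn (fun K => lyapunov (P.loop K) 1) P.stab :=
    (contDiffOn_lyapunov (k := 0) P.contDiff_loop contDiff_const).continuousOn
  exact ((traceLinearMap (Fin n × Fin N) ℝ ℝ).toContinuousLinearMap).continuous.comp_continuousOn h1

open scoped Matrix.Norms.Frobenius in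
/-- On a compact set of stabilizing policies the cost beyond a horizon is uniformly small. -/
theorem exists_horizon {C : Set P.Pol} (hC : IsCompact C) (hCs : C ⊆ P.stab) {ε' : ℝ}
    (hε' : 0 < ε') :
    ∃ Tbar : ℝ, ∀ᵐ x ∂P.D, ∀ K ∈ C, ∀ i, ∀ T : ℕ, Tbar ≤ T →
      P.localH i K x - P.localHT i T K x ≤ ε' := by
  have hl := lambdaMin_pos P.D_pos
  obtain ⟨M, hM0, hM⟩ := P.exists_ae_dotProduct_self_le
  obtain ⟨V, hV⟩ := hC.exists_bound_of_continuousOn (P.continuousOn_trace_lyapunov.mono hCs)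
  have hB : ∀ i, ∃ B, ∀ K ∈ C, ‖P.localJ i K‖ ≤ B := fun i =>
    hC.exists_bound_of_continuousOn ((P.contDiffOn_localJ (k := 0) i).continuousOn.mono hCs)
  choose B hB using hB
  set B' := ∑ i, |B i| with hB'
  refine ⟨V ^ 2 * M * B' / (lambdaMin (secondMoment P.D) * ε') + 1, ?_⟩
  filter_upwards [hM] with x hx K hK i T hT
  have hJB : P.localJ i K ≤ B' := by
    have h1 := (le_abs_self _).trans (hB i K hK)
    exact (h1.trans (le_abs_self _)).trans
      (Finset.single_le_sum (f := fun i => |B i|) (fun _ _ => abs_nonneg _) (mem_univ i))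
  have hB0 : 0 ≤ B' := Finset.sum_nonneg fun _ _ => abs_nonneg _
  have hT0 : (0 : ℝ) < T := by
    have : 0 ≤ V ^ 2 * M * B' / (lambdaMin (secondMoment P.D) * ε') := by positivity
    linarith
  have htail := P.lambdaMin_mul_tail_le (hCs hK) i T x
  have hdecay := mul_norm_pow_sq_le (P.mem_stab.1 (hCs hK)) T
  have hV2 : (lyapunov (P.loop K) 1).trace ^ 2 ≤ V ^ 2 := sq_le_sq' (by
    linarith [neg_le_of_abs_le (hV K hK)]) (le_of_abs_le (hV K hK))
  have h1 := dotProduct_mulVec_self_le (P.loop K ^ T) x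
  have h2 : T * (lambdaMin (secondMoment P.D) * (P.localH i K x - P.localHT i T K x)) ≤
      V ^ 2 * M * B' := by
    calc T * (lambdaMin (secondMoment P.D) * (P.localH i K x - P.localHT i T K x))
        ≤ T * (((P.loop K ^ T *ᵥ x) ⬝ᵥ (P.loop K ^ T *ᵥ x)) * P.localJ i K) := by gcongr
      _ ≤ T * (‖P.loop K ^ T‖ ^ 2 * M * B') := by
        have h3 : (P.loop K ^ T *ᵥ x) ⬝ᵥ (P.loop K ^ T *ᵥ x) ≤ ‖P.loop K ^ T‖ ^ 2 * M :=
          h1.trans (by gcongr)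
        have := P.localJ_nonneg i K
        gcongr
      _ = (T * ‖P.loop K ^ T‖ ^ 2) * M * B' := by ring
      _ ≤ V ^ 2 * M * B' := by
        have := hdecay.trans hV2
        gcongr
  have h4 : V ^ 2 * M * B' ≤ T * (lambdaMin (secondMoment P.D) * ε') := by
    have h5 : V ^ 2 * M * B' / (lambdaMin (secondMoment P.D) * ε') ≤ T := by linarith
    rwa [div_le_iff₀ (by positivity)] at h5
  exact le_of_mul_le_mul_left (le_of_mul_le_mul_left (h2.trans h4) hT0) hl

end Horizon

/-! ### Sublevel sets -/

section Level

theorem sum_gain_row_sq (K : P.Pol) (i : Fin N) :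
    ∑ a, (P.gain K (a, i) ⬝ᵥ P.gain K (a, i)) = ‖K i‖ ^ 2 := by
  rw [EuclideanSpace.real_norm_sq_eq, Fintype.sum_prod_type]
  refine Finset.sum_congr rfl fun a _ => ?_
  rw [dotProduct, Fintype.sum_prod_type, Fintype.sum_prod_type, Finset.sum_comm]
  rw [← Finset.sum_subset (Finset.subset_univ (P.nbrS i)) (fun j _ hj => by simp [gain, hj]),
    ← Finset.sum_coe_sort]
  refine Finset.sum_congr rfl fun j _ => Finset.sum_congr rfl fun b _ => ?_
  simp [gain, j.2, sq]

variable [Nonempty (Fin n × Fin N)]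

/-- The local cost grows quadratically with the policy of the agent, already through the first
input. -/
theorem exists_mul_norm_sq_le_localJ (hm : 0 < m) (i : Fin N) :
    ∃ c : ℝ, 0 < c ∧ ∀ K ∈ P.stab, c * ‖K i‖ ^ 2 ≤ P.localJ i K := by
  classical
  have hprob := P.D_prob
  have : Nonempty (Fin m) := ⟨⟨0, hm⟩⟩
  have hlR := lambdaMin_pos (P.R_pos i)
  have hlS := lambdaMin_pos P.D_pos
  refine ⟨lambdaMin (P.R i) * lambdaMin (secondMoment P.D), by positivity, fun K hK => ?_⟩
  have hpt : ∀ x : P.State, lambdaMin (P.R i) * ∑ a, (P.gain K (a, i) ⬝ᵥ x) ^ 2 ≤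
      P.localH i K x := by
    intro x
    have h0 := le_hasSum (P.hasSum_stageCost hK (P.localQ i) (P.localR i) x) 0 fun t _ =>
      P.stageCost_nonneg (P.posSemidef_localQ i) (P.posSemidef_localR i) K x t
    rw [P.localH_eq hK]
    refine le_trans ?_ h0
    rw [P.stageCost_eq, pow_zero, one_mulVec, dotProduct_weight_mulVec]
    have h1 : 0 ≤ x ⬝ᵥ (P.localQ i *ᵥ x) := by
      simpa using (P.posSemidef_localQ i).dotProduct_mulVec_nonneg x
    set U := P.gain K *ᵥ x with hU
    have h2 : lambdaMin (P.R i) * ∑ a, (P.gain K (a, i) ⬝ᵥ x) ^ 2 ≤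
        (fun a => U (a, i)) ⬝ᵥ (P.R i *ᵥ fun a => U (a, i)) := by
      refine le_trans (le_of_eq ?_) (lambdaMin_mul_dotProduct_le (P.R_pos i).isHermitian _)
      congr 1
      exact Finset.sum_congr rfl fun a _ => sq _
    have h3 : (fun a => U (a, i)) ⬝ᵥ (P.R i *ᵥ fun a => U (a, i)) ≤
        U ⬝ᵥ (P.localR i *ᵥ U) := by
      rw [localR, dotProduct_blockDiagonal_mulVec]
      refine le_trans (le_of_eq ?_) (Finset.single_le_sum (fun j _ => ?_) (mem_univ i))
      · rw [if_pos (P.learn_self i)]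
      · split_ifs
        · simpa using (P.R_pos j).posSemidef.dotProduct_mulVec_nonneg fun a => U (a, j)
        · simp
    linarith
  have hint : Integrable (fun x => lambdaMin (P.R i) * ∑ a, (P.gain K (a, i) ⬝ᵥ x) ^ 2) P.D :=
    (integrable_finsetSum _ fun a _ => integrable_dotProduct_sq P.D_bdd _).const_mul _
  have hmono := integral_mono hint ((P.regular hK).2.2.2.1 i) hpt
  refine le_trans ?_ hmono
  rw [integral_const_mul, integral_finsetSum _ fun a _ => integrable_dotProduct_sq P.D_bdd _,
    mul_assoc, ← P.sum_gain_row_sq, Finset.mul_sum]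
  gcongr with a
  exact lambdaMin_mul_le_integral_sq P.D_bdd P.D_pos _

theorem isBounded_levelSet (hm : 0 < m) (K0 : P.Pol) (α : ℝ) (αi : Fin N → ℝ) :
    Bornology.IsBounded (P.levelSet K0 α αi) := by
  choose c hc hle using fun i => P.exists_mul_norm_sq_le_localJ hm i
  refine (Metric.isBounded_closedBall (x := (0 : P.Pol))
    (r := Real.sqrt (∑ i, αi i * P.localJ i K0 / c i))).subset fun K hK => ?_
  rw [mem_closedBall_zero_iff]
  refine Real.le_sqrt_of_sq_le ?_
  rw [PiLp.norm_sq_eq_of_L2]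
  refine Finset.sum_le_sum fun i _ => ?_
  rw [le_div_iff₀ (hc i), mul_comm]
  exact (hle i K hK.1).trans (hK.2.2 i)

/-- A sublevel set that keeps a distance from the unstable policies is compact. -/
theorem isCompact_levelSet (hm : 0 < m) (K0 : P.Pol) (α : ℝ) (αi : Fin N → ℝ) {ρ : ℝ}
    (hρ : 0 < ρ) (hball : ∀ K ∈ P.levelSet K0 α αi, ∀ K', ‖K' - K‖ ≤ ρ → K' ∈ P.stab) :
    IsCompact (P.levelSet K0 α αi) := by
  refine Metric.isCompact_of_isClosed_isBounded ?_ (P.isBounded_levelSet hm K0 α αi)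
  refine isClosed_of_closure_subset fun K hK => ?_
  have hKs : K ∈ P.stab := by
    obtain ⟨K', hK', hd⟩ := Metric.mem_closure_iff.1 hK ρ hρ
    exact hball K' hK' K (by rw [← dist_eq_norm]; exact hd.le)
  obtain ⟨u, hu, hlim⟩ := mem_closure_iff_seq_limit.1 hK
  have hnhds := P.isOpen_stab.mem_nhds hKs
  refine ⟨hKs, ?_, fun i => ?_⟩
  · exact le_of_tendsto' (((P.contDiffOn_J (k := 0)).continuousOn.continuousAt hnhds).tendsto.comp
      hlim) fun k => (hu k).2.1
  · exact le_of_tendsto' (((P.contDiffOn_localJ (k := 0) i).continuousOn.continuousAt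
      hnhds).tendsto.comp hlim) fun k => (hu k).2.2 i

/-- A horizon that serves all policies of the neighbourhood of a sublevel set. -/
theorem exists_horizon_blockNhd (hm : 0 < m) (K0 : P.Pol) (α : ℝ) (αi : Fin N → ℝ) {ρ : ℝ}
    (hρ : 0 < ρ) (hball : ∀ K ∈ P.levelSet K0 α αi, ∀ K', ‖K' - K‖ ≤ ρ → K' ∈ P.stab)
    {ε' : ℝ} (hε' : 0 < ε') :
    ∃ Tbar : ℝ, ∀ᵐ x ∂P.D, ∀ K ∈ P.blockNhd (P.levelSet K0 α αi) ρ, ∀ i, ∀ T : ℕ, Tbar ≤ T →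
      P.localH i K x - P.localHT i T K x ≤ ε' := by
  have hcomp := P.isCompact_levelSet hm K0 α αi hρ hball
  have hC : IsCompact (Metric.cthickening ρ (P.levelSet K0 α αi)) := hcomp.cthickening
  have hCs : Metric.cthickening ρ (P.levelSet K0 α αi) ⊆ P.stab := by
    rw [hcomp.cthickening_eq_biUnion_closedBall hρ.le]
    refine Set.iUnion₂_subset fun K hK K' hK' => hball K hK K' ?_
    simpa [dist_eq_norm] using hK'
  obtain ⟨Tbar, hT⟩ := P.exists_horizon hC hCs hε'
  refine ⟨Tbar, ?_⟩
  filter_upwards [hT] with x hx K hK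
  refine hx K ?_
  obtain ⟨K₁, hK₁, i, y, hy, rfl⟩ := hK
  exact Metric.mem_cthickening_of_dist_le _ K₁ _ _ hK₁ (by
    rw [dist_eq_norm, P.norm_replace_sub]; exact hy)

/-- The ratio of the sampled local costs to their mean cannot stay below one. -/
theorem one_le_of_costRatio (hN : 0 < N) (hn : 0 < n) (hm : 0 < m) {c : ℝ} (hc : P.CostRatio c)
    {K0 : P.Pol} (hK0 : K0 ∈ P.stab) : 1 ≤ c := by
  have hprob := P.D_prob
  let i : Fin N := ⟨0, hN⟩
  have := P.nontrivial_blk hn hm i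
  obtain ⟨c₀, hc₀, hle⟩ := P.exists_mul_norm_sq_le_localJ hm i
  -- a nearby policy with a nonzero block has a positive local cost
  have hopen : IsOpen {y | P.replace K0 i y ∈ P.stab} :=
    P.isOpen_stab.preimage (P.continuous_replace K0 i)
  obtain ⟨y, hy, hy0⟩ := (dense_compl_singleton (0 : P.Blk i)).inter_open_nonempty _ hopen
    ⟨K0 i, by simpa only [Set.mem_ofPred_eq, replace_self] using hK0⟩
  have hpos : 0 < P.localJ i (P.replace K0 i y) := by
    refine lt_of_lt_of_le ?_ (hle _ hy)
    rw [replace_apply_same]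
    have : 0 < ‖y‖ := norm_pos_iff.2 hy0
    positivity
  have h1 : P.localJ i (P.replace K0 i y) ≤ c * P.localJ i (P.replace K0 i y) := by
    have h2 := integral_mono_ae ((P.regular hy).2.2.2.1 i) (integrable_const
      (c * P.localJ i (P.replace K0 i y))) (by filter_upwards [hc.2] with x hx using hx i _ hy)
    rw [integral_const, probReal_univ, one_smul] at h2
    exact h2
  nlinarith

end Level

end MultiAgentLQR

/-! ### One step of the algorithm -/

/-- The balance of one agent in one step. Here `a` is the norm of its gradient block, `h` the
length of its extrapolation and `q` the factor of its gradient estimate; the truncation error of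
the estimate enters only by half of its range. The constants come from
`(b + c) ^ 2 ≤ 1.62 * b ^ 2 + (1 + 1 / 0.62) * c ^ 2` with `b = 3 * S / 8`, `c = (φ + 1) * √η`, and
from `(h + η * δ) ^ 2 ≤ 3 * h ^ 2 + 1.5 * (η * δ) ^ 2`. -/
theorem agent_balance {a h r q ε' φ δ η S : ℝ} (ha : 0 ≤ a) (hh : 0 ≤ h) (hφ : 0 ≤ φ)
    (hη : 0 < η) (hη1 : η ≤ 1) (hhη : h ≤ η ^ (3 / 2 : ℝ)) (hr : φ * r ≤ S / 4)
    (hq : q * ε' ≤ S / 4) (hquad : η * (φ * δ ^ 2 + 4 * φ ^ 2 + φ + 4) ≤ S ^ 2 / 2) :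
    -(η * (a ^ 2 - φ * (r + h) * a)) + a * h + η * (q * (ε' / 2)) * a + φ / 2 * (h + η * δ) ^ 2 ≤
      -(η / 2) * a ^ 2 + η * S ^ 2 / 2 := by
  -- with `η = u ^ 2`, both `h` and the quadratic terms become polynomial in `u`
  obtain ⟨u, hu0, rfl⟩ : ∃ u : ℝ, 0 < u ∧ η = u ^ 2 :=
    ⟨Real.sqrt η, Real.sqrt_pos.2 hη, (Real.sq_sqrt hη.le).symm⟩
  have hu1 : u ≤ 1 := by nlinarith
  have hu3 : (u ^ 2) ^ (3 / 2 : ℝ) = u ^ 3 := by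
    rw [← Real.rpow_natCast, ← Real.rpow_mul hu0.le, ← Real.rpow_natCast]
    norm_num
  rw [hu3] at hhη
  have hu2 : u ^ 2 ≤ 1 := hη1
  have hu32 : u ^ 3 ≤ u ^ 2 := by nlinarith [sq_nonneg u]
  have hu31 : u ^ 3 ≤ u := by nlinarith
  set E := S / 4 + S / 8 + (φ + 1) * u with hE
  have h1 : φ * (r + h) ≤ S / 4 + φ * u := by
    linarith [mul_le_mul_of_nonneg_left (hhη.trans hu31) hφ]
  have h2 : a * h ≤ u ^ 2 * (u * a) := by
    linarith [mul_le_mul_of_nonneg_left hhη ha]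
  have h3 : h ^ 2 ≤ u ^ 4 :=
    (pow_le_pow_left₀ hh (hhη.trans hu32) 2).trans (le_of_eq (by ring))
  have h4 : (h + u ^ 2 * δ) ^ 2 ≤ u ^ 2 * (3 * u ^ 2 + 3 / 2 * u ^ 2 * δ ^ 2) := by
    linarith [sq_nonneg (2 * h - u ^ 2 * δ)]
  have h5 : a * E ≤ a ^ 2 / 2 + E ^ 2 / 2 := by linarith [sq_nonneg (a - E)]
  have h6 : E ^ 2 ≤ 81 / 50 * (3 * S / 8) ^ 2 + 81 / 31 * ((φ + 1) * u) ^ 2 := by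
    rw [hE]
    linarith [sq_nonneg (31 / 50 * (3 * S / 8) - (φ + 1) * u)]
  have h7 : ((φ + 1) * u) ^ 2 ≤ 2 * (φ ^ 2 + 1) * u ^ 2 := by
    linarith [sq_nonneg ((φ - 1) * u)]
  have h8 : E ^ 2 / 2 + φ / 2 * (3 * u ^ 2 + 3 / 2 * u ^ 2 * δ ^ 2) ≤ S ^ 2 / 2 := by
    clear_value E
    linarith [sq_nonneg ((φ - 1) * u), sq_nonneg (φ * u), sq_nonneg u, sq_nonneg S]
  have hu2' : 0 < u ^ 2 := hη
  have key : -(a ^ 2) + φ * (r + h) * a + u * a + q * (ε' / 2) * a +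
      φ / 2 * (3 * u ^ 2 + 3 / 2 * u ^ 2 * δ ^ 2) ≤ -(a ^ 2) / 2 + S ^ 2 / 2 := by
    have h10 : φ * (r + h) * a + u * a + q * (ε' / 2) * a ≤ a * E := by
      rw [hE]
      linarith [mul_le_mul_of_nonneg_right h1 ha, mul_le_mul_of_nonneg_right hq ha]
    linarith
  have h11 := mul_le_mul_of_nonneg_left key hu2'.le
  have h12 := mul_le_mul_of_nonneg_left h4 (by positivity : 0 ≤ φ / 2)
  linarith

namespace MultiAgentLQR

variable {N n m : ℕ} (P : MultiAgentLQR N n m)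

/-- Uniform local bounds on a set of policies: within distance `ρ` of the set, policies are
stabilizing, `J` is Lipschitz with the constant `lam` and its gradient with the constant `φ`
(both relative to the point of the set), and `B` bounds the local costs on the set. -/
structure LocalBound (A : Set P.Pol) (lam φ ρ : ℝ) (B : Fin N → ℝ) : Prop where
  stab : ∀ K ∈ A, ∀ K', ‖K' - K‖ ≤ ρ → K' ∈ P.stab
  lip : ∀ K ∈ A, ∀ K', ‖K' - K‖ ≤ ρ → |P.J K' - P.J K| ≤ lam * ‖K' - K‖
  grad : ∀ K ∈ A, ∀ K', ‖K' - K‖ ≤ ρ → ‖gradient P.J K' - gradient P.J K‖ ≤ φ * ‖K' - K‖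
  cost : ∀ K ∈ A, ∀ i, P.localJ i K ≤ B i
  rho_pos : 0 < ρ
  lam_nonneg : 0 ≤ lam
  phi_nonneg : 0 ≤ φ

/-- The conditions on the smoothing radii, the step-size and the clusters. The number `S` is the
accuracy that the gradient estimates need, and `δ` bounds the estimates. -/
structure StepSize {s : ℕ} (r : Fin N → ℝ) (η : ℝ) (cl : Fin N → Fin s) (c ε' δ S lam φ ρ : ℝ)
    (B : Fin N → ℝ) : Prop where
  eta_pos : 0 < η
  eta_le_one : η ≤ 1
  c_nonneg : 0 ≤ c
  eps_nonneg : 0 ≤ ε'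
  r_pos : ∀ i, 0 < r i
  r_le : ∀ i, r i ≤ ρ / 2
  phi_mul_r : ∀ i, φ * r i ≤ S / 4
  trunc : ∀ i, P.dim i / r i * ε' ≤ S / 4
  est : ∀ i, P.dim i / r i * (c * (B i + lam * ρ)) ≤ δ
  card : ∀ z, η * δ * Real.sqrt (univ.filter fun i => cl i = z).card ≤ ρ / 2
  quad : η * (φ * δ ^ 2 + 4 * φ ^ 2 + φ + 4) ≤ S ^ 2 / 2

/-- The condition on a sample and a horizon: near the set `A` the sampled local costs are bounded
by their means and are approximated up to `ε'`. -/
def GoodSample (A : Set P.Pol) (ρ c ε' : ℝ) (x : P.State) (T : ℕ) : Prop :=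
  ∀ K ∈ A, ∀ i, ∀ y : P.Blk i, ‖y - K i‖ ≤ ρ →
    P.localH i (P.replace K i y) x ≤ c * P.localJ i (P.replace K i y) ∧
    P.localH i (P.replace K i y) x - P.localHT i T (P.replace K i y) x ≤ ε'

/-- The condition on the extrapolation. -/
def SmallPast {s : ℕ} (η ρ : ℝ) (cl : Fin N → Fin s) (w : Fin N → ℝ) (p : P.Pol × P.Pol) : Prop :=
  ∀ i, 0 ≤ w i ∧ w i * ‖p.1 i - p.2 i‖ ≤ η ^ (3 / 2 : ℝ) ∧
    w i * ‖p.1 i - p.2 i‖ ≤ ρ / (2 * Real.sqrt (univ.filter fun j => cl j = cl i).card)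

/-- The extrapolated block of agent `i`. -/
noncomputable def extrap (w : Fin N → ℝ) (p : P.Pol × P.Pol) (i : Fin N) : P.Blk i :=
  p.1 i + w i • (p.1 i - p.2 i)

/-- The gradient estimate of agent `i`. -/
noncomputable def estimate (r : Fin N → ℝ) (w : Fin N → ℝ) (T : ℕ) (x : P.State)
    (d : ∀ i, P.Blk i) (p : P.Pol × P.Pol) (i : Fin N) : P.Blk i :=
  ((P.dim i : ℝ) / r i *
    P.localHT i T (P.replace p.1 i (P.extrap w p i + r i • d i)) x) • d i

/-- The local cost as a function of the policy and of the initial state, set to zero at the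
policies that are not stabilizing, where the series need not converge. -/
noncomputable def stabLocalH (i : Fin N) (K : P.Pol) (x : P.State) : ℝ :=
  P.stab.indicator (fun K => P.localH i K x) K

theorem stabLocalH_eq {K : P.Pol} (hK : K ∈ P.stab) (i : Fin N) (x : P.State) :
    P.stabLocalH i K x = P.localH i K x := Set.indicator_of_mem hK _

theorem step_fst_apply (r : Fin N → ℝ) (η : ℝ) {s : ℕ} (cl : Fin N → Fin s) (z : Fin s)
    (w : Fin N → ℝ) (T : ℕ) (x : P.State) (d : ∀ i, P.Blk i) (p : P.Pol × P.Pol) (i : Fin N) :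
    (P.step r η cl z w T x d p).1 i =
      if cl i = z then P.extrap w p i - η • P.estimate r w T x d p i else p.1 i := rfl

theorem norm_extrap_sub {w : Fin N → ℝ} {p : P.Pol × P.Pol} {i : Fin N} (hw : 0 ≤ w i) :
    ‖P.extrap w p i - p.1 i‖ = w i * ‖p.1 i - p.2 i‖ := by
  rw [extrap, add_sub_cancel_left, norm_smul, Real.norm_eq_abs, abs_of_nonneg hw]

section Step

variable {P} {A : Set P.Pol} {lam φ ρ : ℝ} {B : Fin N → ℝ}

theorem LocalBound.mem_stab (hA : P.LocalBound A lam φ ρ B) {K : P.Pol} (hK : K ∈ A) :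
    K ∈ P.stab := hA.stab K hK K (by simpa using hA.rho_pos.le)

theorem LocalBound.norm_gradient_le (hA : P.LocalBound A lam φ ρ B) {K : P.Pol} (hK : K ∈ A) :
    ‖gradient P.J K‖ ≤ lam :=
  norm_gradient_le_of_lip hA.rho_pos hA.lam_nonneg (hA.lip K hK)

theorem LocalBound.mono {A' : Set P.Pol} (hA : P.LocalBound A lam φ ρ B) (h : A' ⊆ A) :
    P.LocalBound A' lam φ ρ B :=
  ⟨fun K hK => hA.stab K (h hK), fun K hK => hA.lip K (h hK), fun K hK => hA.grad K (h hK),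
    fun K hK => hA.cost K (h hK), hA.rho_pos, hA.lam_nonneg, hA.phi_nonneg⟩

theorem SmallPast.norm_extrap_sub_le {s : ℕ} {η : ℝ} {cl : Fin N → Fin s} {w : Fin N → ℝ}
    {p : P.Pol × P.Pol} (hp : P.SmallPast η ρ cl w p) (hρ : 0 < ρ) (i : Fin N) :
    ‖P.extrap w p i - p.1 i‖ ≤ ρ / 2 := by
  rw [P.norm_extrap_sub (hp i).1]
  refine (hp i).2.2.trans ?_
  have hcard : (1 : ℝ) ≤ (univ.filter fun j => cl j = cl i).card := by
    exact_mod_cast Finset.card_pos.2 ⟨i, by simp⟩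
  have h1 : 1 ≤ Real.sqrt (univ.filter fun j => cl j = cl i).card := by
    rwa [Real.one_le_sqrt]
  gcongr
  linarith

theorem StepSize.norm_perturbed_sub_le {s : ℕ} {r : Fin N → ℝ} {η : ℝ} {cl : Fin N → Fin s}
    {c ε' δ S : ℝ} {w : Fin N → ℝ} {d : ∀ i, P.Blk i} {p : P.Pol × P.Pol}
    (hs : P.StepSize r η cl c ε' δ S lam φ ρ B)
    (hp : P.SmallPast η ρ cl w p) (hρ : 0 < ρ) {i : Fin N} (hd : ‖d i‖ = 1) :
    ‖P.extrap w p i + r i • d i - p.1 i‖ ≤ ρ := by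
  have h1 := hp.norm_extrap_sub_le hρ i
  have h2 : ‖r i • d i‖ ≤ ρ / 2 := by
    rw [norm_smul, hd, mul_one, Real.norm_eq_abs, abs_of_pos (hs.r_pos i)]
    exact hs.r_le i
  rw [add_sub_right_comm]
  exact (norm_add_le _ _).trans (by linarith)

variable [Nonempty (Fin n × Fin N)]

theorem LocalBound.differentiableAt (hA : P.LocalBound A lam φ ρ B) {K : P.Pol} (hK : K ∈ A)
    {K' : P.Pol} (h : ‖K' - K‖ ≤ ρ) : DifferentiableAt ℝ P.J K' :=
  (P.regular (hA.stab K hK K' h)).2.2.2.2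

theorem LocalBound.localJ_replace_le (hA : P.LocalBound A lam φ ρ B) {K : P.Pol} (hK : K ∈ A)
    {i : Fin N} {y : P.Blk i} (hy : ‖y - K i‖ ≤ ρ) :
    P.localJ i (P.replace K i y) ≤ B i + lam * ρ := by
  have hn : ‖P.replace K i y - K‖ ≤ ρ := by rwa [P.norm_replace_sub]
  have h1 := J_sub_localJ_eq (hA.stab K hK _ hn) (hA.mem_stab hK) (i := i)
    fun j hj => P.replace_apply_of_ne K hj y
  have h2 := (le_abs_self _).trans (hA.lip K hK _ hn)
  have h3 := hA.cost K hK i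
  have h4 := mul_le_mul_of_nonneg_left hn hA.lam_nonneg
  linarith

variable {s : ℕ} {r : Fin N → ℝ} {η : ℝ} {cl : Fin N → Fin s} {c ε' δ S : ℝ} {z : Fin s}
  {w : Fin N → ℝ} {T : ℕ} {x : P.State} {d : ∀ i, P.Blk i} {p : P.Pol × P.Pol}

theorem norm_estimate_le (hA : P.LocalBound A lam φ ρ B)
    (hs : P.StepSize r η cl c ε' δ S lam φ ρ B) (hp : P.SmallPast η ρ cl w p) (hK : p.1 ∈ A)
    (hx : P.GoodSample A ρ c ε' x T) {i : Fin N} (hd : ‖d i‖ = 1) :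
    ‖P.estimate r w T x d p i‖ ≤ δ := by
  have hn := hs.norm_perturbed_sub_le hp hA.rho_pos hd
  have hst : P.replace p.1 i (P.extrap w p i + r i • d i) ∈ P.stab :=
    hA.stab _ hK _ (by rwa [P.norm_replace_sub])
  have h1 := (P.localHT_le_localH hst i T x).trans (hx _ hK i _ hn).1
  have h2 := P.localHT_nonneg i (P.replace p.1 i (P.extrap w p i + r i • d i)) x T
  have h3 := mul_le_mul_of_nonneg_left (hA.localJ_replace_le hK hn) hs.c_nonneg
  have hq : 0 ≤ (P.dim i : ℝ) / r i := div_nonneg (Nat.cast_nonneg _) (hs.r_pos i).le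
  rw [estimate, norm_smul, hd, mul_one, Real.norm_eq_abs, abs_of_nonneg (mul_nonneg hq h2)]
  exact (mul_le_mul_of_nonneg_left (h1.trans h3) hq).trans (hs.est i)

/-- The move of a block in one step. -/
theorem norm_step_sub_apply_le (hA : P.LocalBound A lam φ ρ B)
    (hs : P.StepSize r η cl c ε' δ S lam φ ρ B) (hp : P.SmallPast η ρ cl w p) (hK : p.1 ∈ A)
    (hx : P.GoodSample A ρ c ε' x T) (hd : ∀ i, ‖d i‖ = 1) (i : Fin N) :
    ‖((P.step r η cl z w T x d p).1 - p.1) i‖ ≤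
      if cl i = z then w i * ‖p.1 i - p.2 i‖ + η * δ else 0 := by
  rw [PiLp.sub_apply, step_fst_apply]
  split_ifs with h
  · rw [sub_right_comm, ← P.norm_extrap_sub (hp i).1]
    refine (norm_sub_le _ _).trans ?_
    rw [norm_smul, Real.norm_eq_abs, abs_of_pos hs.eta_pos]
    have := norm_estimate_le hA hs hp hK hx (hd i)
    have := hs.eta_pos
    gcongr
  · simp

theorem norm_step_sub_sq_le (hA : P.LocalBound A lam φ ρ B)
    (hs : P.StepSize r η cl c ε' δ S lam φ ρ B) (hp : P.SmallPast η ρ cl w p) (hK : p.1 ∈ A)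
    (hx : P.GoodSample A ρ c ε' x T) (hd : ∀ i, ‖d i‖ = 1) :
    ‖(P.step r η cl z w T x d p).1 - p.1‖ ^ 2 ≤
      ∑ i ∈ univ.filter (fun i => cl i = z), (w i * ‖p.1 i - p.2 i‖ + η * δ) ^ 2 := by
  rw [PiLp.norm_sq_eq_of_L2, Finset.sum_filter]
  refine Finset.sum_le_sum fun i _ => ?_
  have h := norm_step_sub_apply_le (z := z) hA hs hp hK hx hd i
  split_ifs at h ⊢ with hi
  · exact pow_le_pow_left₀ (norm_nonneg _) h 2
  · rw [norm_le_zero_iff.1 h]; simp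

/-- A step does not leave the neighbourhood of the set. -/
theorem norm_step_sub_le (hA : P.LocalBound A lam φ ρ B)
    (hs : P.StepSize r η cl c ε' δ S lam φ ρ B) (hp : P.SmallPast η ρ cl w p) (hK : p.1 ∈ A)
    (hx : P.GoodSample A ρ c ε' x T) (hd : ∀ i, ‖d i‖ = 1) :
    ‖(P.step r η cl z w T x d p).1 - p.1‖ ≤ ρ := by
  refine abs_le_of_sq_le_sq' ?_ hA.rho_pos.le |>.2
  refine (norm_step_sub_sq_le (z := z) hA hs hp hK hx hd).trans ?_
  set C := univ.filter (fun i => cl i = z) with hC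
  rcases C.eq_empty_or_nonempty with h0 | h0
  · rw [h0, Finset.sum_empty]; positivity
  have hcard : (0 : ℝ) < C.card := by exact_mod_cast h0.card_pos
  have hsq := Real.sq_sqrt hcard.le
  have hsp := Real.sqrt_pos.2 hcard
  -- the extrapolation and the estimate contribute at most half of the distance each
  have hterm : ∀ i ∈ C, (w i * ‖p.1 i - p.2 i‖ + η * δ) ^ 2 ≤ ρ ^ 2 / C.card := by
    intro i hi
    have hi' : cl i = z := (Finset.mem_filter.1 hi).2
    have h1 := (hp i).2.2
    rw [hi', ← hC] at h1
    have h2 := hs.card z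
    rw [← hC, ← le_div_iff₀ hsp] at h2
    have h3 : w i * ‖p.1 i - p.2 i‖ + η * δ ≤ ρ / Real.sqrt C.card := by
      have : ρ / Real.sqrt C.card = ρ / (2 * Real.sqrt C.card) + ρ / 2 / Real.sqrt C.card := by
        field_simp; ring
      linarith
    have hδ : 0 ≤ δ := (norm_nonneg _).trans (norm_estimate_le hA hs hp hK hx (hd i))
    have h4 : 0 ≤ w i * ‖p.1 i - p.2 i‖ + η * δ :=
      add_nonneg (mul_nonneg (hp i).1 (norm_nonneg _)) (mul_nonneg hs.eta_pos.le hδ)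
    calc (w i * ‖p.1 i - p.2 i‖ + η * δ) ^ 2 ≤ (ρ / Real.sqrt C.card) ^ 2 :=
          pow_le_pow_left₀ h4 h3 2
      _ = ρ ^ 2 / C.card := by rw [div_pow, hsq]
  refine (Finset.sum_le_sum hterm).trans (le_of_eq ?_)
  rw [Finset.sum_const, nsmul_eq_mul]
  field_simp

theorem norm_step_sub_le_sum (hA : P.LocalBound A lam φ ρ B)
    (hs : P.StepSize r η cl c ε' δ S lam φ ρ B) (hp : P.SmallPast η ρ cl w p) (hK : p.1 ∈ A)
    (hx : P.GoodSample A ρ c ε' x T) (hd : ∀ i, ‖d i‖ = 1) :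
    ‖(P.step r η cl z w T x d p).1 - p.1‖ ≤
      ∑ i ∈ univ.filter (fun i => cl i = z), (w i * ‖p.1 i - p.2 i‖ + η * δ) := by
  have hnn : ∀ i ∈ univ.filter (fun i => cl i = z), 0 ≤ w i * ‖p.1 i - p.2 i‖ + η * δ :=
    fun i _ => add_nonneg (mul_nonneg (hp i).1 (norm_nonneg _)) (mul_nonneg hs.eta_pos.le
      ((norm_nonneg _).trans (norm_estimate_le hA hs hp hK hx (hd i))))
  refine abs_le_of_sq_le_sq' ?_ (Finset.sum_nonneg hnn) |>.2
  exact (norm_step_sub_sq_le (z := z) hA hs hp hK hx hd).trans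
    (Finset.sum_sq_le_sq_sum_of_nonneg hnn)

/-- The estimate of the squared norm of a gradient block by an infinite-horizon cost. The
subtracted `ε' / 2` does not change its mean. -/
noncomputable def gradSqEstimate (P : MultiAgentLQR N n m) (r ε' : ℝ) (i : Fin N) (K : P.Pol)
    (y : P.Blk i) (x : P.State) (D : P.Blk i) : ℝ :=
  (P.dim i : ℝ) / r * (P.stabLocalH i (P.replace K i (y + r • D)) x - ε' / 2) *
    inner ℝ (gradient P.J K i) D

/-- The descent of one step before taking means. -/
theorem J_step_le (hA : P.LocalBound A lam φ ρ B)
    (hs : P.StepSize r η cl c ε' δ S lam φ ρ B) (hp : P.SmallPast η ρ cl w p) (hK : p.1 ∈ A)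
    (hx : P.GoodSample A ρ c ε' x T) (hd : ∀ i, ‖d i‖ = 1) :
    P.J (P.step r η cl z w T x d p).1 ≤ P.J p.1 +
      ∑ i ∈ univ.filter (fun i => cl i = z),
        (-(η * gradSqEstimate P (r i) ε' i p.1 (P.extrap w p i) x (d i)) +
        (‖gradient P.J p.1 i‖ * (w i * ‖p.1 i - p.2 i‖) +
          η * (P.dim i / r i * (ε' / 2)) * ‖gradient P.J p.1 i‖ +
          φ / 2 * (w i * ‖p.1 i - p.2 i‖ + η * δ) ^ 2)) := by
  have hdesc := le_add_inner_add_of_gradient (f := P.J) (x₀ := p.1) (R := ρ) (φ := φ)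
    (fun y hy => hA.differentiableAt hK hy) (hA.grad _ hK)
    (norm_step_sub_le (z := z) hA hs hp hK hx hd)
  have hsq := norm_step_sub_sq_le (z := z) hA hs hp hK hx hd
  have hinner : inner ℝ (gradient P.J p.1) ((P.step r η cl z w T x d p).1 - p.1) ≤
      ∑ i ∈ univ.filter (fun i => cl i = z),
        (-(η * gradSqEstimate P (r i) ε' i p.1 (P.extrap w p i) x (d i)) +
        (‖gradient P.J p.1 i‖ * (w i * ‖p.1 i - p.2 i‖) +
          η * (P.dim i / r i * (ε' / 2)) * ‖gradient P.J p.1 i‖)) := by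
    rw [PiLp.inner_apply, Finset.sum_filter]
    refine Finset.sum_le_sum fun i _ => ?_
    rw [PiLp.sub_apply, step_fst_apply]
    split_ifs with hi
    · set g := gradient P.J p.1 i with hg
      have hn := hs.norm_perturbed_sub_le hp hA.rho_pos (hd i)
      have hst : P.replace p.1 i (P.extrap w p i + r i • d i) ∈ P.stab :=
        hA.stab _ hK _ (by rwa [P.norm_replace_sub])
      have ht0 := P.localHT_le_localH hst i T x
      have ht1 := (hx _ hK i _ hn).2
      have hq : 0 ≤ (P.dim i : ℝ) / r i := div_nonneg (Nat.cast_nonneg _) (hs.r_pos i).le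
      rw [sub_right_comm, inner_sub_right, estimate, inner_smul_right, inner_smul_right,
        ← P.norm_extrap_sub (hp i).1, gradSqEstimate, P.stabLocalH_eq hst, ← hg]
      set H := P.localH i (P.replace p.1 i (P.extrap w p i + r i • d i)) x
      set HT := P.localHT i T (P.replace p.1 i (P.extrap w p i + r i • d i)) x
      have h1 := real_inner_le_norm g (P.extrap w p i - p.1 i)
      have h2 : |inner ℝ g (d i)| ≤ ‖g‖ := by
        simpa [hd i] using abs_real_inner_le_norm g (d i)
      -- the truncation error lies in `[0, ε']`, and centering it halves its size
      have h3 : |H - HT - ε' / 2| ≤ ε' / 2 := by rw [abs_le]; constructor <;> linarith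
      have h4 : (H - HT - ε' / 2) * inner ℝ g (d i) ≤ ε' / 2 * ‖g‖ := by
        refine (le_abs_self _).trans ?_
        rw [abs_mul]
        exact mul_le_mul h3 h2 (abs_nonneg _) (by linarith [hs.eps_nonneg])
      have h5 := mul_le_mul_of_nonneg_left h4 (mul_nonneg hs.eta_pos.le hq)
      have h6 : -(η * ((P.dim i : ℝ) / r i * HT * inner ℝ g (d i))) =
          -(η * ((P.dim i : ℝ) / r i * (H - ε' / 2) * inner ℝ g (d i))) +
            η * ((P.dim i : ℝ) / r i) * ((H - HT - ε' / 2) * inner ℝ g (d i)) := by ring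
      linarith
    · simp
  refine hdesc.trans ?_
  have h7 := mul_le_mul_of_nonneg_left hsq (by linarith [hA.phi_nonneg] : 0 ≤ φ / 2)
  rw [Finset.mul_sum] at h7
  rw [add_assoc]
  refine add_le_add le_rfl ((add_le_add hinner h7).trans (le_of_eq ?_))
  rw [← Finset.sum_add_distrib]
  exact Finset.sum_congr rfl fun i _ => by ring

end Step

end MultiAgentLQR

/-! ### Measurability -/

theorem measurable_indicator_of_continuousOn {α : Type*} [TopologicalSpace α] [MeasurableSpace α]
    [BorelSpace α] {s : Set α} (hs : MeasurableSet s) {f : α → ℝ} (hf : ContinuousOn f s) :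
    Measurable (s.indicator f) := by
  classical
  rw [← Set.piecewise_eq_indicator]
  exact hf.measurable_piecewise continuousOn_const hs

namespace MultiAgentLQR

variable {N n m : ℕ} (P : MultiAgentLQR N n m)

section Measurability

theorem measurable_policy {α : Type*} {_ : MeasurableSpace α} {f : α → P.Pol}
    (h : ∀ i, Measurable fun a => f a i) : Measurable f :=
  (WithLp.measurable_toLp 2 (∀ i, P.Blk i)).comp (measurable_pi_iff.2 h)

theorem measurable_policy_apply {α : Type*} {_ : MeasurableSpace α} {f : α → P.Pol}
    (h : Measurable f) (i : Fin N) : Measurable fun a => f a i :=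
  (measurable_pi_apply i).comp ((WithLp.measurable_ofLp 2 (∀ i, P.Blk i)).comp h)

theorem measurable_replace {α : Type*} {_ : MeasurableSpace α} {f : α → P.Pol} {i : Fin N}
    {y : α → P.Blk i} (hf : Measurable f) (hy : Measurable y) :
    Measurable fun a => P.replace (f a) i (y a) := by
  refine P.measurable_policy fun j => ?_
  by_cases h : j = i
  · subst h
    simpa only [replace_apply_same] using hy
  · simpa only [P.replace_apply_of_ne _ h] using P.measurable_policy_apply hf j

open scoped Matrix.Norms.Frobenius in
theorem continuous_localHT (i : Fin N) (T : ℕ) :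
    Continuous fun q : P.Pol × P.State => P.localHT i T q.1 q.2 := by
  have hl : Continuous P.loop := (P.contDiff_loop (k := 0)).continuous
  have hw : Continuous (P.weight (P.localQ i) (P.localR i)) :=
    (P.contDiff_weight (k := 0) _ _).continuous
  simp only [localHT, P.stageCost_eq]
  refine continuous_finsetSum _ fun t _ => ?_
  have h1 : Continuous fun q : P.Pol × P.State => P.loop q.1 ^ t *ᵥ q.2 :=
    ((hl.comp continuous_fst).pow t).matrix_mulVec continuous_snd
  exact h1.dotProduct ((hw.comp continuous_fst).matrix_mulVec h1)

theorem measurable_localHT {α : Type*} {_ : MeasurableSpace α} {i : Fin N} {T : α → ℕ}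
    {f : α → P.Pol} {x : α → P.State} (hT : Measurable T) (hf : Measurable f) (hx : Measurable x) :
    Measurable fun a => P.localHT i (T a) (f a) (x a) := by
  have h : Measurable fun q : ℕ × (P.Pol × P.State) => P.localHT i q.1 q.2.1 q.2.2 :=
    measurable_from_prod_countable_right fun t => by
      exact (P.continuous_localHT i t).measurable
  have h' := h.comp (hT.prodMk (hf.prodMk hx))
  simpa only [Function.comp_def] using h'

theorem measurable_extrap {α : Type*} {_ : MeasurableSpace α} {w : Fin N → α → ℝ}
    {p : α → P.Pol × P.Pol} (hw : ∀ i, Measurable (w i)) (hp : Measurable p) (i : Fin N) :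
    Measurable fun a => P.extrap (fun i => w i a) (p a) i := by
  have h1 := P.measurable_policy_apply hp.fst i
  have h2 := P.measurable_policy_apply hp.snd i
  simp only [extrap]
  exact h1.add ((hw i).smul (h1.sub h2))

theorem measurable_estimate {α : Type*} {_ : MeasurableSpace α} {r : Fin N → ℝ} {w : Fin N → α → ℝ}
    {T : α → ℕ} {x : α → P.State} {d : α → ∀ i, P.Blk i} {p : α → P.Pol × P.Pol}
    (hw : ∀ i, Measurable (w i)) (hT : Measurable T) (hx : Measurable x) (hd : Measurable d)
    (hp : Measurable p) (i : Fin N) :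
    Measurable fun a => P.estimate r (fun i => w i a) (T a) (x a) (d a) (p a) i := by
  have hd' : Measurable fun a => d a i := measurable_pi_iff.1 hd i
  have h1 : Measurable fun a =>
      P.replace (p a).1 i (P.extrap (fun i => w i a) (p a) i + r i • d a i) :=
    P.measurable_replace hp.fst ((P.measurable_extrap hw hp i).add (hd'.const_smul (r i)))
  have h2 := (P.measurable_localHT (i := i) hT h1 hx).const_mul ((P.dim i : ℝ) / r i)
  simp only [estimate]
  exact h2.smul hd'

theorem measurable_step {α : Type*} {_ : MeasurableSpace α} {s : ℕ} {cl : Fin N → Fin s} {z : Fin s}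
    {r : Fin N → ℝ} {η : ℝ} {w : Fin N → α → ℝ} {T : α → ℕ} {x : α → P.State}
    {d : α → ∀ i, P.Blk i} {p : α → P.Pol × P.Pol} (hw : ∀ i, Measurable (w i))
    (hT : Measurable T) (hx : Measurable x) (hd : Measurable d) (hp : Measurable p) :
    Measurable fun a => P.step r η cl z (fun i => w i a) (T a) (x a) (d a) (p a) := by
  have h1 := P.measurable_policy_apply hp.fst
  have h2 := P.measurable_policy_apply hp.snd
  have h3 : ∀ i, Measurable fun a => if cl i = z then P.extrap (fun i => w i a) (p a) i -
      η • P.estimate r (fun i => w i a) (T a) (x a) (d a) (p a) i else (p a).1 i := fun i => by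
    by_cases h : cl i = z
    · simp only [h, if_true]
      exact (P.measurable_extrap hw hp i).sub
        ((P.measurable_estimate hw hT hx hd hp i).const_smul η)
    · simp only [h, if_false]
      exact h1 i
  have h4 : ∀ i, Measurable fun a => if cl i = z then (p a).1 i else (p a).2 i := fun i => by
    by_cases h : cl i = z
    · simp only [h, if_true]
      exact h1 i
    · simp only [h, if_false]
      exact h2 i
  exact (P.measurable_policy (f := fun a => WithLp.toLp 2 fun i => if cl i = z then
      P.extrap (fun i => w i a) (p a) i -
      η • P.estimate r (fun i => w i a) (T a) (x a) (d a) (p a) i else (p a).1 i) h3).prodMk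
    (P.measurable_policy (f := fun a => WithLp.toLp 2 fun i =>
      if cl i = z then (p a).1 i else (p a).2 i) h4)

theorem measurable_gradient : Measurable (gradient P.J) :=
  (InnerProductSpace.toDual ℝ P.Pol).symm.continuous.measurable.comp (measurable_fderiv ℝ P.J)

variable [Nonempty (Fin n × Fin N)]

theorem measurableSet_stab : MeasurableSet P.stab := P.isOpen_stab.measurableSet

theorem measurable_indicator_J : Measurable (P.stab.indicator P.J) :=
  measurable_indicator_of_continuousOn P.measurableSet_stab
    (P.contDiffOn_J (k := 0)).continuousOn

open scoped Matrix.Norms.Frobenius in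
theorem measurable_stabLocalH (i : Fin N) :
    Measurable fun q : P.Pol × P.State => P.stabLocalH i q.1 q.2 := by
  set X := P.valMat (P.localQ i) (P.localR i)
  have hX : ∀ a b, Measurable (P.stab.indicator fun K => X K a b) := fun a b => by
    have h := (P.contDiffOn_valMat (k := 0) (P.localQ i) (P.localR i)).continuousOn
    have h' : ContinuousOn (fun K => X K a b) P.stab :=
      (continuous_id.matrix_elem a b).comp_continuousOn h
    exact measurable_indicator_of_continuousOn P.measurableSet_stab h'
  have : (fun q : P.Pol × P.State => P.stabLocalH i q.1 q.2) =
      fun q => ∑ a, ∑ b, P.stab.indicator (fun K => X K a b) q.1 * (q.2 a * q.2 b) := by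
    funext q
    by_cases hq : q.1 ∈ P.stab
    · simp only [P.stabLocalH_eq hq, P.localH_eq hq, Set.indicator_of_mem hq, quadratic_eq_sum, X]
    · simp [stabLocalH, Set.indicator_of_notMem hq]
  rw [this]
  refine Finset.measurable_sum _ fun a _ => Finset.measurable_sum _ fun b _ => ?_
  exact ((hX a b).comp measurable_fst).mul
    (((measurable_pi_apply a).comp measurable_snd).mul
      ((measurable_pi_apply b).comp measurable_snd))

end Measurability

end MultiAgentLQR

/-! ### Conditioning on the past -/

section Freezing

variable {Ω α β : Type*} {m₀ : MeasurableSpace Ω} [mΩ : MeasurableSpace Ω]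
  [MeasurableSpace α] [MeasurableSpace β]
  {μ : Measure Ω} [IsProbabilityMeasure μ] {Y : Ω → α} {ξ : Ω → β}
  {E : Set Ω}

/-- On an event of the past, a function of the past and an independent variable have a product
law. -/
theorem map_prodMk_restrict_eq_prod (hm : m₀ ≤ mΩ) (hY : Measurable[m₀] Y) (hξ : Measurable ξ)
    (hind : Indep (MeasurableSpace.comap ξ inferInstance) m₀ μ) (hE : MeasurableSet[m₀] E) :
    (μ.restrict E).map (fun ω => (Y ω, ξ ω)) = ((μ.restrict E).map Y).prod (μ.map ξ) := by
  have hY' : Measurable Y := hY.mono hm le_rfl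
  have : IsProbabilityMeasure (μ.map ξ) := Measure.isProbabilityMeasure_map hξ.aemeasurable
  refine (Measure.prod_eq fun s t hs ht => ?_).symm
  rw [Measure.map_apply (hY'.prodMk hξ) (hs.prod ht), Measure.map_apply hY' hs,
    Measure.map_apply hξ ht, Measure.restrict_apply ((hY'.prodMk hξ) (hs.prod ht)),
    Measure.restrict_apply (hY' hs)]
  have h := (Indep_iff _ _ μ).1 hind (ξ ⁻¹' t) (Y ⁻¹' s ∩ E) ⟨t, ht, rfl⟩ ((hY hs).inter hE)
  rw [mul_comm, ← h]
  congr 1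
  ext ω
  simp only [Set.mem_inter_iff, Set.mem_preimage, Set.mem_prod]
  tauto

/-- On an event of the past, the integral of a function of the past and an independent variable
may be computed by integrating out the latter with the past kept fixed. -/
theorem setIntegral_comp_eq_of_indep (hm : m₀ ≤ mΩ) (hY : Measurable[m₀] Y) (hξ : Measurable ξ)
    (hind : Indep (MeasurableSpace.comap ξ inferInstance) m₀ μ) (hE : MeasurableSet[m₀] E)
    {F : α × β → ℝ} (hF : Measurable F) (hint : IntegrableOn (fun ω => F (Y ω, ξ ω)) E μ) :
    IntegrableOn (fun ω => ∫ v, F (Y ω, v) ∂(μ.map ξ)) E μ ∧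
    ∫ ω in E, F (Y ω, ξ ω) ∂μ = ∫ ω in E, ∫ v, F (Y ω, v) ∂(μ.map ξ) ∂μ := by
  have hY' : Measurable Y := hY.mono hm le_rfl
  have : IsProbabilityMeasure (μ.map ξ) := Measure.isProbabilityMeasure_map hξ.aemeasurable
  have hmap := map_prodMk_restrict_eq_prod hm hY hξ hind hE
  have hF' : Integrable F (((μ.restrict E).map Y).prod (μ.map ξ)) := by
    rw [← hmap, integrable_map_measure hF.aestronglyMeasurable (hY'.prodMk hξ).aemeasurable]
    exact hint
  have hG := hF'.integral_prod_left
  constructor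
  · exact (integrable_map_measure hG.aestronglyMeasurable hY'.aemeasurable).1 hG
  · have h1 : ∫ q, F q ∂((μ.restrict E).map fun ω => (Y ω, ξ ω)) = ∫ ω in E, F (Y ω, ξ ω) ∂μ :=
      integral_map (hY'.prodMk hξ).aemeasurable hF.aestronglyMeasurable
    rw [← h1, hmap, integral_prod F hF', integral_map hY'.aemeasurable hG.aestronglyMeasurable]

end Freezing

/-! ### The descent in the mean -/

namespace MultiAgentLQR

section Mean

variable {N n m : ℕ} {P : MultiAgentLQR N n m} {A : Set P.Pol} {lam φ ρ : ℝ} {B : Fin N → ℝ}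
  [Nonempty (Fin n × Fin N)]

theorem abs_gradSqEstimate_le (hA : P.LocalBound A lam φ ρ B) {c ε' r : ℝ} (hc : 0 ≤ c)
    (hε : 0 ≤ ε') (hr : 0 < r) {K : P.Pol} (hK : K ∈ A) {i : Fin N} {y D : P.Blk i} {x : P.State}
    (hy : r + ‖y - K i‖ ≤ ρ) (hD : ‖D‖ = 1)
    (hx : P.localH i (P.replace K i (y + r • D)) x ≤
      c * P.localJ i (P.replace K i (y + r • D))) :
    |P.gradSqEstimate r ε' i K y x D| ≤ P.dim i / r * (c * (B i + lam * ρ) + ε') * lam := by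
  have hn : ‖y + r • D - K i‖ ≤ ρ := by
    rw [add_sub_right_comm]
    refine (norm_add_le _ _).trans ?_
    rw [norm_smul, hD, mul_one, Real.norm_eq_abs, abs_of_pos hr]
    linarith
  have hst : P.replace K i (y + r • D) ∈ P.stab :=
    hA.stab _ hK _ (by rwa [P.norm_replace_sub])
  have h0 := P.localH_nonneg i (P.replace K i (y + r • D)) x
  have h1 := hx.trans (mul_le_mul_of_nonneg_left (hA.localJ_replace_le hK hn) hc)
  have hg : |inner ℝ (gradient P.J K i) D| ≤ lam := by
    refine (abs_real_inner_le_norm _ _).trans ?_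
    rw [hD, mul_one]
    exact (PiLp.norm_apply_le _ i).trans (hA.norm_gradient_le hK)
  have hq : 0 ≤ (P.dim i : ℝ) / r := div_nonneg (Nat.cast_nonneg _) hr.le
  rw [gradSqEstimate, P.stabLocalH_eq hst, abs_mul, abs_mul, abs_of_nonneg hq]
  have h2 : |P.localH i (P.replace K i (y + r • D)) x - ε' / 2| ≤ c * (B i + lam * ρ) + ε' := by
    rw [abs_le]; constructor <;> linarith
  have h3 : 0 ≤ c * (B i + lam * ρ) + ε' := (abs_nonneg _).trans h2
  gcongr

theorem measurable_gradSqEstimate {α : Type*} [MeasurableSpace α] {r ε' : ℝ} {i : Fin N}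
    {K : α → P.Pol} {y D : α → P.Blk i} {x : α → P.State} (hK : Measurable K) (hy : Measurable y)
    (hx : Measurable x) (hD : Measurable D) :
    Measurable fun a => P.gradSqEstimate r ε' i (K a) (y a) (x a) (D a) := by
  have h1 : Measurable fun a => P.replace (K a) i (y a + r • D a) :=
    P.measurable_replace hK (hy.add (hD.const_smul r))
  have h2 := (P.measurable_stabLocalH i).comp (h1.prodMk hx)
  have h3 : Measurable fun a => gradient P.J (K a) i :=
    P.measurable_policy_apply (P.measurable_gradient.comp hK) i
  have h4 := ((h2.sub_const (ε' / 2)).const_mul ((P.dim i : ℝ) / r)).mul (h3.inner hD)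
  exact h4

/-- The mean of the one-point estimate. -/
theorem le_integral_gradSqEstimate [∀ i, Nontrivial (P.Blk i)] (hA : P.LocalBound A lam φ ρ B)
    {c ε' r : ℝ} (hc : P.CostRatio c) (hε : 0 ≤ ε') (hr : 0 < r) {K : P.Pol} (hK : K ∈ A)
    {i : Fin N} {y : P.Blk i} (hy : r + ‖y - K i‖ ≤ ρ) :
    ‖gradient P.J K i‖ ^ 2 - φ * (r + ‖y - K i‖) * ‖gradient P.J K i‖ ≤
      ∫ v, P.gradSqEstimate r ε' i K y v.1 v.2 ∂(P.D.prod (uniformSphere (P.Blk i))) := by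
  have hprob := P.D_prob
  set g := gradient P.J K with hg
  have hn : ∀ p ∈ Metric.closedBall y r, ‖P.replace K i p - K‖ ≤ r + ‖y - K i‖ := by
    intro p hp
    rw [P.norm_replace_sub, ← sub_add_sub_cancel p y]
    refine (norm_add_le _ _).trans ?_
    rw [mem_closedBall_iff_norm] at hp
    linarith
  have hball : ∀ D : P.Blk i, ‖D‖ = 1 → y + r • D ∈ Metric.closedBall y r := fun D hD => by
    simp [norm_smul, hD, abs_of_pos hr]
  have hst : ∀ p ∈ Metric.closedBall y r, P.replace K i p ∈ P.stab := fun p hp =>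
    hA.stab K hK _ ((hn p hp).trans hy)
  have hint : Integrable (fun v : P.State × P.Blk i => P.gradSqEstimate r ε' i K y v.1 v.2)
      (P.D.prod (uniformSphere (P.Blk i))) := by
    refine Integrable.of_bound (measurable_gradSqEstimate measurable_const measurable_const
      measurable_fst measurable_snd).aestronglyMeasurable
      (P.dim i / r * (c * (B i + lam * ρ) + ε') * lam) ?_
    have h1 := Measure.quasiMeasurePreserving_fst (μ := P.D)
      (ν := uniformSphere (P.Blk i)) |>.ae hc.2
    have h2 := Measure.quasiMeasurePreserving_snd (μ := P.D)
      (ν := uniformSphere (P.Blk i)) |>.ae ae_norm_eq_one_uniformSphere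
    filter_upwards [h1, h2] with v hv1 hv2
    exact abs_gradSqEstimate_le hA hc.1.le hε hr hK hy hv2 (hv1 i _ (hst _ (hball _ hv2)))
  set f : P.Blk i → ℝ := fun p => P.localJ i (P.replace K i p) - ε' / 2 with hf
  set q : ℝ := (P.dim i : ℝ) / r with hq
  have hinner : ∀ D : P.Blk i, ‖D‖ = 1 → ∫ x, P.gradSqEstimate r ε' i K y x D ∂P.D =
      q * (f (y + r • D) * inner ℝ (g i) D) := by
    intro D hD
    have hs := hst _ (hball D hD)
    have hi := (P.regular hs).2.2.2.1 i
    simp only [gradSqEstimate, P.stabLocalH_eq hs]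
    rw [integral_mul_const, integral_const_mul, integral_sub hi (integrable_const _)]
    simp only [hf, localJ, integral_const, probReal_univ, one_smul, hg]
    ring
  have hae : (fun D => ∫ x, P.gradSqEstimate r ε' i K y x D ∂P.D) =ᵐ[uniformSphere (P.Blk i)]
      fun D => q * (f (y + r • D) * inner ℝ (g i) D) := by
    filter_upwards [ae_norm_eq_one_uniformSphere (E := P.Blk i)] with D hD using hinner D hD
  have hq0 : 0 < q := by
    have : 0 < Module.finrank ℝ (P.Blk i) := Module.finrank_pos
    rw [P.finrank_blk] at this
    positivity
  have hint2 : Integrable (fun D => f (y + r • D) * inner ℝ (g i) D) (uniformSphere (P.Blk i)) := by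
    refine (((hint.integral_prod_right).congr hae).const_mul q⁻¹).congr
      (Filter.Eventually.of_forall fun D => ?_)
    simp only
    rw [inv_mul_cancel_left₀ hq0.ne']
  -- the local cost may be replaced by the global cost, of which the gradient is taken
  have hlin : ∀ p ∈ Metric.closedBall y r, ∀ p' ∈ Metric.closedBall y r,
      |f p - f p' - inner ℝ (g i) (p - p')| ≤ φ * (r + ‖y - K i‖) * ‖p - p'‖ := by
    intro p hp p' hp'
    have h1 := abs_sub_sub_inner_le (f := P.J) (x₀ := K) (R := r + ‖y - K i‖)
      (C := φ * (r + ‖y - K i‖)) (fun u hu => hA.differentiableAt hK (hu.trans hy))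
      (fun u hu => (hA.grad K hK u (hu.trans hy)).trans
        (mul_le_mul_of_nonneg_left hu hA.phi_nonneg)) (hn p hp) (hn p' hp')
    rw [P.inner_replace_sub_replace, P.norm_replace_sub_replace] at h1
    have h2 := J_sub_localJ_eq (i := i) (hst p hp) (hst p' hp') fun j hj => by
      rw [P.replace_apply_of_ne K hj, P.replace_apply_of_ne K hj]
    have h3 : f p - f p' = P.J (P.replace K i p) - P.J (P.replace K i p') := by
      simp only [hf]; linarith
    rwa [h3]
  have hmain := abs_integral_sphere_estimate_sub_le hr hlin hint2
  rw [P.finrank_blk] at hmain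
  rw [integral_prod_symm _ hint, integral_congr_ae hae, integral_const_mul]
  linarith [neg_le_of_abs_le hmain]

end Mean

end MultiAgentLQR

section Telescoping

variable {Ω : Type*} [MeasurableSpace Ω] {μ : Measure Ω} [IsProbabilityMeasure μ]

/-- The supermartingale argument: `V` decreases in the mean by a multiple of `G`, up to `κ`, as
long as the events `E k` hold, and it is at least `M` when they fail for the first time. -/
theorem min_mul_measureReal_bad_le {E : ℕ → Set Ω} {V G : ℕ → Ω → ℝ} {T : ℕ} {M b κ V₀ : ℝ}
    (hE : ∀ k, MeasurableSet (E k)) (hanti : Antitone E) (hE0 : E 0 = Set.univ)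
    (hM : 0 ≤ M) (hb : 0 ≤ b) (hV0 : ∀ ω, V 0 ω = V₀) (hV : ∀ k ω, 0 ≤ V k ω)
    (hG : ∀ k ω, 0 ≤ G k ω) (hVi : ∀ k < T, IntegrableOn (V (k + 1)) (E k) μ)
    (hGi : ∀ k < T, IntegrableOn (G k) (E k) μ)
    (hstep : ∀ k < T, ∫ ω in E k, V (k + 1) ω ∂μ ≤
      ∫ ω in E k, V k ω ∂μ - ∫ ω in E k, G k ω ∂μ + κ)
    (hexit : ∀ k < T, ∀ᵐ ω ∂μ, ω ∈ E k → ω ∉ E (k + 1) → M ≤ V (k + 1) ω) :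
    min M b * μ.real ((E T)ᶜ ∪ {ω | b ≤ ∑ k ∈ range T, (E k).indicator (G k) ω}) ≤
      V₀ + T * κ := by
  -- the mean of `V` on `E t`, the loss by exits and the accumulated decrease stay within budget
  have hkey : ∀ t ≤ T, ∫ ω in E t, V t ω ∂μ + M * μ.real (E t)ᶜ +
      ∑ k ∈ range t, ∫ ω in E k, G k ω ∂μ ≤ V₀ + t * κ := by
    intro t
    induction t with
    | zero => intro _; simp [hE0, hV0]
    | succ t ih =>
      intro ht
      have h1 := ih (Nat.le_of_succ_le ht)
      have h2 := hstep t ht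
      have h3 : ∫ ω in E (t + 1), V (t + 1) ω ∂μ + M * μ.real (E t \ E (t + 1)) ≤
          ∫ ω in E t, V (t + 1) ω ∂μ := by
        have hsub := hanti (Nat.le_succ t)
        have hd : MeasurableSet (E t \ E (t + 1)) := (hE t).diff (hE (t + 1))
        have hu : E t = E (t + 1) ∪ (E t \ E (t + 1)) := (Set.union_sdiff_cancel hsub).symm
        have hI := hVi t ht
        rw [show ∫ ω in E t, V (t + 1) ω ∂μ = ∫ ω in E (t + 1), V (t + 1) ω ∂μ +
            ∫ ω in E t \ E (t + 1), V (t + 1) ω ∂μ by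
          conv_lhs => rw [hu]
          exact setIntegral_union Set.disjoint_sdiff_right hd (hI.mono_set hsub)
            (hI.mono_set Set.sdiff_subset)]
        refine add_le_add le_rfl ?_
        have h4 : ∫ _ in E t \ E (t + 1), M ∂μ ≤ ∫ ω in E t \ E (t + 1), V (t + 1) ω ∂μ := by
          refine setIntegral_mono_on_ae (integrable_const _) (hI.mono_set Set.sdiff_subset) hd ?_
          filter_upwards [hexit t ht] with ω hω h using hω h.1 h.2
        rwa [setIntegral_const, smul_eq_mul, mul_comm] at h4
      have h5 : μ.real (E (t + 1))ᶜ = μ.real (E t)ᶜ + μ.real (E t \ E (t + 1)) := by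
        rw [← measureReal_union _ ((hE t).diff (hE (t + 1)))]
        · congr 1
          ext ω
          have : ω ∈ E (t + 1) → ω ∈ E t := fun h => hanti (Nat.le_succ t) h
          simp only [Set.mem_compl_iff, Set.mem_union, Set.mem_sdiff]
          tauto
        · exact Set.disjoint_left.2 fun ω h h' => h h'.1
      rw [h5, Finset.sum_range_succ]
      push_cast
      linarith
  have hfin := hkey T le_rfl
  have hVT : 0 ≤ ∫ ω in E T, V T ω ∂μ := integral_nonneg fun ω => hV T ω
  have hsumi : ∀ k ∈ range T, Integrable ((E k).indicator (G k)) μ := fun k hk =>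
    (hGi k (mem_range.1 hk)).integrable_indicator (hE k)
  set Z : Ω → ℝ := fun ω => ∑ k ∈ range T, (E k).indicator (G k) ω with hZ
  have hZi : Integrable Z μ := integrable_finsetSum _ hsumi
  have hZ0 : ∀ ω, 0 ≤ Z ω := fun ω => Finset.sum_nonneg fun k _ =>
    Set.indicator_nonneg (fun ω _ => hG k ω) ω
  have hZint : ∫ ω, Z ω ∂μ = ∑ k ∈ range T, ∫ ω in E k, G k ω ∂μ := by
    rw [hZ, integral_finsetSum _ hsumi]
    exact Finset.sum_congr rfl fun k _ => integral_indicator (hE k)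
  -- Markov's inequality for the stopped sum
  have hmark := mul_meas_ge_le_integral_of_nonneg (μ := μ) (Filter.Eventually.of_forall hZ0) hZi b
  have hunion := measureReal_union_le (μ := μ) (E T)ᶜ {ω | b ≤ Z ω}
  have h6 := mul_le_mul_of_nonneg_left hunion (le_min hM hb)
  have h7 := mul_le_mul_of_nonneg_right (min_le_left M b)
    (measureReal_nonneg (μ := μ) (s := (E T)ᶜ))
  have h8 := mul_le_mul_of_nonneg_right (min_le_right M b)
    (measureReal_nonneg (μ := μ) (s := {ω | b ≤ Z ω}))
  linarith

end Telescoping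

/-! ### The iterates as random variables -/

namespace MultiAgentLQR

theorem run_succ_fst {N n m : ℕ} {P : MultiAgentLQR N n m} {Ω : Type*} {w : ℕ → Fin N → Ω → ℝ}
    {T : ℕ → Ω → ℕ} {x : ℕ → Ω → P.State} {d : ℕ → Ω → ∀ i, P.Blk i} {K0 : P.Pol}
    {r : Fin N → ℝ} {η : ℝ} {s : ℕ} {cl : Fin N → Fin s} {z : ℕ → Fin s} {K Kprev : ℕ → Ω → P.Pol}
    (hrun : ∀ k ω, (K k ω, Kprev k ω) =
      P.run K0 r η cl z (fun l i => w l i ω) (fun l => T l ω) (fun l => x l ω)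
        (fun l => d l ω) k) (k : ℕ) (ω : Ω) :
    K (k + 1) ω = (P.step r η cl (z k) (fun i => w k i ω) (T k ω) (x k ω) (d k ω)
      (K k ω, Kprev k ω)).1 := by
  have h := hrun (k + 1) ω
  rw [run, ← hrun] at h
  exact congrArg Prod.fst h

section Iterates

variable {N n m : ℕ} {P : MultiAgentLQR N n m} {Ω : Type u} [MeasurableSpace Ω] {μ : Measure Ω}
  {ℱ : Filtration ℕ (inferInstance : MeasurableSpace Ω)}
  {w : ℕ → Fin N → Ω → ℝ} {T : ℕ → Ω → ℕ} {x : ℕ → Ω → P.State}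
  {d : ℕ → Ω → ∀ i, P.Blk i} {K0 : P.Pol} {r : Fin N → ℝ} {η : ℝ} {s : ℕ} {cl : Fin N → Fin s}
  {z : ℕ → Fin s} {K Kprev : ℕ → Ω → P.Pol}

/-- The iterates and the previous values of their blocks are determined by the past. -/
theorem Sampling.measurable_run (hS : P.Sampling μ ℱ w T x d)
    (hrun : ∀ k ω, (K k ω, Kprev k ω) =
      P.run K0 r η cl z (fun l i => w l i ω) (fun l => T l ω) (fun l => x l ω)
        (fun l => d l ω) k) (k : ℕ) : Measurable[ℱ k] fun ω => (K k ω, Kprev k ω) := by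
  induction k with
  | zero =>
    have : (fun ω => (K 0 ω, Kprev 0 ω)) = fun _ => (K0, K0) := funext fun ω => hrun 0 ω
    rw [this]
    exact measurable_const
  | succ k ih =>
    have h : (fun ω => (K (k + 1) ω, Kprev (k + 1) ω)) = fun ω =>
        P.step r η cl (z k) (fun i => w k i ω) (T k ω) (x k ω) (d k ω) (K k ω, Kprev k ω) :=
      funext fun ω => by rw [hrun, run, ← hrun]
    have hle : ℱ k ≤ ℱ (k + 1) := ℱ.mono (Nat.le_succ k)
    rw [h]
    exact P.measurable_step (fun i => (hS.weight k i).mono hle le_rfl) (hS.horizon k)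
      (hS.meas k).fst (hS.meas k).snd (ih.mono hle le_rfl)

theorem Sampling.ae_state (hS : P.Sampling μ ℱ w T x d) (k : ℕ) {p : P.State → Prop}
    (hp : ∀ᵐ y ∂P.D, p y) : ∀ᵐ ω ∂μ, p (x k ω) := by
  have hprob := P.D_prob
  have hm := (hS.meas k).mono (ℱ.le _) le_rfl
  have h := Measure.quasiMeasurePreserving_fst (μ := P.D)
    (ν := Measure.pi fun i => uniformSphere (P.Blk i)) |>.ae hp
  rw [← hS.law k] at h
  exact ae_of_ae_map hm.aemeasurable h

variable [∀ i, Nontrivial (P.Blk i)]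

theorem Sampling.map_pair (hS : P.Sampling μ ℱ w T x d) (k : ℕ) (i : Fin N) :
    μ.map (fun ω => (x k ω, d k ω i)) = P.D.prod (uniformSphere (P.Blk i)) := by
  have hprob := P.D_prob
  have h1 : MeasurePreserving (Prod.map id (Function.eval i))
      (P.D.prod (Measure.pi fun i => uniformSphere (P.Blk i)))
      (P.D.prod (uniformSphere (P.Blk i))) :=
    (MeasurePreserving.id P.D).prod (measurePreserving_eval (fun i => uniformSphere (P.Blk i)) i)
  rw [← h1.map_eq, ← hS.law k, Measure.map_map h1.measurable
    ((hS.meas k).mono (ℱ.le _) le_rfl)]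
  rfl

theorem Sampling.ae_norm_eq_one (hS : P.Sampling μ ℱ w T x d) (k : ℕ) :
    ∀ᵐ ω ∂μ, ∀ i, ‖d k ω i‖ = 1 := by
  have hprob := P.D_prob
  refine ae_all_iff.2 fun i => ?_
  have hm : Measurable fun ω => (x k ω, d k ω i) := by
    have h := (hS.meas k).mono (ℱ.le _) le_rfl
    exact h.fst.prodMk (measurable_pi_iff.1 h.snd i)
  have h := Measure.quasiMeasurePreserving_snd (μ := P.D) (ν := uniformSphere (P.Blk i)) |>.ae
    ae_norm_eq_one_uniformSphere
  rw [← hS.map_pair k i] at h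
  exact ae_of_ae_map hm.aemeasurable h

variable [IsProbabilityMeasure μ] [Nonempty (Fin n × Fin N)] {A : Set P.Pol} {lam φ ρ : ℝ}
  {B : Fin N → ℝ} {c ε' δ S M : ℝ}

/-- The descent of one step in the mean, on an event of the past. -/
theorem Sampling.setIntegral_J_step_le (hS : P.Sampling μ ℱ w T x d)
    (hrun : ∀ k ω, (K k ω, Kprev k ω) =
      P.run K0 r η cl z (fun l i => w l i ω) (fun l => T l ω) (fun l => x l ω)
        (fun l => d l ω) k)
    (hA : P.LocalBound A lam φ ρ B) (hs : P.StepSize r η cl c ε' δ S lam φ ρ B)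
    (hc : P.CostRatio c) (hM : ∀ K ∈ A, P.J K ≤ M) {k : ℕ} {E : Set Ω}
    (hE : MeasurableSet[ℱ k] E) (hEA : ∀ ω ∈ E, K k ω ∈ A)
    (hx : ∀ᵐ ω ∂μ, P.GoodSample A ρ c ε' (x k ω) (T k ω))
    (hp : ∀ᵐ ω ∂μ, P.SmallPast η ρ cl (fun i => w k i ω) (K k ω, Kprev k ω)) :
    IntegrableOn (fun ω => P.stab.indicator P.J (K (k + 1) ω)) E μ ∧
    IntegrableOn (fun ω => ∑ i ∈ univ.filter (fun i => cl i = z k),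
      ‖gradient P.J (K k ω) i‖ ^ 2) E μ ∧
    ∫ ω in E, P.stab.indicator P.J (K (k + 1) ω) ∂μ ≤
      ∫ ω in E, P.stab.indicator P.J (K k ω) ∂μ -
      η / 2 * ∫ ω in E, ∑ i ∈ univ.filter (fun i => cl i = z k),
        ‖gradient P.J (K k ω) i‖ ^ 2 ∂μ +
      (univ.filter fun i => cl i = z k).card * (η * S ^ 2 / 2) := by
  set C := univ.filter (fun i => cl i = z k) with hC
  have hle : ℱ k ≤ (inferInstance : MeasurableSpace Ω) := ℱ.le k
  have hE' : MeasurableSet E := hle _ hE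
  have hKK := hS.measurable_run hrun
  have hKm : ∀ l, Measurable (K l) := fun l => ((hKK l).mono (ℱ.le l) le_rfl).fst
  have hJm : ∀ l, Measurable fun ω => P.stab.indicator P.J (K l ω) := fun l =>
    P.measurable_indicator_J.comp (hKm l)
  have hgm : ∀ i, Measurable fun ω => gradient P.J (K k ω) i := fun i =>
    P.measurable_policy_apply (P.measurable_gradient.comp (hKm k)) i
  have hgood : ∀ᵐ ω ∂(μ.restrict E), ω ∈ E ∧ (∀ i, ‖d k ω i‖ = 1) ∧
      P.GoodSample A ρ c ε' (x k ω) (T k ω) ∧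
      P.SmallPast η ρ cl (fun i => w k i ω) (K k ω, Kprev k ω) := by
    filter_upwards [ae_restrict_mem hE', ae_restrict_of_ae (hS.ae_norm_eq_one k),
      ae_restrict_of_ae hx, ae_restrict_of_ae hp] with ω h1 h2 h3 h4 using ⟨h1, h2, h3, h4⟩
  -- the policy and the extrapolated block are known before the samples are drawn
  set Y : ∀ i, Ω → P.Pol × P.Blk i := fun i ω =>
    (K k ω, P.extrap (fun i => w k i ω) (K k ω, Kprev k ω) i) with hY
  have hYm : ∀ i, Measurable[ℱ k] (Y i) := fun i =>
    (hKK k).fst.prodMk (P.measurable_extrap (fun i => hS.weight k i) (hKK k) i)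
  have hYn : ∀ ω i, P.SmallPast η ρ cl (fun i => w k i ω) (K k ω, Kprev k ω) →
      r i + ‖(Y i ω).2 - K k ω i‖ ≤ ρ := fun ω i h => by
    have h1 := h.norm_extrap_sub_le hA.rho_pos i
    have h2 := hs.r_le i
    simp only [hY]
    linarith
  set F : ∀ i, (P.Pol × P.Blk i) × (P.State × P.Blk i) → ℝ := fun i v =>
    P.gradSqEstimate (r i) ε' i v.1.1 v.1.2 v.2.1 v.2.2 with hF
  have hFm : ∀ i, Measurable (F i) := fun i =>
    measurable_gradSqEstimate measurable_fst.fst measurable_fst.snd measurable_snd.fst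
      measurable_snd.snd
  have hξm : ∀ i, Measurable fun ω => (x k ω, d k ω i) := fun i => by
    have h := (hS.meas k).mono (ℱ.le _) le_rfl
    exact h.fst.prodMk (measurable_pi_iff.1 h.snd i)
  have hFi : ∀ i, IntegrableOn (fun ω => F i (Y i ω, (x k ω, d k ω i))) E μ := by
    intro i
    refine Integrable.of_bound ((hFm i).comp
      (((hYm i).mono hle le_rfl).prodMk (hξm i))).aestronglyMeasurable
      (P.dim i / r i * (c * (B i + lam * ρ) + ε') * lam) ?_
    filter_upwards [hgood] with ω ⟨h1, h2, h3, h4⟩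
    refine abs_gradSqEstimate_le hA hc.1.le hs.eps_nonneg (hs.r_pos i) (hEA ω h1) (hYn ω i h4)
      (h2 i) ?_
    exact (h3 _ (hEA ω h1) i _ (hs.norm_perturbed_sub_le h4 hA.rho_pos (h2 i))).1
  have hind : ∀ i, Indep (MeasurableSpace.comap (fun ω => (x k ω, d k ω i)) inferInstance)
      (ℱ k) μ := fun i => by
    refine indep_of_indep_of_le_left (hS.indep k) ?_
    have hmeas : Measurable (Prod.map id (Function.eval i) :
        P.State × (∀ i, P.Blk i) → P.State × P.Blk i) :=
      measurable_id.prodMap (measurable_pi_apply i)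
    rintro s ⟨t, ht, rfl⟩
    exact ⟨_, hmeas ht, rfl⟩
  -- the means of the estimates, given the past
  set Φ : Fin N → Ω → ℝ := fun i ω => ∫ v, F i (Y i ω, v) ∂(P.D.prod (uniformSphere (P.Blk i)))
    with hΦ
  have hfreeze : ∀ i, IntegrableOn (Φ i) E μ ∧
      ∫ ω in E, F i (Y i ω, (x k ω, d k ω i)) ∂μ = ∫ ω in E, Φ i ω ∂μ := fun i => by
    have h := setIntegral_comp_eq_of_indep hle (hYm i) (hξm i) (hind i) hE (hFm i) (hFi i)
    rw [hS.map_pair k i] at h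
    exact h
  have hgi : ∀ i, IntegrableOn (fun ω => ‖gradient P.J (K k ω) i‖ ^ 2) E μ := by
    intro i
    refine Integrable.of_bound ((hgm i).norm.pow_const 2).aestronglyMeasurable (lam ^ 2) ?_
    filter_upwards [hgood] with ω ⟨h1, _⟩
    rw [Real.norm_eq_abs, abs_of_nonneg (by positivity)]
    have h2 := (PiLp.norm_apply_le (gradient P.J (K k ω)) i).trans
      (hA.norm_gradient_le (hEA ω h1))
    gcongr
  have hstab : ∀ᵐ ω ∂(μ.restrict E), ‖K (k + 1) ω - K k ω‖ ≤ ρ := by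
    filter_upwards [hgood] with ω ⟨h1, h2, h3, h4⟩
    rw [run_succ_fst hrun]
    exact norm_step_sub_le hA hs h4 (hEA ω h1) h3 h2
  have hJi0 : IntegrableOn (fun ω => P.stab.indicator P.J (K k ω)) E μ := by
    refine Integrable.of_bound (hJm k).aestronglyMeasurable M ?_
    filter_upwards [hgood] with ω ⟨h1, _⟩
    rw [Set.indicator_of_mem (hA.mem_stab (hEA ω h1)), Real.norm_eq_abs,
      abs_of_nonneg (P.J_nonneg _)]
    exact hM _ (hEA ω h1)
  have hJi1 : IntegrableOn (fun ω => P.stab.indicator P.J (K (k + 1) ω)) E μ := by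
    refine Integrable.of_bound (hJm (k + 1)).aestronglyMeasurable (M + lam * ρ) ?_
    filter_upwards [hgood, hstab] with ω ⟨h1, _⟩ h2
    rw [Set.indicator_of_mem (hA.stab _ (hEA ω h1) _ h2), Real.norm_eq_abs,
      abs_of_nonneg (P.J_nonneg _)]
    have h3 := (le_abs_self _).trans (hA.lip _ (hEA ω h1) _ h2)
    have h4 := mul_le_mul_of_nonneg_left h2 hA.lam_nonneg
    linarith [hM _ (hEA ω h1)]
  refine ⟨hJi1, integrable_finsetSum _ fun i _ => hgi i, ?_⟩
  have hpath : ∀ᵐ ω ∂(μ.restrict E), P.stab.indicator P.J (K (k + 1) ω) ≤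
      P.stab.indicator P.J (K k ω) + ∑ i ∈ C, (η * Φ i ω - η * F i (Y i ω, (x k ω, d k ω i)) -
        η / 2 * ‖gradient P.J (K k ω) i‖ ^ 2 + η * S ^ 2 / 2) := by
    filter_upwards [hgood, hstab] with ω ⟨h1, h2, h3, h4⟩ h5
    have hK := hEA ω h1
    rw [Set.indicator_of_mem (hA.stab _ hK _ h5), Set.indicator_of_mem (hA.mem_stab hK),
      run_succ_fst hrun]
    refine (J_step_le (z := z k) hA hs h4 hK h3 h2).trans (add_le_add le_rfl
      (Finset.sum_le_sum fun i _ => ?_))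
    have h6 := le_integral_gradSqEstimate hA hc hs.eps_nonneg (hs.r_pos i) hK (hYn ω i h4)
    have hw := h4 i
    have h7 : ‖(Y i ω).2 - K k ω i‖ = w k i ω * ‖K k ω i - Kprev k ω i‖ :=
      P.norm_extrap_sub (p := (K k ω, Kprev k ω)) (w := fun i => w k i ω) hw.1
    have h8 := agent_balance (a := ‖gradient P.J (K k ω) i‖)
      (norm_nonneg _) (mul_nonneg hw.1 (norm_nonneg _)) hA.phi_nonneg hs.eta_pos hs.eta_le_one
      hw.2.1 (hs.phi_mul_r i) (hs.trunc i) hs.quad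
    rw [h7] at h6
    have h9 := mul_le_mul_of_nonneg_left h6 hs.eta_pos.le
    simp only [hΦ, hF, hY] at h9 h8 ⊢
    linarith
  have hterm : ∀ i ∈ C, IntegrableOn (fun ω => η * Φ i ω - η * F i (Y i ω, (x k ω, d k ω i)) -
        η / 2 * ‖gradient P.J (K k ω) i‖ ^ 2 + η * S ^ 2 / 2) E μ := fun i _ =>
    ((((hfreeze i).1.const_mul η).sub ((hFi i).const_mul η)).sub
      ((hgi i).const_mul (η / 2))).add (integrable_const _)
  -- the estimates and their means given the past have the same integral over `E`
  have hval : ∀ i ∈ C, ∫ ω in E, (η * Φ i ω - η * F i (Y i ω, (x k ω, d k ω i)) -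
        η / 2 * ‖gradient P.J (K k ω) i‖ ^ 2 + η * S ^ 2 / 2) ∂μ ≤
      -(η / 2 * ∫ ω in E, ‖gradient P.J (K k ω) i‖ ^ 2 ∂μ) + η * S ^ 2 / 2 := fun i _ => by
    have i1 := (hfreeze i).1.const_mul η
    have i2 := (hFi i).const_mul η
    have i3 := (hgi i).const_mul (η / 2)
    have i4 : Integrable (fun ω => η * Φ i ω - η * F i (Y i ω, (x k ω, d k ω i)))
        (μ.restrict E) := i1.sub i2
    have i5 : Integrable (fun ω => η * Φ i ω - η * F i (Y i ω, (x k ω, d k ω i)) -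
        η / 2 * ‖gradient P.J (K k ω) i‖ ^ 2) (μ.restrict E) := i4.sub i3
    rw [integral_add i5 (integrable_const _), integral_sub i4 i3,
      integral_sub i1 i2, integral_const_mul, integral_const_mul, integral_const_mul,
      (hfreeze i).2, setIntegral_const, smul_eq_mul]
    have h0 : 0 ≤ η * S ^ 2 / 2 := by have := hs.eta_pos; positivity
    have h1 := mul_le_mul_of_nonneg_right (measureReal_le_one (μ := μ) (s := E)) h0
    linarith
  have hsum := Finset.sum_le_sum hval
  rw [← integral_finsetSum _ hterm, Finset.sum_add_distrib, Finset.sum_neg_distrib,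
    ← Finset.mul_sum, Finset.sum_const, nsmul_eq_mul, ← integral_finsetSum _ fun i _ => hgi i]
    at hsum
  have hmono := integral_mono_ae hJi1 (hJi0.add (integrable_finsetSum _ hterm)) hpath
  rw [integral_add' hJi0 (integrable_finsetSum _ hterm)] at hmono
  linarith

end Iterates

end MultiAgentLQR

/-! ### The event on which the algorithm behaves well -/

namespace MultiAgentLQR

section GoodEvent

variable {N n m : ℕ} {P : MultiAgentLQR N n m} {Ω : Type u} [MeasurableSpace Ω] {μ : Measure Ω}
  [IsProbabilityMeasure μ] {ℱ : Filtration ℕ (inferInstance : MeasurableSpace Ω)}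
  {w : ℕ → Fin N → Ω → ℝ} {T : ℕ → Ω → ℕ} {x : ℕ → Ω → P.State}
  {d : ℕ → Ω → ∀ i, P.Blk i} {K0 : P.Pol} {r : Fin N → ℝ} {η : ℝ} {s : ℕ} {cl : Fin N → Fin s}
  {z : ℕ → Fin s} {K Kprev : ℕ → Ω → P.Pol} [Nonempty (Fin n × Fin N)] {lam φ ρ : ℝ}
  {B : Fin N → ℝ} {c ε' δ S : ℝ}

/-- With a large probability the iterates stay in the sublevel set of `M` and the weighted sum of
the squared gradient blocks stays below `b`. -/
theorem Sampling.one_sub_le_measureReal_good [∀ i, Nontrivial (P.Blk i)] {M b p : ℝ} {N0 TK : ℕ}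
    (hS : P.Sampling μ ℱ w T x d)
    (hrun : ∀ k ω, (K k ω, Kprev k ω) =
      P.run K0 r η cl z (fun l i => w l i ω) (fun l => T l ω) (fun l => x l ω)
        (fun l => d l ω) k)
    (hA : P.LocalBound {K | K ∈ P.stab ∧ P.J K ≤ M} lam φ ρ B)
    (hs : P.StepSize r η cl c ε' δ S lam φ ρ B) (hc : P.CostRatio c)
    (hK0 : K0 ∈ P.stab) (hK0M : P.J K0 ≤ M) (hN0 : ∀ z, (univ.filter fun i => cl i = z).card ≤ N0)
    (hx : ∀ k < TK, ∀ᵐ ω ∂μ, P.GoodSample {K | K ∈ P.stab ∧ P.J K ≤ M} ρ c ε' (x k ω) (T k ω))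
    (hp : ∀ k < TK, ∀ᵐ ω ∂μ, P.SmallPast η ρ cl (fun i => w k i ω) (K k ω, Kprev k ω))
    (hM : 0 < M) (hb : 0 < b) (hpM : P.J K0 + TK * (N0 * (η * S ^ 2 / 2)) ≤ p * M)
    (hpb : P.J K0 + TK * (N0 * (η * S ^ 2 / 2)) ≤ p * b) :
    1 - p ≤ μ.real {ω | (∀ k ≤ TK, K k ω ∈ P.stab ∧ P.J (K k ω) ≤ M) ∧
      ∑ k ∈ range TK, η / 2 * ∑ i ∈ univ.filter (fun i => cl i = z k),
        ‖gradient P.J (K k ω) i‖ ^ 2 < b} := by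
  set A : Set P.Pol := {K | K ∈ P.stab ∧ P.J K ≤ M} with hAdef
  have hKm : ∀ k, Measurable[ℱ k] (K k) := fun k => (hS.measurable_run hrun k).fst
  have hAm : MeasurableSet A := by
    have : A = P.stab ∩ {K | P.stab.indicator P.J K ≤ M} := by
      ext K
      simp only [hAdef, Set.mem_inter_iff, Set.mem_ofPred_eq]
      exact and_congr_right fun h => by rw [Set.indicator_of_mem h]
    rw [this]
    exact P.measurableSet_stab.inter (measurableSet_le P.measurable_indicator_J measurable_const)
  set E : ℕ → Set Ω := fun k => {ω | ∀ l ≤ k, K l ω ∈ A} with hE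
  have hEm : ∀ k, MeasurableSet[ℱ k] (E k) := by
    intro k
    have : E k = ⋂ l ∈ Set.Iic k, K l ⁻¹' A := by
      ext ω; simp [hE]
    rw [this]
    exact MeasurableSet.biInter (Set.to_countable _) fun l hl =>
      (hKm l).mono (ℱ.mono hl) le_rfl hAm
  have hanti : Antitone E := fun k l hkl ω hω j hj => hω j (hj.trans hkl)
  have hK0' : ∀ ω, K 0 ω = K0 := fun ω => congrArg Prod.fst (hrun 0 ω)
  have hE0 : E 0 = Set.univ := by
    refine Set.eq_univ_of_forall fun ω l hl => ?_
    rw [Nat.le_zero.1 hl, hK0']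
    exact ⟨hK0, hK0M⟩
  have hEA : ∀ k, ∀ ω ∈ E k, K k ω ∈ A := fun k ω hω => hω k le_rfl
  have hstep := fun k (hk : k < TK) => hS.setIntegral_J_step_le hrun hA hs hc
    (fun K hK => hK.2) (hEm k) (hEA k) (hx k hk) (hp k hk)
  have hexit : ∀ k < TK, ∀ᵐ ω ∂μ, ω ∈ E k → ω ∉ E (k + 1) →
      M ≤ P.stab.indicator P.J (K (k + 1) ω) := by
    intro k hk
    filter_upwards [hS.ae_norm_eq_one k, hx k hk, hp k hk] with ω h1 h2 h3 hω hω'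
    have h4 : ‖K (k + 1) ω - K k ω‖ ≤ ρ := by
      rw [run_succ_fst hrun]
      exact norm_step_sub_le hA hs h3 (hEA k ω hω) h2 h1
    have h5 := hA.stab _ (hEA k ω hω) _ h4
    rw [Set.indicator_of_mem h5]
    by_contra hlt
    refine hω' fun l hl => ?_
    rcases Nat.le_succ_iff.1 hl with h | rfl
    · exact hω l h
    · exact ⟨h5, (not_le.1 hlt).le⟩
  have hη := hs.eta_pos
  have hsuper := min_mul_measureReal_bad_le (μ := μ) (E := E) (T := TK) (M := M) (b := b)
    (V := fun k ω => P.stab.indicator P.J (K k ω))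
    (G := fun k ω => η / 2 * ∑ i ∈ univ.filter (fun i => cl i = z k),
        ‖gradient P.J (K k ω) i‖ ^ 2) (κ := N0 * (η * S ^ 2 / 2)) (V₀ := P.J K0)
    (fun k => ℱ.le k _ (hEm k)) hanti hE0 hM.le hb.le
    (fun ω => by simp only [hK0', Set.indicator_of_mem hK0])
    (fun k ω => Set.indicator_nonneg (fun K _ => P.J_nonneg K) _) (fun k ω => by positivity)
    (fun k hk => (hstep k hk).1) (fun k hk => (hstep k hk).2.1.const_mul _)
    (fun k hk => by
      refine (hstep k hk).2.2.trans ?_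
      rw [integral_const_mul]
      have h0 : 0 ≤ η * S ^ 2 / 2 := by positivity
      have h1 := mul_le_mul_of_nonneg_right (Nat.cast_le (α := ℝ).2 (hN0 (z k))) h0
      linarith) hexit
  set G : ℕ → Ω → ℝ := fun k ω => η / 2 * ∑ i ∈ univ.filter (fun i => cl i = z k),
        ‖gradient P.J (K k ω) i‖ ^ 2 with hG
  set bad := (E TK)ᶜ ∪ {ω | b ≤ ∑ k ∈ range TK, (E k).indicator (G k) ω} with hbad
  have hpos : 0 < min M b := lt_min hM hb
  have hbadp : μ.real bad ≤ p := by
    have h1 : P.J K0 + TK * (N0 * (η * S ^ 2 / 2)) ≤ min M b * p := by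
      rcases min_choice M b with h | h <;> rw [h] <;> linarith
    exact le_of_mul_le_mul_left (hsuper.trans h1) hpos
  have hcompl : badᶜ ⊆ {ω | (∀ k ≤ TK, K k ω ∈ P.stab ∧ P.J (K k ω) ≤ M) ∧
      ∑ k ∈ range TK, G k ω < b} := by
    intro ω hω
    simp only [hbad, Set.mem_compl_iff, Set.mem_union, not_or, not_not, Set.mem_ofPred_eq,
      not_le] at hω
    refine ⟨fun k hk => hω.1 k hk, ?_⟩
    refine lt_of_eq_of_lt (Finset.sum_congr rfl fun k hk => ?_) hω.2
    rw [Set.indicator_of_mem (hanti (mem_range.1 hk).le hω.1)]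
  have h1 := measureReal_union_le (μ := μ) badᶜ bad
  rw [Set.compl_union_self, probReal_univ] at h1
  have h2 := measureReal_mono (μ := μ) hcompl
  linarith

end GoodEvent

end MultiAgentLQR

/-! ### Cyclic updates -/

/-- Young's inequality in the form used for comparing gradients at different steps. -/
theorem norm_sq_le_of_young {E : Type*} [NormedAddCommGroup E] (a b : E) {t : ℝ} (ht : 0 < t) :
    ‖a‖ ^ 2 ≤ (1 + t) * ‖b‖ ^ 2 + (1 + t⁻¹) * ‖a - b‖ ^ 2 := by
  have h1 : ‖a‖ ≤ ‖b‖ + ‖a - b‖ := by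
    simpa using norm_add_le b (a - b)
  have h2 : ‖a‖ ^ 2 ≤ (‖b‖ + ‖a - b‖) ^ 2 := pow_le_pow_left₀ (norm_nonneg _) h1 2
  have h3 : t * ‖b‖ ^ 2 + t⁻¹ * ‖a - b‖ ^ 2 - 2 * (‖b‖ * ‖a - b‖) =
      t⁻¹ * (t * ‖b‖ - ‖a - b‖) ^ 2 := by
    field_simp
    ring
  have h4 : 0 ≤ t⁻¹ * (t * ‖b‖ - ‖a - b‖) ^ 2 := by positivity
  linarith

section Cyclic

variable {N s : ℕ} {F : Fin N → Type*} [∀ i, NormedAddCommGroup (F i)] {cl : Fin N → Fin s}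
  {z : ℕ → Fin s} {v : ℕ → PiLp 2 F}

/-- During a block of `T₀` steps in which all clusters are updated, the vectors are controlled by
the parts that belong to the updated clusters. The part of a cluster is compared at each step
with the part at a step that updates this cluster; the comparison is void at that very step,
which gives the factor `T₀ - 1`. -/
theorem sum_norm_sq_block_le {T₀ : ℕ} (hT : 0 < T₀) (hs : s ≤ T₀) {I : Finset ℕ}
    (hI : I.card = T₀) {y : ℝ} (hz : ∀ j, ∃ k ∈ I, z k = j)
    (hy : ∀ k ∈ I, ∀ l ∈ I, ‖v l - v k‖ ≤ y) :
    ∑ k ∈ I, ‖v k‖ ^ 2 ≤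
      (2 * T₀ - 1 / 2) * ∑ k ∈ I, ∑ i ∈ univ.filter (fun i => cl i = z k), ‖v k i‖ ^ 2 +
        2 * T₀ ^ 2 * y ^ 2 := by
  choose κ hκI hκ using hz
  have hT1 : (1 : ℝ) ≤ T₀ := by exact_mod_cast hT
  -- with this parameter in Young's inequality, `T₀ * (1 + t) = 2 * T₀ - 1 / 2` leaves room for
  -- the steps after the last complete cycle
  set t : ℝ := 1 - 1 / (2 * T₀) with ht
  have ht0 : 0 < t := by
    have : 1 / (2 * (T₀ : ℝ)) ≤ 1 / 2 := by
      apply one_div_le_one_div_of_le <;> linarith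
    linarith
  set p : ℕ → Fin s → ℝ := fun k j => ∑ i ∈ univ.filter (fun i => cl i = j), ‖v k i‖ ^ 2 with hp
  have hp0 : ∀ k j, 0 ≤ p k j := fun k j => Finset.sum_nonneg fun i _ => by positivity
  have hsplit : ∀ k, ‖v k‖ ^ 2 = ∑ j, p k j := fun k => by
    rw [PiLp.norm_sq_eq_of_L2, hp]
    exact (Finset.sum_fiberwise univ cl fun i => ‖v k i‖ ^ 2).symm
  have hpk : ∀ k ∈ I, ∀ j, p k j ≤ (1 + t) * p (κ j) j +
      if κ j = k then 0 else (1 + t⁻¹) * y ^ 2 := by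
    intro k hk j
    split_ifs with h
    · rw [h]
      nlinarith [hp0 k j]
    · have h1 : ∑ i ∈ univ.filter (fun i => cl i = j), ‖(v k - v (κ j)) i‖ ^ 2 ≤ y ^ 2 := by
        refine (Finset.sum_le_sum_of_subset_of_nonneg (Finset.subset_univ _)
          fun i _ _ => by positivity).trans ?_
        rw [← PiLp.norm_sq_eq_of_L2]
        exact pow_le_pow_left₀ (norm_nonneg _) (hy _ (hκI j) k hk) 2
      have h2 : p k j ≤ (1 + t) * p (κ j) j +
          (1 + t⁻¹) * ∑ i ∈ univ.filter (fun i => cl i = j), ‖(v k - v (κ j)) i‖ ^ 2 := by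
        rw [hp]
        simp only
        rw [Finset.mul_sum, Finset.mul_sum, ← Finset.sum_add_distrib]
        exact Finset.sum_le_sum fun i _ => norm_sq_le_of_young _ _ ht0
      have h3 := mul_le_mul_of_nonneg_left h1 (by positivity : 0 ≤ 1 + t⁻¹)
      linarith
  have hG : ∑ j, p (κ j) j ≤ ∑ k ∈ I, p k (z k) := by
    have hinj : Function.Injective κ := fun a b h => by rw [← hκ a, ← hκ b, h]
    calc ∑ j, p (κ j) j = ∑ j, p (κ j) (z (κ j)) := Finset.sum_congr rfl fun j _ => by rw [hκ]
      _ = ∑ k ∈ univ.map ⟨κ, hinj⟩, p k (z k) := by rw [Finset.sum_map]; rfl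
      _ ≤ ∑ k ∈ I, p k (z k) := by
          refine Finset.sum_le_sum_of_subset_of_nonneg ?_ fun k _ _ => hp0 _ _
          intro k hk
          obtain ⟨j, -, rfl⟩ := Finset.mem_map.1 hk
          exact hκI j
  have hcount : ∀ j, ∑ k ∈ I, (if κ j = k then 0 else (1 + t⁻¹) * y ^ 2) =
      ((T₀ : ℝ) - 1) * ((1 + t⁻¹) * y ^ 2) := by
    intro j
    have h1 : ∀ k ∈ I, (if κ j = k then 0 else (1 + t⁻¹) * y ^ 2) =
        (1 + t⁻¹) * y ^ 2 - if κ j = k then (1 + t⁻¹) * y ^ 2 else 0 := fun k _ => by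
      split_ifs <;> simp
    rw [Finset.sum_congr rfl h1, Finset.sum_sub_distrib, Finset.sum_ite_eq, if_pos (hκI j),
      Finset.sum_const, hI, nsmul_eq_mul]
    ring
  have hconst : ((T₀ : ℝ) - 1) * (1 + t⁻¹) ≤ 2 * T₀ := by
    have h1 : t⁻¹ = 2 * T₀ / (2 * T₀ - 1) := by
      rw [ht]
      have : (2 * (T₀ : ℝ) - 1) ≠ 0 := by linarith
      field_simp
    have h2 : (0 : ℝ) < 2 * T₀ - 1 := by linarith
    rw [h1, one_add_div h2.ne', mul_div_assoc', div_le_iff₀ h2]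
    nlinarith
  calc ∑ k ∈ I, ‖v k‖ ^ 2 = ∑ k ∈ I, ∑ j, p k j := Finset.sum_congr rfl fun k _ => hsplit k
    _ ≤ ∑ k ∈ I, ∑ j, ((1 + t) * p (κ j) j + if κ j = k then 0 else (1 + t⁻¹) * y ^ 2) :=
        Finset.sum_le_sum fun k hk => Finset.sum_le_sum fun j _ => hpk k hk j
    _ = T₀ * ((1 + t) * ∑ j, p (κ j) j) + s * (((T₀ : ℝ) - 1) * ((1 + t⁻¹) * y ^ 2)) := by
        simp_rw [Finset.sum_add_distrib]
        rw [Finset.sum_comm (s := I) (f := fun k j => if κ j = k then 0 else (1 + t⁻¹) * y ^ 2),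
          Finset.sum_congr rfl fun j _ => hcount j, Finset.sum_const, Finset.sum_const, hI,
          ← Finset.mul_sum, Finset.card_univ, Fintype.card_fin, nsmul_eq_mul, nsmul_eq_mul]
    _ ≤ T₀ * ((1 + t) * ∑ k ∈ I, p k (z k)) + T₀ * (2 * T₀ * y ^ 2) := by
        have h1 : (0 : ℝ) ≤ T₀ - 1 := by linarith
        have h2 : (s : ℝ) ≤ T₀ := by exact_mod_cast hs
        have h3 := mul_le_mul_of_nonneg_right hconst (sq_nonneg y)
        rw [mul_assoc] at h3
        gcongr
    _ = _ := by
        have h1 : (T₀ : ℝ) * (1 + t) = 2 * T₀ - 1 / 2 := by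
          rw [ht]; field_simp; ring
        rw [← mul_assoc, h1]
        ring

/-- The average of the full squared norms under essentially cyclic updates. The steps after the
last complete block are controlled by `htail`. -/
theorem sum_norm_sq_lt_of_cyclic {T₀ TK : ℕ} {ε y : ℝ} (hT : 0 < T₀) (hTK : 0 < TK) (hε : 0 < ε)
    (hs : s ≤ T₀)
    (hz : ∀ (j : Fin s) (k₁ k₂ : ℕ), k₂ + 1 = k₁ + T₀ → k₂ < TK →
      ∃ k₀, k₁ ≤ k₀ ∧ k₀ ≤ k₂ ∧ z k₀ = j)
    (hy : ∀ k l, k ≤ l → l < k + T₀ → l < TK → ‖v l - v k‖ ≤ y)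
    (htail : ∀ k < TK, ((T₀ : ℝ) - 1) * ‖v k‖ ^ 2 ≤ TK * ε / 2 + ((T₀ : ℝ) - 1) * (y ^ 2 / 4))
    (hG : ∑ k ∈ range TK, ∑ i ∈ univ.filter (fun i => cl i = z k), ‖v k i‖ ^ 2 < TK * ε) :
    ∑ k ∈ range TK, ‖v k‖ ^ 2 < 2 * T₀ * TK * (ε + y ^ 2) := by
  set g : ℕ → ℝ := fun k => ∑ i ∈ univ.filter (fun i => cl i = z k), ‖v k i‖ ^ 2 with hg
  have hg0 : ∀ k, 0 ≤ g k := fun k => Finset.sum_nonneg fun i _ => by positivity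
  have hT1 : (1 : ℝ) ≤ T₀ := by exact_mod_cast hT
  have hblocks : ∀ b, b * T₀ ≤ TK → ∑ k ∈ range (b * T₀), ‖v k‖ ^ 2 ≤
      (2 * T₀ - 1 / 2) * ∑ k ∈ range (b * T₀), g k + 2 * T₀ * (b * T₀) * y ^ 2 := by
    intro b
    induction b with
    | zero => intro _; simp
    | succ b ih =>
      intro hb
      have hb' : b * T₀ + T₀ ≤ TK := by rwa [Nat.succ_mul] at hb
      have h1 := ih (by omega)
      have h2 := sum_norm_sq_block_le (v := v) (cl := cl) (z := z) hT hs
        (I := Finset.Ico (b * T₀) (b * T₀ + T₀)) (by simp) (y := y)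
        (fun j => by
          obtain ⟨k, hk1, hk2, hk3⟩ := hz j (b * T₀) (b * T₀ + T₀ - 1) (by omega) (by omega)
          exact ⟨k, Finset.mem_Ico.2 ⟨hk1, by omega⟩, hk3⟩)
        (fun k hk l hl => by
          rw [Finset.mem_Ico] at hk hl
          rcases le_total k l with h | h
          · exact hy k l h (by omega) (by omega)
          · rw [norm_sub_rev]
            exact hy l k h (by omega) (by omega))
      rw [Nat.succ_mul, ← Finset.sum_range_add_sum_Ico _ (Nat.le_add_right (b * T₀) T₀),
        ← Finset.sum_range_add_sum_Ico (fun k => g k) (Nat.le_add_right (b * T₀) T₀)]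
      push_cast
      linarith
  set M := TK / T₀ with hM
  have hMT : M * T₀ ≤ TK := Nat.div_mul_le_self _ _
  have hrem : TK - M * T₀ < T₀ := by
    have h1 := Nat.div_add_mod' TK T₀
    have h2 := Nat.mod_lt TK hT
    rw [← hM] at h1
    omega
  have h1 := hblocks M hMT
  have htailsum : ∑ k ∈ Finset.Ico (M * T₀) TK, ‖v k‖ ^ 2 ≤
      TK * ε / 2 + (TK - M * T₀ : ℕ) * (y ^ 2 / 4) := by
    rcases Nat.eq_zero_or_pos (TK - M * T₀) with h0 | h0
    · rw [Finset.Ico_eq_empty (by omega), h0]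
      simp only [Finset.sum_empty, Nat.cast_zero, zero_mul, add_zero]
      positivity
    have hT2 : (0 : ℝ) < T₀ - 1 := by
      have : (1 : ℝ) < T₀ := by exact_mod_cast (by omega : 1 < T₀)
      linarith
    have hr : ((TK - M * T₀ : ℕ) : ℝ) ≤ T₀ - 1 := by
      have : ((TK - M * T₀ : ℕ) : ℝ) + 1 ≤ T₀ := by exact_mod_cast hrem
      linarith
    have h2 : ∀ k ∈ Finset.Ico (M * T₀) TK, ‖v k‖ ^ 2 ≤
        TK * ε / 2 / ((T₀ : ℝ) - 1) + y ^ 2 / 4 := by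
      intro k hk
      have := htail k (Finset.mem_Ico.1 hk).2
      rw [div_add' _ _ _ hT2.ne', le_div_iff₀ hT2]
      linarith
    refine (Finset.sum_le_card_nsmul _ _ _ h2).trans ?_
    rw [Nat.card_Ico, nsmul_eq_mul, mul_add]
    have h3 : ((TK - M * T₀ : ℕ) : ℝ) * (TK * ε / 2 / ((T₀ : ℝ) - 1)) ≤
        ((T₀ : ℝ) - 1) * (TK * ε / 2 / ((T₀ : ℝ) - 1)) := by gcongr
    rw [mul_div_cancel₀ _ hT2.ne'] at h3
    linarith
  have hgle : ∑ k ∈ range (M * T₀), g k ≤ ∑ k ∈ range TK, g k :=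
    Finset.sum_le_sum_of_subset_of_nonneg (by simpa using hMT) fun k _ _ => hg0 k
  have hglt : (2 * (T₀ : ℝ) - 1 / 2) * ∑ k ∈ range (M * T₀), g k <
      (2 * T₀ - 1 / 2) * (TK * ε) :=
    mul_lt_mul_of_pos_left (hgle.trans_lt hG) (by linarith)
  have hcast : ((TK - M * T₀ : ℕ) : ℝ) = TK - M * T₀ := by
    rw [Nat.cast_sub hMT, Nat.cast_mul]
  rw [← Finset.sum_range_add_sum_Ico _ hMT]
  have hy2 : ((TK - M * T₀ : ℕ) : ℝ) * (y ^ 2 / 4) ≤ 2 * T₀ * (TK - M * T₀ : ℕ) * y ^ 2 := by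
    have h3 : (0 : ℝ) ≤ (TK - M * T₀ : ℕ) * y ^ 2 := by positivity
    nlinarith
  rw [hcast] at hy2 htailsum
  linarith

end Cyclic

/-! ### The constants -/

/-- The budget of the supermartingale argument: the initial cost and the accumulated errors are
small compared with the exit level and with the target for the sum of the squared gradients. -/
theorem initial_cost_add_errors_le {J₀ α ν γ ε η TK : ℝ} (hJ : 0 < J₀) (hα0 : 0 < α)
    (hν : 0 < ν) (hγ : 0 < γ) (hε : 0 < ε) (hη : 0 < η)
    (hηJ : η ≤ 2 * α * J₀ / (γ * ε)) (h1 : 2 * α * ν * J₀ / (η * ε) ≤ TK)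
    (h2 : TK ≤ 2 * α * ν * J₀ / (η * ε) + 1) :
    J₀ + TK * (η * γ * ε / (2 * α)) ≤
      1 / α * (2 + γ + 1 / ν + ν * γ) * min (α * J₀) (2 * α * ν * J₀) ∧
    J₀ + TK * (η * γ * ε / (2 * α)) ≤
      1 / α * (2 + γ + 1 / ν + ν * γ) * (η * TK * ε / 2) := by
  rw [le_div_iff₀ (by positivity)] at hηJ
  rw [div_le_iff₀ (by positivity)] at h1
  rw [← sub_le_iff_le_add, le_div_iff₀ (by positivity)] at h2
  have hA : J₀ + TK * (η * γ * ε / (2 * α)) ≤ (2 + ν * γ) * J₀ := by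
    have h3 : TK * (η * γ * ε / (2 * α)) =
        ((TK - 1) * (η * ε)) * γ / (2 * α) + η * (γ * ε) / (2 * α) := by ring
    have h4 : ((TK - 1) * (η * ε)) * γ / (2 * α) ≤ 2 * α * ν * J₀ * γ / (2 * α) := by gcongr
    have h5 : η * (γ * ε) / (2 * α) ≤ 2 * α * J₀ / (2 * α) := by gcongr
    have h6 : 2 * α * ν * J₀ * γ / (2 * α) = ν * γ * J₀ := by field_simp
    have h7 : 2 * α * J₀ / (2 * α) = J₀ := by field_simp
    linarith
  constructor
  · rcases min_choice (α * J₀) (2 * α * ν * J₀) with h | h <;> rw [h]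
    · refine hA.trans ?_
      have : 1 / α * (2 + γ + 1 / ν + ν * γ) * (α * J₀) = (2 + γ + 1 / ν + ν * γ) * J₀ := by
        field_simp
      rw [this]
      have : 0 ≤ 1 / ν := by positivity
      gcongr
      linarith
    · refine hA.trans ?_
      have : 1 / α * (2 + γ + 1 / ν + ν * γ) * (2 * α * ν * J₀) =
          (4 * ν + 2 * ν * γ + 2 + 2 * ν ^ 2 * γ) * J₀ := by
        field_simp; ring
      rw [this]
      have h3 : 0 < ν * γ := by positivity
      have h4 : 0 < ν ^ 2 * γ := by positivity
      exact mul_le_mul_of_nonneg_right (by linarith) hJ.le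
  · have h3 : J₀ ≤ 1 / α * (1 / ν) * (η * TK * ε / 2) := by
      have : 1 / α * (1 / ν) * (η * TK * ε / 2) = TK * (η * ε) / (2 * α * ν) := by field_simp
      rw [this, le_div_iff₀ (by positivity)]
      linarith
    have h4 : TK * (η * γ * ε / (2 * α)) = 1 / α * γ * (η * TK * ε / 2) := by field_simp
    have hTK : 0 ≤ TK := by
      have h5 : 0 < 2 * α * ν * J₀ := by positivity
      exact (pos_of_mul_pos_left (h5.trans_le h1) (by positivity)).le
    have h5 : 0 ≤ 1 / α * (2 + ν * γ) * (η * TK * ε / 2) := by positivity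
    have h6 : 1 / α * (2 + γ + 1 / ν + ν * γ) * (η * TK * ε / 2) =
        1 / α * (1 / ν) * (η * TK * ε / 2) + 1 / α * γ * (η * TK * ε / 2) +
          1 / α * (2 + ν * γ) * (η * TK * ε / 2) := by ring
    linarith

namespace MultiAgentLQR

variable {N n m : ℕ} {P : MultiAgentLQR N n m}

section Constants

theorem localBound_levelSet {lam zet phi bet : P.Pol → ℝ} (hlp : P.LocalParams lam zet phi bet)
    {K0 : P.Pol} {α phi0 lam0 rho0 : ℝ} {αi : Fin N → ℝ} (hK0 : K0 ∈ P.levelSet K0 α αi)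
    (hphi : IsLUB (phi '' P.levelSet K0 α αi) phi0)
    (hlam : IsLUB (lam '' P.levelSet K0 α αi) lam0)
    (hrho : IsGLB (bet '' P.levelSet K0 α αi ∪ zet '' P.levelSet K0 α αi) rho0)
    (hρ : 0 < rho0) :
    P.LocalBound (P.levelSet K0 α αi) lam0 phi0 rho0 fun i => αi i * P.localJ i K0 := by
  have hb : ∀ K ∈ P.levelSet K0 α αi, rho0 ≤ bet K := fun K hK =>
    hrho.1 (Or.inl ⟨K, hK, rfl⟩)
  have hz : ∀ K ∈ P.levelSet K0 α αi, rho0 ≤ zet K := fun K hK =>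
    hrho.1 (Or.inr ⟨K, hK, rfl⟩)
  have hl : ∀ K ∈ P.levelSet K0 α αi, lam K ≤ lam0 := fun K hK => hlam.1 ⟨K, hK, rfl⟩
  have hp : ∀ K ∈ P.levelSet K0 α αi, phi K ≤ phi0 := fun K hK => hphi.1 ⟨K, hK, rfl⟩
  obtain ⟨h1, -, h2, -⟩ := hlp.pos K0 hK0.1
  exact
    { stab := fun K hK K' h => (hlp.grad K hK.1 K' (h.trans (hb K hK))).1
      lip := fun K hK K' h => (hlp.lip K hK.1 K' (h.trans (hz K hK))).2.trans
        (mul_le_mul_of_nonneg_right (hl K hK) (norm_nonneg _))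
      grad := fun K hK K' h => (hlp.grad K hK.1 K' (h.trans (hb K hK))).2.trans
        (mul_le_mul_of_nonneg_right (hp K hK) (norm_nonneg _))
      cost := fun K hK i => hK.2.2 i
      rho_pos := hρ
      lam_nonneg := h1.le.trans (hl K0 hK0)
      phi_nonneg := h2.le.trans (hp K0 hK0) }

theorem dim_le_dimMax (i : Fin N) : P.dim i ≤ P.dimMax := Finset.le_sup (f := P.dim) (mem_univ i)

theorem card_cluster_le {s : ℕ} {cl : Fin N → Fin s} {Ni : Fin N → ℕ}
    (hNi : ∀ i, Ni i = (univ.filter fun j => cl j = cl i).card) (z : Fin s) :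
    (univ.filter fun i => cl i = z).card ≤ univ.sup Ni := by
  rcases (univ.filter fun i => cl i = z).eq_empty_or_nonempty with h | ⟨i, hi⟩
  · simp [h]
  · rw [← (mem_filter.1 hi).2, ← hNi]
    exact Finset.le_sup (f := Ni) (mem_univ i)

theorem iInf_radius_pos [Nonempty (Fin N)] {r : Fin N → ℝ} (hr : ∀ i, 0 < r i) : 0 < ⨅ i, r i := by
  obtain ⟨i, hi⟩ := exists_eq_ciInf_of_finite (f := r)
  rw [← hi]
  exact hr i

theorem iInf_radius_le (r : Fin N → ℝ) (i : Fin N) : ⨅ i, r i ≤ r i :=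
  ciInf_le (Set.finite_range r).bddBelow i

/-- The bound on the estimates exceeds twice the Lipschitz constant of the cost, because the
smoothing radii are at most `ρ / 2`. -/
theorem two_mul_le_gradBound (hN : 0 < N) (hn : 0 < n) (hm : 0 < m) {K0 : P.Pol}
    {αi r : Fin N → ℝ} {c lam0 rho0 ε' : ℝ} (hc : 1 ≤ c) (hlam : 0 ≤ lam0) (hρ : 0 < rho0)
    (hε' : 0 < ε') (hα : ∀ i, 0 ≤ αi i) (hr : ∀ i, 0 < r i) (hrρ : ∀ i, r i ≤ rho0 / 2) :
    2 * lam0 ≤ P.gradBound K0 αi r c lam0 rho0 ε' ∧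
      0 < P.gradBound K0 αi r c lam0 rho0 ε' := by
  let i : Fin N := ⟨0, hN⟩
  have hne : Nonempty (Fin N) := ⟨i⟩
  have hmin := iInf_radius_pos hr
  have hmin' : ⨅ i, r i ≤ rho0 / 2 := (iInf_radius_le r i).trans (hrρ i)
  have hdim : (1 : ℝ) ≤ P.dimMax := by
    exact_mod_cast (P.dim_pos hn hm i).trans_le (P.dim_le_dimMax i)
  have hB : 0 ≤ ⨆ i, αi i * P.localJ i K0 :=
    Real.iSup_nonneg fun i => mul_nonneg (hα i) (P.localJ_nonneg i K0)
  have h1 : 2 / rho0 ≤ P.dimMax / ⨅ i, r i := by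
    rw [div_le_div_iff₀ hρ hmin]
    nlinarith
  have h2 : lam0 * rho0 + ε' ≤ c * ((⨆ i, αi i * P.localJ i K0) + lam0 * rho0) + ε' := by
    have : 0 ≤ lam0 * rho0 := by positivity
    nlinarith
  have h0 : 0 < lam0 * rho0 + ε' := by positivity
  have h3 : 2 / rho0 * (lam0 * rho0 + ε') ≤ P.gradBound K0 αi r c lam0 rho0 ε' := by
    rw [gradBound]
    exact mul_le_mul h1 h2 h0.le ((by positivity : (0 : ℝ) ≤ 2 / rho0).trans h1)
  have h4 : 2 / rho0 * (lam0 * rho0 + ε') = 2 * lam0 + 2 / rho0 * ε' := by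
    field_simp
  have h5 : 0 < 2 / rho0 * ε' := by positivity
  constructor <;> linarith

theorem stepSize_of_le (hN : 0 < N) (hn : 0 < n) (hm : 0 < m) {K0 : P.Pol}
    {αi r : Fin N → ℝ} {c phi0 lam0 rho0 ε' : ℝ} (hc : 1 ≤ c) (hphi : 0 ≤ phi0)
    (hlam : 0 ≤ lam0) (hρ : 0 < rho0) (hε' : 0 < ε') (hα : ∀ i, 0 ≤ αi i)
    {γ ε α η δ S : ℝ} {s : ℕ} {cl : Fin N → Fin s} {Ni : Fin N → ℕ} {N0 : ℕ}
    (hγ : 0 < γ) (hε : 0 < ε) (hα0 : 0 < α)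
    (hNi : ∀ i, Ni i = (univ.filter fun j => cl j = cl i).card) (hN0 : N0 = univ.sup Ni)
    (hδ : δ = P.gradBound K0 αi r c lam0 rho0 ε') (hS : S = Real.sqrt (γ * ε / (α * N0)))
    (hη : 0 < η) (hη1 : η ≤ 1) (hηρ : η ≤ rho0 / (2 * δ * Real.sqrt N0))
    (hηq : η ≤ γ * ε / (2 * α * N0 * (phi0 * δ ^ 2 + 4 * phi0 ^ 2 + phi0 + 4)))
    (hεS : ε' ≤ (⨅ i, r i) / (4 * P.dimMax) * S)
    (hr : ∀ i, 0 < r i ∧ r i ≤ rho0 / 2 ∧ r i ≤ 1 / (4 * phi0) * S) :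
    0 < N0 ∧ N0 * (η * S ^ 2 / 2) = η * γ * ε / (2 * α) ∧
    P.StepSize r η cl c ε' δ S lam0 phi0 rho0 fun i => αi i * P.localJ i K0 := by
  have hne : Nonempty (Fin N) := ⟨⟨0, hN⟩⟩
  have hcard : ∀ z, (univ.filter fun i => cl i = z).card ≤ N0 := fun z => by
    rw [hN0]; exact card_cluster_le hNi z
  have hN0pos : 0 < N0 := by
    refine lt_of_lt_of_le ?_ (hcard (cl ⟨0, hN⟩))
    exact Finset.card_pos.2 ⟨⟨0, hN⟩, by simp⟩
  have hN0R : (0 : ℝ) < N0 := by exact_mod_cast hN0pos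
  have hS2 : S ^ 2 = γ * ε / (α * N0) := by
    rw [hS, Real.sq_sqrt (by positivity)]
  have hS0 : 0 ≤ S := hS ▸ Real.sqrt_nonneg _
  have hmin := iInf_radius_pos fun i => (hr i).1
  have hdim : (1 : ℝ) ≤ P.dimMax := by
    exact_mod_cast (P.dim_pos hn hm ⟨0, hN⟩).trans_le (P.dim_le_dimMax ⟨0, hN⟩)
  have hδ0 : 0 < δ := hδ ▸ (two_mul_le_gradBound hN hn hm hc hlam hρ hε' hα (fun i => (hr i).1)
    fun i => (hr i).2.1).2
  have hqi : ∀ i, (P.dim i : ℝ) / r i ≤ P.dimMax / ⨅ i, r i := fun i =>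
    div_le_div₀ (by linarith) (by exact_mod_cast P.dim_le_dimMax i) hmin (iInf_radius_le r i)
  refine ⟨hN0pos, by rw [hS2]; field_simp, ?_⟩
  refine ⟨hη, hη1, by linarith, hε'.le, fun i => (hr i).1, fun i => (hr i).2.1, fun i => ?_,
    fun i => ?_, fun i => ?_, fun z => ?_, ?_⟩
  · have h1 := mul_le_mul_of_nonneg_left (hr i).2.2 hphi
    refine h1.trans ?_
    -- `1 / (4 * phi0)` is zero for `phi0 = 0`, where the bound is trivial
    rcases hphi.eq_or_lt with h | h
    · rw [← h]; simp only [zero_mul]; positivity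
    · apply le_of_eq; field_simp
  · refine (mul_le_mul_of_nonneg_right (hqi i) hε'.le).trans ?_
    refine (mul_le_mul_of_nonneg_left hεS (by positivity)).trans (le_of_eq ?_)
    field_simp
  · rw [hδ, gradBound]
    have hle : αi i * P.localJ i K0 ≤ ⨆ i, αi i * P.localJ i K0 :=
      le_ciSup (Set.finite_range fun i => αi i * P.localJ i K0).bddAbove i
    have h0 : 0 ≤ αi i * P.localJ i K0 + lam0 * rho0 :=
      add_nonneg (mul_nonneg (hα i) (P.localJ_nonneg i K0)) (by positivity)
    have h1 : c * (αi i * P.localJ i K0 + lam0 * rho0) ≤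
        c * ((⨆ i, αi i * P.localJ i K0) + lam0 * rho0) + ε' := by
      have := mul_le_mul_of_nonneg_left (add_le_add_left hle (lam0 * rho0)) (by linarith : 0 ≤ c)
      linarith
    exact mul_le_mul (hqi i) h1 (mul_nonneg (by linarith) h0) (by positivity)
  · have hsq : Real.sqrt (univ.filter fun i => cl i = z).card ≤ Real.sqrt N0 :=
      Real.sqrt_le_sqrt (by exact_mod_cast hcard z)
    have hsp : 0 < Real.sqrt N0 := Real.sqrt_pos.2 hN0R
    rw [le_div_iff₀ (by positivity)] at hηρ
    have h1 := mul_le_mul_of_nonneg_left hsq (by positivity : 0 ≤ η * δ)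
    linarith
  · have hD : 0 < phi0 * δ ^ 2 + 4 * phi0 ^ 2 + phi0 + 4 := by positivity
    rw [le_div_iff₀ (by positivity)] at hηq
    rw [hS2, div_div, le_div_iff₀ (by positivity)]
    linarith

end Constants

section Horizon

variable [Nonempty (Fin n × Fin N)]

/-- Almost surely, a sample with a long enough horizon is good. -/
theorem exists_horizon_goodSample (hm : 0 < m) {K0 : P.Pol} {α c phi0 lam0 rho0 κ0 ε' : ℝ}
    {αi : Fin N → ℝ} (hc : P.CostRatio c)
    (hA : P.LocalBound (P.levelSet K0 α αi) lam0 phi0 rho0 fun i => αi i * P.localJ i K0)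
    (hκ : IsLUB ((fun K => matSpectralNorm (P.discLoop (P.gain K))) ''
      P.blockNhd (P.levelSet K0 α αi) rho0) κ0) (hε' : 0 < ε') :
    ∃ Tbar : ℝ, ∀ᵐ x ∂P.D, ∀ T : ℕ, (Tbar ≤ T ∨
      (κ0 < 1 ∧ ∀ i, P.horizonBound K0 αi lam0 rho0 κ0 ε' x i ≤ T)) →
      P.GoodSample (P.levelSet K0 α αi) rho0 c ε' x T := by
  obtain ⟨Tbar, hT⟩ := P.exists_horizon_blockNhd hm K0 α αi hA.rho_pos hA.stab hε'
  refine ⟨Tbar, ?_⟩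
  filter_upwards [hT, hc.2] with x hx hcx T hTx K hK i y hy
  have hst : P.replace K i y ∈ P.stab := hA.stab K hK _ (by rwa [P.norm_replace_sub])
  have hmem : P.replace K i y ∈ P.blockNhd (P.levelSet K0 α αi) rho0 := ⟨K, hK, i, y, hy, rfl⟩
  refine ⟨hcx i _ hst, ?_⟩
  rcases hTx with h | ⟨h1, h2⟩
  · exact hx _ hmem i T h
  · exact P.tail_le_of_log_le hst h1 (hκ.1 ⟨_, hmem, rfl⟩) (hA.localJ_replace_le hK hy) hε' (h2 i)

end Horizon

section Distance

variable [Nonempty (Fin n × Fin N)] {A : Set P.Pol} {lam φ ρ : ℝ} {B : Fin N → ℝ}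
  {s : ℕ} {r : Fin N → ℝ} {η : ℝ} {cl : Fin N → Fin s} {c ε' δ S : ℝ}

/-- The distance of consecutive iterates under the conditions for cyclic updates. -/
theorem mul_norm_step_sub_le {z : Fin s} {w : Fin N → ℝ} {T : ℕ} {x : P.State}
    {d : ∀ i, P.Blk i} {p : P.Pol × P.Pol} (hA : P.LocalBound A lam φ ρ B)
    (hs : P.StepSize r η cl c ε' δ S lam φ ρ B) (hp : P.SmallPast η ρ cl w p) (hK : p.1 ∈ A)
    (hx : P.GoodSample A ρ c ε' x T) (hd : ∀ i, ‖d i‖ = 1) {τ εbar : ℝ} {N0 : ℕ} (hτ : 0 ≤ τ)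
    (hδ0 : 0 ≤ δ) (hε : 0 ≤ εbar) (hcard : (univ.filter fun i => cl i = z).card ≤ N0)
    (hw : ∀ i, 2 * τ * (univ.filter fun j => cl j = cl i).card *
      (w i * ‖p.1 i - p.2 i‖) ≤ εbar) (hδ : 2 * δ * τ * N0 * η ≤ εbar) :
    τ * ‖(P.step r η cl z w T x d p).1 - p.1‖ ≤ εbar := by
  have hsum := norm_step_sub_le_sum (z := z) hA hs hp hK hx hd
  refine (mul_le_mul_of_nonneg_left hsum hτ).trans ?_
  set C := univ.filter (fun i => cl i = z) with hC
  rcases C.eq_empty_or_nonempty with h0 | h0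
  · rw [h0, Finset.sum_empty, mul_zero]; exact hε
  have hcpos : (0 : ℝ) < C.card := by exact_mod_cast h0.card_pos
  have h1 : ∑ i ∈ C, w i * ‖p.1 i - p.2 i‖ * (2 * τ) ≤ εbar := by
    have h2 : ∀ i ∈ C, w i * ‖p.1 i - p.2 i‖ * (2 * τ) ≤ εbar / C.card := fun i hi => by
      have h3 := hw i
      rw [(mem_filter.1 hi).2, ← hC] at h3
      rw [le_div_iff₀ hcpos]
      linarith
    refine (Finset.sum_le_card_nsmul _ _ _ h2).trans (le_of_eq ?_)
    rw [nsmul_eq_mul, mul_div_cancel₀ _ hcpos.ne']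
  have h2 : 2 * τ * (C.card * (η * δ)) ≤ εbar := by
    have h3 : (C.card : ℝ) ≤ N0 := by exact_mod_cast hcard
    have h4 := mul_le_mul_of_nonneg_left h3
      (mul_nonneg (mul_nonneg hτ hs.eta_pos.le) hδ0)
    linarith
  rw [← Finset.sum_mul] at h1
  rw [Finset.sum_add_distrib, Finset.sum_const, nsmul_eq_mul]
  linarith

/-- The distance of the iterates within one cycle. -/
theorem norm_sub_le_of_mul_norm_step_le {E : Type*} [SeminormedAddCommGroup E] {v : ℕ → E}
    {T₀ TK : ℕ} {εbar : ℝ} (hε : 0 ≤ εbar)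
    (hv : ∀ k < TK, ((T₀ : ℝ) - 1) * ‖v (k + 1) - v k‖ ≤ εbar) {k l : ℕ} (hkl : k ≤ l)
    (hl : l < k + T₀) (hlT : l < TK) : ‖v l - v k‖ ≤ εbar := by
  rcases hkl.eq_or_lt with rfl | hlt
  · simpa using hε
  have hT : (0 : ℝ) < T₀ - 1 := by
    have : (1 : ℝ) < T₀ := by exact_mod_cast (by omega : 1 < T₀)
    linarith
  have h1 : ‖v l - v k‖ ≤ ∑ j ∈ Finset.Ico k l, ‖v (j + 1) - v j‖ := by
    rw [← Finset.sum_Ico_sub v hkl]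
    exact norm_sum_le _ _
  have h2 : ∀ j ∈ Finset.Ico k l, ‖v (j + 1) - v j‖ ≤ εbar / (T₀ - 1) := fun j hj => by
    rw [le_div_iff₀ hT, mul_comm]
    exact hv j ((Finset.mem_Ico.1 hj).2.trans hlT)
  refine (h1.trans (Finset.sum_le_card_nsmul _ _ _ h2)).trans ?_
  rw [Nat.card_Ico, nsmul_eq_mul]
  have h3 : ((l - k : ℕ) : ℝ) ≤ T₀ - 1 := by
    have : ((l - k : ℕ) : ℝ) + 1 ≤ T₀ := by exact_mod_cast (by omega : l - k + 1 ≤ T₀)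
    linarith
  calc ((l - k : ℕ) : ℝ) * (εbar / (T₀ - 1)) ≤ (T₀ - 1) * (εbar / (T₀ - 1)) := by gcongr
    _ = εbar := mul_div_cancel₀ _ hT.ne'

/-- A bound for a single gradient, used for the steps after the last complete cycle. -/
theorem mul_norm_gradient_sq_le (hA : P.LocalBound A lam φ ρ B) {K : P.Pol} (hK : K ∈ A)
    {τ εbar ε N0 TK : ℝ} (hη : 0 < η) (hτ : 0 ≤ τ) (hε0 : 0 < εbar) (hερ : εbar ≤ ρ)
    (hN0 : 1 ≤ N0) (hlam : 2 * lam ≤ δ) (hδ : 2 * δ * τ * N0 * η ≤ εbar)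
    (hJ : P.J K ≤ TK * (η * ε)) (hTK : 0 ≤ TK * ε) :
    τ * ‖gradient P.J K‖ ^ 2 ≤ TK * ε / 2 + τ * ((φ * εbar) ^ 2 / 4) := by
  set a := ‖gradient P.J K‖ with ha
  have ha0 : 0 ≤ a := norm_nonneg _
  have h1 : εbar * a ≤ P.J K + φ / 2 * εbar ^ 2 :=
    mul_norm_gradient_le hε0 hA.phi_nonneg (fun y hy => hA.differentiableAt hK (hy.trans hερ))
      (fun y hy => hA.grad K hK y (hy.trans hερ)) fun y _ => P.J_nonneg y
  have h2 : 2 * a ≤ δ := by linarith [hA.norm_gradient_le hK]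
  have h3 : 4 * a * τ * η ≤ εbar := by
    have h4 : 2 * (2 * a) * τ * η ≤ 2 * δ * τ * η := by gcongr
    have h5 : 2 * δ * τ * η * 1 ≤ 2 * δ * τ * η * N0 := by
      have : 0 ≤ δ := by linarith
      gcongr
    linarith
  have h4 : 4 * (τ * a * P.J K) ≤ εbar * (TK * ε) := by
    have h5 := mul_le_mul_of_nonneg_left hJ (by positivity : 0 ≤ τ * a)
    have h6 := mul_le_mul_of_nonneg_right h3 hTK
    linarith
  have h5 := mul_le_mul_of_nonneg_left h1 (by positivity : 0 ≤ τ * a)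
  have h6 : εbar * (τ * a ^ 2) ≤ εbar * (TK * ε / 4 + τ * a * (φ * εbar) / 2) := by
    linarith
  have h7 := le_of_mul_le_mul_left h6 hε0
  have h8 := mul_nonneg hτ (sq_nonneg (a - φ * εbar / 2))
  linarith

end Distance

end MultiAgentLQR

/-! ### Convergence of the algorithm -/

theorem theorem2 {N n m : ℕ} (hN : 0 < N) (hn : 0 < n) (hm : 0 < m)
    (P : MultiAgentLQR N n m) :
    -- the costs are well defined and the constants in the bounds exist
    (∀ K ∈ P.stab, P.Regular K) ∧
    (∃ lam zet phi bet : P.Pol → ℝ, P.LocalParams lam zet phi bet) ∧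
    (∃ c : ℝ, P.CostRatio c) ∧
    -- for every choice of these constants and of the parameters
    ∀ (lam zet phi bet : P.Pol → ℝ), P.LocalParams lam zet phi bet →
    ∀ c : ℝ, P.CostRatio c →
    ∀ K0 ∈ P.stab,
    ∀ ε ν γ α : ℝ, 0 < ε → 0 < ν → 0 < γ → 2 + γ + 1 / ν + ν * γ ≤ α →
    ∀ αi : Fin N → ℝ, (∀ i, 1 < αi i) →
    (∀ K ∈ P.stab, P.J K ≤ α * P.J K0 → ∀ i, P.localJ i K ≤ αi i * P.localJ i K0) →
    ∀ phi0 lam0 rho0 κ0 : ℝ,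
    IsLUB (phi '' P.levelSet K0 α αi) phi0 →
    IsLUB (lam '' P.levelSet K0 α αi) lam0 →
    IsGLB (bet '' P.levelSet K0 α αi ∪ zet '' P.levelSet K0 α αi) rho0 →
    IsLUB ((fun K => matSpectralNorm (P.discLoop (P.gain K))) ''
      P.blockNhd (P.levelSet K0 α αi) rho0) κ0 →
    ∀ ε' : ℝ, 0 < ε' →
    -- a long enough horizon
    ∃ Tbar : ℝ,
    -- the inputs of the algorithm
    ∀ (r : Fin N → ℝ) (η : ℝ) (s : ℕ) (cl : Fin N → Fin s) (z : ℕ → Fin s) (TK : ℕ),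
    P.IsClustering cl →
    ∀ (Ni : Fin N → ℕ) (N0 : ℕ) (δ : ℝ) (S : ℝ),
    (∀ i, Ni i = (univ.filter fun j => cl j = cl i).card) →
    N0 = univ.sup Ni →
    δ = P.gradBound K0 αi r c lam0 rho0 ε' →
    S = Real.sqrt (γ * ε / (α * N0)) →
    -- the conditions on the parameters
    TK = ⌈2 * α * ν * P.J K0 / (η * ε)⌉₊ →
    0 < η → η ≤ 1 →
    η ≤ rho0 / (2 * δ * Real.sqrt N0) →
    η ≤ 2 * α * P.J K0 / (γ * ε) →
    η ≤ γ * ε / (2 * α * N0 * (phi0 * δ ^ 2 + 4 * phi0 ^ 2 + phi0 + 4)) →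
    ε' ≤ (⨅ i, r i) / (4 * P.dimMax) * S →
    (∀ i, 0 < r i ∧ r i ≤ rho0 / 2 ∧ r i ≤ 1 / (4 * phi0) * S) →
    -- the random inputs and the iterates
    ∀ (Ω : Type u) [MeasurableSpace Ω] (μ : Measure Ω) [IsProbabilityMeasure μ]
      (ℱ : Filtration ℕ (inferInstance : MeasurableSpace Ω))
      (w : ℕ → Fin N → Ω → ℝ) (T : ℕ → Ω → ℕ) (x : ℕ → Ω → P.State)
      (d : ℕ → Ω → ∀ i, P.Blk i) (K Kprev : ℕ → Ω → P.Pol),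
    P.Sampling μ ℱ w T x d →
    (∀ k ω, (K k ω, Kprev k ω) =
      P.run K0 r η cl z (fun l i => w l i ω) (fun l => T l ω) (fun l => x l ω)
        (fun l => d l ω) k) →
    (∀ᵐ ω ∂μ, ∀ k < TK, ∀ i, 0 ≤ w k i ω ∧
      w k i ω * ‖K k ω i - Kprev k ω i‖ ≤
        min (η ^ (3 / 2 : ℝ)) (rho0 / (2 * Real.sqrt (Ni i)))) →
    (∀ᵐ ω ∂μ, ∀ k < TK, Tbar ≤ T k ω ∨
      (κ0 < 1 ∧ ∀ i, P.horizonBound K0 αi lam0 rho0 κ0 ε' (x k ω) i ≤ T k ω)) →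
    -- the cluster blocks of the gradient
    (1 - 1 / α * (2 + γ + 1 / ν + ν * γ) ≤
      μ.real {ω | (∀ k < TK, K k ω ∈ P.stab) ∧
        1 / (TK : ℝ) * ∑ k ∈ range TK, ∑ i ∈ univ.filter (fun i => cl i = z k),
          ‖gradient P.J (K k ω) i‖ ^ 2 < ε}) ∧
    -- the full gradient, under essentially cyclic updates
    (∀ (T0 : ℕ) (εbar : ℝ), s ≤ T0 →
      (∀ (j : Fin s) (k₁ k₂ : ℕ), k₂ + 1 = k₁ + T0 → k₂ < TK →
        ∃ k₀, k₁ ≤ k₀ ∧ k₀ ≤ k₂ ∧ z k₀ = j) →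
      0 < εbar → εbar ≤ rho0 →
      (∀ᵐ ω ∂μ, ∀ k < TK, ∀ i,
        2 * ((T0 : ℝ) - 1) * Ni i * (w k i ω * ‖K k ω i - Kprev k ω i‖) ≤ εbar) →
      2 * δ * ((T0 : ℝ) - 1) * N0 * η ≤ εbar →
      1 - 1 / α * (2 + γ + 1 / ν + ν * γ) ≤
        μ.real {ω | (∀ k < TK, K k ω ∈ P.stab) ∧
          1 / (TK : ℝ) * ∑ k ∈ range TK, ‖gradient P.J (K k ω)‖ ^ 2 <
            2 * T0 * (ε + phi0 ^ 2 * εbar ^ 2)}) := by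
  have hne : Nonempty (Fin n × Fin N) := ⟨(⟨0, hn⟩, ⟨0, hN⟩)⟩
  have hnt : ∀ i, Nontrivial (P.Blk i) := P.nontrivial_blk hn hm
  refine ⟨fun K hK => P.regular hK, P.exists_localParams, P.exists_costRatio, ?_⟩
  intro lam zet phi bet hlp c hc K0 hK0 ε ν γ α hε hν hγ hα αi hαi hJi phi0 lam0 rho0 κ0 hphi hlam
    hrho hκ ε' hε'
  have hν' : 0 < 1 / ν := by positivity
  have hνγ : 0 < ν * γ := by positivity
  have hα0 : 0 < α := by linarith
  have hαi0 : ∀ i, 0 ≤ αi i := fun i => by linarith [hαi i]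
  have hJ0 := P.J_nonneg K0
  have hK0α : K0 ∈ P.levelSet K0 α αi := by
    have h : P.J K0 ≤ α * P.J K0 := by nlinarith
    exact ⟨hK0, h, hJi K0 hK0 h⟩
  -- the radii force `rho0` to be positive, so that otherwise any horizon will do
  by_cases hρ : 0 < rho0
  swap
  · refine ⟨0, fun r η s cl z TK _ Ni N0 δ S _ _ _ _ _ _ _ _ _ _ _ hr => ?_⟩
    have := hr ⟨0, hN⟩
    exact absurd (by linarith : 0 < rho0) hρ
  have hA := P.localBound_levelSet hlp hK0α hphi hlam hrho hρ
  obtain ⟨Tbar, hTbar⟩ := P.exists_horizon_goodSample hm hc hA hκ hε'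
  refine ⟨Tbar, ?_⟩
  intro r η s cl z TK _ Ni N0 δ S hNi hN0 hδ hS hTK hη hη1 hηρ hηJ hηq hεS hr Ω _ μ _ ℱ w T x d K
    Kprev hsamp hrun hw hT
  have hc1 := P.one_le_of_costRatio hN hn hm hc hK0
  obtain ⟨hN0pos, hκ', hs⟩ := P.stepSize_of_le hN hn hm hc1 hA.phi_nonneg hA.lam_nonneg hρ hε' hαi0
    hγ hε hα0 hNi hN0 hδ hS hη hη1 hηρ hηq hεS hr
  obtain ⟨hδlam, hδ0⟩ : 2 * lam0 ≤ δ ∧ 0 < δ := hδ ▸ P.two_mul_le_gradBound hN hn hm hc1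
    hA.lam_nonneg hρ hε' hαi0 (fun i => (hr i).1) fun i => (hr i).2.1
  have hcard : ∀ z, (univ.filter fun i => cl i = z).card ≤ N0 := fun z => by
    rw [hN0]; exact MultiAgentLQR.card_cluster_le hNi z
  -- the bound on the step-size rules out a vanishing initial cost
  have hJpos : 0 < P.J K0 := by
    rw [le_div_iff₀ (by positivity)] at hηJ
    have h1 : 0 < 2 * α * P.J K0 := lt_of_lt_of_le (by positivity) hηJ
    exact pos_of_mul_pos_right h1 (by positivity)
  have hTKpos : 0 < TK := by rw [hTK, Nat.ceil_pos]; positivity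
  have hTKR : (0 : ℝ) < TK := by exact_mod_cast hTKpos
  have hTK1 : 2 * α * ν * P.J K0 / (η * ε) ≤ TK := by rw [hTK]; exact Nat.le_ceil _
  have hTK2 : (TK : ℝ) ≤ 2 * α * ν * P.J K0 / (η * ε) + 1 := by
    rw [hTK]; exact (Nat.ceil_lt_add_one (by positivity)).le
  obtain ⟨hpM, hpb⟩ := initial_cost_add_errors_le hJpos hα0 hν hγ hε hη hηJ hTK1 hTK2
  rw [← hκ'] at hpM hpb
  have hαν : 1 ≤ α * ν := by
    have h1 : 1 / ν ≤ α := by linarith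
    rwa [div_le_iff₀ hν] at h1
  -- the level at which the descent is stopped: `α` keeps the iterates in the level set, and
  -- `2 * α * ν` bounds the cost by `TK * η * ε`, which is needed after the last complete cycle
  set M := min (α * P.J K0) (2 * α * ν * P.J K0) with hM
  set A : Set P.Pol := {K | K ∈ P.stab ∧ P.J K ≤ M} with hAdef
  have hsub : A ⊆ P.levelSet K0 α αi := fun K hK => by
    have h1 := hK.2.trans (min_le_left _ _)
    exact ⟨hK.1, h1, hJi K hK.1 h1⟩
  have hA' := hA.mono hsub
  have hK0M : P.J K0 ≤ M := le_min (by nlinarith) (by nlinarith)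
  have hx : ∀ᵐ ω ∂μ, ∀ k < TK, P.GoodSample A rho0 c ε' (x k ω) (T k ω) := by
    have h1 : ∀ᵐ ω ∂μ, ∀ k, ∀ t : ℕ, (Tbar ≤ t ∨
        (κ0 < 1 ∧ ∀ i, P.horizonBound K0 αi lam0 rho0 κ0 ε' (x k ω) i ≤ t)) →
        P.GoodSample (P.levelSet K0 α αi) rho0 c ε' (x k ω) t :=
      ae_all_iff.2 fun k => hsamp.ae_state k hTbar
    filter_upwards [h1, hT] with ω h2 h3 k hk K hK
    exact h2 k _ (h3 k hk) K (hsub hK)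
  have hp : ∀ᵐ ω ∂μ, ∀ k < TK,
      P.SmallPast η rho0 cl (fun i => w k i ω) (K k ω, Kprev k ω) := by
    filter_upwards [hw] with ω h1 k hk i
    have h2 := h1 k hk i
    rw [le_min_iff, hNi] at h2
    exact h2
  have hgood := hsamp.one_sub_le_measureReal_good (b := η * TK * ε / 2) hrun hA' hs hc hK0 hK0M
    hcard (fun k hk => hx.mono fun ω h => h k hk) (fun k hk => hp.mono fun ω h => h k hk)
    (hJpos.trans_le hK0M) (by positivity) hpM hpb
  have hsum : ∀ ω, ∑ k ∈ range TK, η / 2 * ∑ i ∈ univ.filter (fun i => cl i = z k),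
        ‖gradient P.J (K k ω) i‖ ^ 2 < η * TK * ε / 2 →
      ∑ k ∈ range TK, ∑ i ∈ univ.filter (fun i => cl i = z k),
        ‖gradient P.J (K k ω) i‖ ^ 2 < TK * ε := fun ω h => by
    rw [← Finset.mul_sum] at h
    refine lt_of_mul_lt_mul_left (h.trans_eq ?_) (by positivity : 0 ≤ η / 2)
    ring
  constructor
  · refine hgood.trans (measureReal_mono fun ω hω => ⟨fun k hk => (hω.1 k hk.le).1, ?_⟩)
    rw [one_div, inv_mul_lt_iff₀ hTKR]
    exact hsum ω hω.2
  · intro T0 εbar hsT hcyc hε0 hερ hwbar hδbar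
    have hT0 : 0 < T0 := lt_of_lt_of_le (Fin.pos (cl ⟨0, hN⟩)) hsT
    have hτ : (0 : ℝ) ≤ (T0 : ℝ) - 1 := by
      have : (1 : ℝ) ≤ T0 := by exact_mod_cast hT0
      linarith
    have hN01 : (1 : ℝ) ≤ N0 := by exact_mod_cast hN0pos
    refine hgood.trans (ENNReal.toReal_mono (measure_ne_top _ _) (measure_mono_ae ?_))
    filter_upwards [hx, hp, hwbar, ae_all_iff.2 hsamp.ae_norm_eq_one] with ω hxω hpω hwω hdω hω
    have hKA : ∀ k ≤ TK, K k ω ∈ A := hω.1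
    refine ⟨fun k hk => (hKA k hk.le).1, ?_⟩
    have hmove : ∀ k < TK, ((T0 : ℝ) - 1) * ‖K (k + 1) ω - K k ω‖ ≤ εbar := by
      intro k hk
      rw [MultiAgentLQR.run_succ_fst hrun]
      refine MultiAgentLQR.mul_norm_step_sub_le hA' hs (hpω k hk) (hKA k hk.le) (hxω k hk) (hdω k)
        hτ hδ0.le hε0.le (hcard (z k)) (fun i => ?_) hδbar
      have h := hwω k hk i
      rwa [hNi] at h
    rw [one_div, inv_mul_lt_iff₀ hTKR]
    have hfin := sum_norm_sq_lt_of_cyclic (v := fun k => gradient P.J (K k ω)) (y := phi0 * εbar)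
      (cl := cl) hT0 hTKpos hε hsT hcyc ?_ ?_ (hsum ω hω.2)
    · refine hfin.trans_eq ?_
      ring
    · intro k l hkl hl hlT
      have h1 := MultiAgentLQR.norm_sub_le_of_mul_norm_step_le (v := fun k => K k ω)
        hε0.le hmove hkl hl hlT
      exact (hA'.grad _ (hKA k (hkl.trans hlT.le)) _ (h1.trans hερ)).trans
        (mul_le_mul_of_nonneg_left h1 hA.phi_nonneg)
    · intro k hk
      refine MultiAgentLQR.mul_norm_gradient_sq_le hA' (hKA k hk.le) hη hτ hε0 hερ hN01 hδlam
        hδbar ?_ (by positivity)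
      refine ((hKA k hk.le).2.trans (min_le_right _ _)).trans ?_
      rwa [div_le_iff₀ (by positivity)] at hTK1
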